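/- Setting. Let $n\ge 1$. Let $W\in C^{2,1}[0,1]$ be a double-well potential: $W(0)=W(1)=0$, $W>0$ on $(0,1)$, $W'(0)=W'(1)=0$, $W''(0),W''(1)>0$, $\int_0^1\sqrt{W}=1$. Set $V(t)=\big(\int_0^t\sqrt{W(s)}\,ds\big)^{(n+1)/n}$ for $t\in[0,1]$. Let $\mathbf W\subset\mathbb R^{n+1}$ be compact, $\Omega=\mathbb R^{n+1}\setminus\mathbf W$, and let $\mathcal C$ be a spanning class for $\mathbf W$, i.e. a family of smooth embeddings $\gamma:\mathbb S^1\to\Omega$ such that $H(\cdot,1)\in\mathcal C$ whenever $H\in C^\infty(\mathbb S^1\times[0,1];\Omega)$, every $H(\cdot,t)$ is a smooth embedding and $H(\cdot,0)\in\mathcal C$. For a Borel set $A\subset\mathbb R^{n+1}$ let $A^{(\theta)}$ be its set of points of Lebesgue density $\theta$ and $\partial^eA=\mathbb R^{n+1}\setminus(A^{(0)}\cup A^{(1)})$. A set $S$ essentially disconnects $T$ into $\{T_1,T_2\}$ if $T_1,T_2$ are Borel, $|T\Delta(T_1\cup T_2)|=|T_1\cap T_2|=0$, $|T_1|\,|T_2|>0$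 and $\mathcal H^n\big((T^{(1)}\cap\partial^eT_1\cap\partial^eT_2)\setminus S\big)=0$. A Borel set $S\subset\Omega$ is $\mathcal C$-spanning $\mathbf W$ if for every $\gamma\in\mathcal C$ and every diffeomorphism $\Psi$ of $\mathbb S^1\times\overline{B_1^n}$ onto a compact subset of $\Omega$ with $\Psi(\cdot,0)=\gamma$, setting $T=\Psi(\mathbb S^1\times B_1^n)$ and $T[s]=\Psi(\{s\}\times B_1^n)$, the following holds for a.e. $s\in\mathbb S^1$: for $\mathcal H^n$-a.e. $x\in T[s]$ there is $\{T_1,T_2\}$ with $x\in\partial^eT_1\cap\partial^eT_2$ such that $S\cup T[s]$ essentially disconnects $T$ into $\{T_1,T_2\}$. Given $v>0$, $\varepsilon>0$, $\delta\in(1/2,1]$, let $$\Upsilon(v,\varepsilon,\delta)=\inf\ \frac12\int_\Omega\Big(\varepsilon|\nabla u|^2+\frac{W(u)}{\varepsilon}\Big)$$ over all $u\in W^{1,2}_{\rm loc}(\Omega;[0,1])$ such that $\int_\Omega V(u)=v$ and $\{u^*\ge t\}$ is $\mathcal C$-spanning $\mathbf W$ for every $t\in(1/2,\delta)$, where $u^*$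 is the precise representative of $u$, defined at those points of $\Omega$ where the approximate upper and lower limits of $u$ agree and equal there to their common value. A minimizer is a competitor which attains the infimum and has finite energy. Theorem. Let $u$ be a minimizer of $\Upsilon(v,\varepsilon,\delta)$. Then there is $\lambda\in\mathbb R$ such that, for every $X\in C_c^\infty(\Omega;\mathbb R^{n+1})$, $$\int_\Omega\Big(\varepsilon|\nabla u|^2+\frac{W(u)}\varepsilon\Big)\,{\rm div}\,X-2\varepsilon\,\nabla u\cdot\nabla X[\nabla u]=\lambda\int_\Omega V(u)\,{\rm div}\,X\,,$$ and, with the same $\lambda$, $$(\delta-u)\,\big\{2\varepsilon^2\Delta u-W'(u)+\varepsilon\lambda V'(u)\big\}=0\qquad\text{in }\Omega$$ in the sense of distributions, that is, for every $\varphi\in C_c^\infty(\Omega)$, $$2\varepsilon\int_\Omega|\nabla u|^2\varphi=\int_\Omega(\delta-u)\Big\{2\varepsilon\,\nabla u\cdot\nabla\varphi+\Big(\frac{W'(u)}\varepsilon-\lambda V'(u)\Big)\varphi\Big\}\,.$$ Moreover, the limit of the averages of $u$ over the balls $B_r(x)$ as $r\to0^+$ exists at every $x\in\Omega$, and $u$,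 identified with the Lebesgue representative defined by these limits, is lower semicontinuous in $\Omega$. If $\Omega'$ is a connected component of $\Omega$, then either $u\equiv0$ on $\Omega'$ or $u>0$ on $\Omega'$. If $\delta<1$, then on each connected component $\Omega'$ of $\Omega$ we have $u<1$, unless $\Omega'$ is bounded and $u\equiv1$ on $\Omega'$; in particular $u<1$ in $\Omega$ whenever $\Omega$ is connected. -/

import Mathlib

open MeasureTheory Set Filter Topology
open scoped ContDiff ENNReal

noncomputable section

namespace ACPlateau

/-- The ambient space `ℝ^{n+1}`. -/
abbrev Amb (n : ℕ) : Type := EuclideanSpace ℝ (Fin (n + 1))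

/-- The cross-section space `ℝ^n`. -/
abbrev Cross (n : ℕ) : Type := EuclideanSpace ℝ (Fin n)

/-! ### The potentials -/

/-- The derivative of a function on the interval `[0,1]` (one-sided at the end points). -/
def deriv01 (f : ℝ → ℝ) (t : ℝ) : ℝ := derivWithin f (Icc 0 1) t

/-- Nondegenerate, normalized double-well potentials of class `C^{2,1}[0,1]`, with wells `0`, `1`. -/
structure IsDoubleWell (W : ℝ → ℝ) : Prop where
  contDiffOn : ContDiffOn ℝ 2 W (Icc 0 1)
  lipschitz : ∃ L, LipschitzOnWith L (iteratedDerivWithin 2 W (Icc 0 1)) (Icc 0 1)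
  zero : W 0 = 0
  one : W 1 = 0
  pos : ∀ t ∈ Ioo (0 : ℝ) 1, 0 < W t
  deriv_zero : deriv01 W 0 = 0
  deriv_one : deriv01 W 1 = 0
  deriv2_zero : 0 < iteratedDerivWithin 2 W (Icc 0 1) 0
  deriv2_one : 0 < iteratedDerivWithin 2 W (Icc 0 1) 1
  normalized : ∫ t in (0 : ℝ)..1, Real.sqrt (W t) = 1

/-- `Φ(t) = ∫₀ᵗ √W`. -/
def phi (W : ℝ → ℝ) (t : ℝ) : ℝ := ∫ s in (0 : ℝ)..t, Real.sqrt (W s)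

/-- The volume density potential `V = Φ^{(n+1)/n}`. -/
def volPot (n : ℕ) (W : ℝ → ℝ) (t : ℝ) : ℝ := phi W t ^ (((n : ℝ) + 1) / (n : ℝ))

/-! ### Density points and essential disconnection -/

/-- `A^{(θ)}`: the points of Lebesgue density `θ` of `A`. -/
def densityPts {n : ℕ} (θ : ℝ≥0∞) (A : Set (Amb n)) : Set (Amb n) :=
  {x | Tendsto (fun r : ℝ => volume (A ∩ Metric.ball x r) / volume (Metric.ball x r))
    (𝓝[>] 0) (𝓝 θ)}

/-- The essential boundary `∂ᵉA = ℝ^{n+1} \ (A^{(0)} ∪ A^{(1)})`. -/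
def essBdry {n : ℕ} (A : Set (Amb n)) : Set (Amb n) := (densityPts 0 A ∪ densityPts 1 A)ᶜ

/-- `S` essentially disconnects `T` into the non-trivial Lebesgue partition `{T₁, T₂}`. -/
structure EssDisconnects {n : ℕ} (S T T₁ T₂ : Set (Amb n)) : Prop where
  meas₁ : MeasurableSet T₁
  meas₂ : MeasurableSet T₂
  cover : volume (symmDiff T (T₁ ∪ T₂)) = 0
  disj : volume (T₁ ∩ T₂) = 0
  pos₁ : 0 < volume T₁
  pos₂ : 0 < volume T₂
  bdry : Measure.hausdorffMeasure (n : ℝ) ((densityPts 1 T ∩ essBdry T₁ ∩ essBdry T₂) \ S) = 0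

/-! ### Homotopic spanning; the circle is `ℝ/ℤ` -/

/-- Smooth embeddings of the circle into `Ω`. -/
structure IsLoop {n : ℕ} (Ω : Set (Amb n)) (γ : UnitAddCircle → Amb n) : Prop where
  smooth : ContDiff ℝ ∞ (fun t : ℝ => γ (t : UnitAddCircle))
  injective : Function.Injective γ
  immersion : ∀ t : ℝ, deriv (fun t : ℝ => γ (t : UnitAddCircle)) t ≠ 0
  mem : ∀ s, γ s ∈ Ω

/-- Families of smooth embeddings of the circle into `Ω`, closed under smooth isotopies in `Ω`. -/
structure IsSpanningClass {n : ℕ} (Ω : Set (Amb n)) (C : Set (UnitAddCircle → Amb n)) : Prop where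
  loop : ∀ γ ∈ C, IsLoop Ω γ
  isotopy : ∀ H : UnitAddCircle → ℝ → Amb n,
    ContDiffOn ℝ ∞ (fun p : ℝ × ℝ => H (p.1 : UnitAddCircle) p.2) (univ ×ˢ Icc 0 1) →
    (∀ t ∈ Icc (0 : ℝ) 1, IsLoop Ω (fun s => H s t)) →
    (fun s => H s 0) ∈ C → (fun s => H s 1) ∈ C

/-- `Φ` is a diffeomorphism (up to the boundary) of `𝕊¹ × cl(B₁ⁿ)` onto a compact subset of `Ω`
whose core curve is `γ`. -/
structure IsTube {n : ℕ} (Ω : Set (Amb n)) (γ : UnitAddCircle → Amb n)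
    (Φ : UnitAddCircle → Cross n → Amb n) : Prop where
  smooth : ContDiffOn ℝ ∞ (fun p : ℝ × Cross n => Φ (p.1 : UnitAddCircle) p.2)
    (univ ×ˢ Metric.closedBall 0 1)
  injOn : InjOn (fun p : UnitAddCircle × Cross n => Φ p.1 p.2) (univ ×ˢ Metric.closedBall 0 1)
  immersion : ∀ p ∈ (univ : Set ℝ) ×ˢ Metric.closedBall (0 : Cross n) 1,
    Function.Injective (fderivWithin ℝ (fun p : ℝ × Cross n => Φ (p.1 : UnitAddCircle) p.2)
      (univ ×ˢ Metric.closedBall 0 1) p)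
  core : ∀ s, Φ s 0 = γ s
  mem : ∀ s, ∀ y ∈ Metric.closedBall (0 : Cross n) 1, Φ s y ∈ Ω

/-- The slice `T[s] = Φ({s} × B₁ⁿ)`. -/
def slice {n : ℕ} (Φ : UnitAddCircle → Cross n → Amb n) (s : UnitAddCircle) : Set (Amb n) :=
  Φ s '' Metric.ball 0 1

/-- The open tube `T = Φ(𝕊¹ × B₁ⁿ)`. -/
def tube {n : ℕ} (Φ : UnitAddCircle → Cross n → Amb n) : Set (Amb n) := ⋃ s, slice Φ s

/-- The measure theoretic notion of `S` being `C`-spanning. -/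
def IsSpanning {n : ℕ} (Ω : Set (Amb n)) (C : Set (UnitAddCircle → Amb n))
    (S : Set (Amb n)) : Prop :=
  ∀ γ ∈ C, ∀ Φ : UnitAddCircle → Cross n → Amb n, IsTube Ω γ Φ →
    ∀ᵐ s : UnitAddCircle,
      ∀ᵐ x ∂((Measure.hausdorffMeasure (n : ℝ)).restrict (slice Φ s)),
        ∃ T₁ T₂ : Set (Amb n), x ∈ essBdry T₁ ∩ essBdry T₂ ∧
          EssDisconnects (S ∪ slice Φ s) (tube Φ) T₁ T₂

/-! ### The precise representative -/

/-- The approximate upper limit `u⁺(x) = inf {t ∈ ℝ : x ∈ {u > t}^{(0)}}`. -/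
def approxSup {n : ℕ} (Ω : Set (Amb n)) (u : Amb n → ℝ) (x : Amb n) : EReal :=
  sInf ((fun t : ℝ => (t : EReal)) '' {t : ℝ | x ∈ densityPts 0 {y | y ∈ Ω ∧ t < u y}})

/-- The approximate lower limit `u⁻(x) = sup {t ∈ ℝ : x ∈ {u < t}^{(0)}}`. -/
def approxInf {n : ℕ} (Ω : Set (Amb n)) (u : Amb n → ℝ) (x : Amb n) : EReal :=
  sSup ((fun t : ℝ => (t : EReal)) '' {t : ℝ | x ∈ densityPts 0 {y | y ∈ Ω ∧ u y < t}})

/-- The superlevel set `{u* ≥ t}`, where the precise representative `u* = u⁺ = u⁻` is defined at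
those points of `Ω` where the approximate upper and lower limits agree. -/
def superlevel {n : ℕ} (Ω : Set (Amb n)) (u : Amb n → ℝ) (t : ℝ) : Set (Amb n) :=
  {x | x ∈ Ω ∧ approxInf Ω u x = approxSup Ω u x ∧ (t : EReal) ≤ approxSup Ω u x}

/-! ### Sobolev functions -/

/-- `C_c^∞(Ω; F)`. -/
structure IsTest {n : ℕ} {F : Type*} [NormedAddCommGroup F] [NormedSpace ℝ F]
    (Ω : Set (Amb n)) (φ : Amb n → F) : Prop where
  smooth : ContDiff ℝ ∞ φ
  compact : HasCompactSupport φ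
  support : tsupport φ ⊆ Ω

/-- `u ∈ W^{1,2}_loc(Ω)` with weak gradient `∇u = G`. -/
structure IsW12loc {n : ℕ} (Ω : Set (Amb n)) (u : Amb n → ℝ) (G : Amb n → Amb n) : Prop where
  memLp : ∀ K ⊆ Ω, IsCompact K → MemLp u 2 (volume.restrict K)
  memLp_grad : ∀ K ⊆ Ω, IsCompact K → MemLp G 2 (volume.restrict K)
  weak : ∀ φ : Amb n → ℝ, IsTest Ω φ → ∀ e : Amb n,
    ∫ x in Ω, u x * fderiv ℝ φ x e = - ∫ x in Ω, inner ℝ (G x) e * φ x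

/-- The divergence of a vector field. -/
def divergence {n : ℕ} (X : Amb n → Amb n) (x : Amb n) : ℝ :=
  ∑ i, fderiv ℝ X x (EuclideanSpace.single i 1) i

/-! ### The variational problem -/

/-- The Allen–Cahn energy density `ε |∇u|² + W(u)/ε`. -/
def acDensity {n : ℕ} (W : ℝ → ℝ) (ε : ℝ) (u : Amb n → ℝ) (G : Amb n → Amb n) (x : Amb n) : ℝ :=
  ε * ‖G x‖ ^ 2 + W (u x) / ε

/-- The Allen–Cahn energy of `u` (with `∇u = G`) in `Ω`. -/
def acEnergy {n : ℕ} (W : ℝ → ℝ) (ε : ℝ) (Ω : Set (Amb n)) (u : Amb n → ℝ)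
    (G : Amb n → Amb n) : ℝ≥0∞ :=
  ∫⁻ x in Ω, ENNReal.ofReal (acDensity W ε u G x)

/-- The competitors `u ∈ W^{1,2}_loc(Ω; [0,1])` (with `∇u = G`) in `Υ(v, ε, δ)`. -/
structure IsCompetitor {n : ℕ} (W : ℝ → ℝ) (Ω : Set (Amb n)) (C : Set (UnitAddCircle → Amb n))
    (v δ : ℝ) (u : Amb n → ℝ) (G : Amb n → Amb n) : Prop where
  sobolev : IsW12loc Ω u G
  range : ∀ᵐ x ∂(volume.restrict Ω), u x ∈ Icc (0 : ℝ) 1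
  volume_eq : ∫⁻ x in Ω, ENNReal.ofReal (volPot n W (u x)) = ENNReal.ofReal v
  spanning : ∀ t ∈ Ioo (1 / 2 : ℝ) δ, IsSpanning Ω C (superlevel Ω u t)

/-- The infimum `Υ(v, ε, δ)` of half the Allen–Cahn energy. -/
def Upsilon {n : ℕ} (W : ℝ → ℝ) (Ω : Set (Amb n)) (C : Set (UnitAddCircle → Amb n))
    (v ε δ : ℝ) : ℝ≥0∞ :=
  ⨅ (u : Amb n → ℝ) (G : Amb n → Amb n) (_ : IsCompetitor W Ω C v δ u G), acEnergy W ε Ω u G / 2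

/-- `u` (with `∇u = G`) is a minimizer of `Υ(v, ε, δ)`: a competitor attaining the finite
infimum. -/
structure IsMinimizer {n : ℕ} (W : ℝ → ℝ) (Ω : Set (Amb n)) (C : Set (UnitAddCircle → Amb n))
    (v ε δ : ℝ) (u : Amb n → ℝ) (G : Amb n → Amb n) : Prop where
  competitor : IsCompetitor W Ω C v δ u G
  finite : acEnergy W ε Ω u G ≠ ⊤
  attains : acEnergy W ε Ω u G / 2 = Upsilon W Ω C v ε δ

/-! ### Euler–Lagrange equations -/

/-- The Euler–Lagrange equation in inner variation form, with multiplier `lam`. -/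
def InnerEL {n : ℕ} (W : ℝ → ℝ) (Ω : Set (Amb n)) (ε lam : ℝ) (u : Amb n → ℝ)
    (G : Amb n → Amb n) : Prop :=
  ∀ X : Amb n → Amb n, IsTest Ω X →
    ∫ x in Ω, (acDensity W ε u G x * divergence X x
        - 2 * ε * inner ℝ (G x) (fderiv ℝ X x (G x)))
      = lam * ∫ x in Ω, volPot n W (u x) * divergence X x

/-- The distributional form of `(δ - u) {2ε²Δu - W'(u) + ε lam V'(u)} = 0` in `Ω`. -/
def OuterEL {n : ℕ} (W : ℝ → ℝ) (Ω : Set (Amb n)) (ε δ lam : ℝ) (u : Amb n → ℝ)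
    (G : Amb n → Amb n) : Prop :=
  ∀ φ : Amb n → ℝ, IsTest Ω φ →
    2 * ε * ∫ x in Ω, ‖G x‖ ^ 2 * φ x
      = ∫ x in Ω, (δ - u x) * (2 * ε * fderiv ℝ φ x (G x)
          + (deriv01 W (u x) / ε - lam * deriv01 (volPot n W) (u x)) * φ x)

end ACPlateau

end

noncomputable section

namespace ACPlateau

/-! ### Potentials extended by clamping -/

/-! Admissible variations. A minimizer is varied by replacing `u` with `(1 + b) u + a`, truncating
to `[0,1]`, and transporting the result by a diffeomorphism `id + s X` with `X` compactly supported
in `Ω`. Transport respects spanning because a spanning class is closed under isotopies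
(`IsSpanningClass.exists_diffeo`, `IsSpanning.image`). The change of values respects it when the
level `δ` is not lowered, since only levels `t < δ` are tested: it suffices that `a + δ b ≥ 0`
wherever the approximate limit of `u` is below some fixed `c > δ` (`exists_admissible`). Three
directions matter. The variation `u + φ (δ - u)`, that is `a = δ φ` and `b = -φ`, is admissible with
both signs of `φ` and yields the outer equation; `X` alone yields the inner one. Adding `φ ≥ 0` is
admissible with one sign only, and so is subtracting `φ ≥ 0` supported where `u ≥ c > δ`.

Multiplier. The volume is restored by a multiple of `φ₀ (δ - u)`, whose effect on the volume is `∫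
V'(u) (δ - u) φ₀` to first order. If some `φ₀` makes this nonzero, `lagrange_nonneg` gives one
multiplier serving all admissible directions, one-sided ones included. Otherwise `V'(u) (δ - u) = 0`
a.e., so `u` takes only the values `0`, `δ`, `1`; then `∇u = 0` and every conclusion holds with
multiplier `0`.

Differentiation. After a change of variables, energy and volume of a perturbation are integrals over
`Ω` of `jetDensity`, a pointwise function of `u`, `∇u` and the first order data of the perturbation.
A linear bound for its increments from the trivial jet allows differentiation under the integral
(`exists_hasFDerivAt_integral_jetDensity`). This gives differentiability at the origin and
continuity nearby, which is all the multiplier rule uses.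

Regularity. `W'` and `V'` vanish linearly at both wells, so the one-sided inequalities become `Δu ≤
K u` in `Ω` and `Δ(1 - u) ≤ K (1 - u)` where `u > c`. For a nonnegative `z` with `Δz ≤ K z`, the
quantity `exp(-K r²/4)` times the average of `z` on `B_r(x)` is nonincreasing in `r`
(`IsSupersol.antitoneOn_average`). Hence the averages converge, the limit is lower semicontinuous,
and a zero of it forces `z = 0` nearby; the last fact gives the alternative `u ≡ 0` or `u > 0` on
components.

The value 1. When `δ < 1`, the same principle for `1 - u` makes `{u = 1}` open. It is also
relatively closed: otherwise a ball inside it touches its complement at a point of `Ω`, where lower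
semicontinuity and the convergence of averages contradict each other (`one_le_of_touching`). So `u <
1` or `u ≡ 1` on each component. Since `V(1) = 1`, the latter needs finite volume, whereas an
unbounded component of the complement of a compact set contains arbitrarily large balls. -/

/-- The projection of the real line onto `[0,1]`. -/
def clamp (t : ℝ) : ℝ := max 0 (min t 1)

lemma clamp_mem (t : ℝ) : clamp t ∈ Icc (0 : ℝ) 1 := by
  unfold clamp
  exact ⟨le_max_left _ _, max_le zero_le_one (min_le_right _ _)⟩

lemma clamp_of_mem {t : ℝ} (h : t ∈ Icc (0 : ℝ) 1) : clamp t = t := by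
  unfold clamp
  rw [min_eq_left h.2, max_eq_right h.1]

lemma continuous_clamp : Continuous clamp := by
  unfold clamp
  fun_prop

lemma clamp_of_nonpos {t : ℝ} (h : t ≤ 0) : clamp t = 0 := by
  unfold clamp
  rw [max_eq_left]
  exact (min_le_left _ _).trans h

lemma clamp_of_one_le {t : ℝ} (h : 1 ≤ t) : clamp t = 1 := by
  unfold clamp
  rw [min_eq_right h, max_eq_right zero_le_one]

/-- Nonnegative `C¹` functions on `[0,1]` with derivative vanishing linearly at both end points. -/
structure IsFlatPotential (g : ℝ → ℝ) : Prop where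
  nonneg : ∀ t ∈ Icc (0 : ℝ) 1, 0 ≤ g t
  hasDeriv : ∀ t ∈ Icc (0 : ℝ) 1, HasDerivWithinAt g (deriv01 g t) (Icc 0 1) t
  cont : ContinuousOn (deriv01 g) (Icc 0 1)
  bound : ∃ M, 0 ≤ M ∧ ∀ t ∈ Icc (0 : ℝ) 1, |deriv01 g t| ≤ M * t ∧ |deriv01 g t| ≤ M * (1 - t)

namespace IsFlatPotential

variable {g : ℝ → ℝ}

lemma deriv_zero (h : IsFlatPotential g) : deriv01 g 0 = 0 := by
  obtain ⟨M, -, hM⟩ := h.bound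
  simpa using (hM 0 (by simp)).1

lemma deriv_one (h : IsFlatPotential g) : deriv01 g 1 = 0 := by
  obtain ⟨M, -, hM⟩ := h.bound
  simpa using (hM 1 (by simp)).2

/-- The one-sided derivatives vanish at both end points, so they match the constant extensions and
the clamped function is `C¹` on the whole line. -/
lemma hasDerivAt (h : IsFlatPotential g) (t : ℝ) :
    HasDerivAt (fun s => g (clamp s)) (deriv01 g (clamp t)) t := by
  have hl : ∀ t ≤ (0 : ℝ), HasDerivWithinAt (fun s => g (clamp s)) 0 (Iic 0) t := by
    intro t ht
    refine (hasDerivWithinAt_const t (Iic (0 : ℝ)) (g 0)).congr ?_ ?_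
    · intro x hx
      simp [clamp_of_nonpos hx]
    · simp [clamp_of_nonpos ht]
  have hr : ∀ t, (1 : ℝ) ≤ t → HasDerivWithinAt (fun s => g (clamp s)) 0 (Ici 1) t := by
    intro t ht
    refine (hasDerivWithinAt_const t (Ici (1 : ℝ)) (g 1)).congr ?_ ?_
    · intro x hx
      simp [clamp_of_one_le hx]
    · simp [clamp_of_one_le ht]
  have hm : ∀ t ∈ Icc (0 : ℝ) 1,
      HasDerivWithinAt (fun s => g (clamp s)) (deriv01 g t) (Icc 0 1) t := by
    intro t ht
    refine (h.hasDeriv t ht).congr ?_ ?_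
    · intro x hx
      simp [clamp_of_mem hx]
    · simp [clamp_of_mem ht]
  rcases lt_trichotomy t 0 with h0 | h0 | h0
  · rw [clamp_of_nonpos h0.le, h.deriv_zero]
    exact (hl t h0.le).hasDerivAt (Iic_mem_nhds h0)
  · subst h0
    have h1 := hm 0 (by simp)
    rw [clamp_of_nonpos le_rfl]
    have h2 := hl 0 le_rfl
    rw [h.deriv_zero] at h1 ⊢
    refine (h2.union h1).hasDerivAt ?_
    filter_upwards [Iio_mem_nhds (show (0 : ℝ) < 1 by norm_num)] with x hx
    rcases le_total x 0 with h | h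
    · exact Or.inl h
    · exact Or.inr ⟨h, le_of_lt hx⟩
  · rcases lt_trichotomy t 1 with h1 | h1 | h1
    · rw [clamp_of_mem ⟨h0.le, h1.le⟩]
      exact (hm t ⟨h0.le, h1.le⟩).hasDerivAt (Icc_mem_nhds h0 h1)
    · subst h1
      have h1 := hm 1 (by simp)
      rw [clamp_of_one_le le_rfl]
      have h2 := hr 1 le_rfl
      rw [h.deriv_one] at h1 ⊢
      refine (h2.union h1).hasDerivAt ?_
      filter_upwards [Ioi_mem_nhds (show (0 : ℝ) < 1 by norm_num)] with x hx
      rcases le_total x 1 with h | h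
      · exact Or.inr ⟨le_of_lt hx, h⟩
      · exact Or.inl h
    · rw [clamp_of_one_le h1.le, h.deriv_one]
      exact (hr t h1.le).hasDerivAt (Ici_mem_nhds h1)

lemma continuous_deriv (h : IsFlatPotential g) : Continuous fun t => deriv01 g (clamp t) :=
  h.cont.comp_continuous continuous_clamp clamp_mem

lemma continuous (h : IsFlatPotential g) : Continuous fun t => g (clamp t) :=
  continuous_iff_continuousAt.2 fun t => (h.hasDerivAt t).continuousAt

lemma exists_deriv_le (h : IsFlatPotential g) :
    ∃ M, 0 ≤ M ∧ ∀ t, |deriv01 g (clamp t)| ≤ M := by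
  obtain ⟨M, hM0, hM⟩ := h.bound
  refine ⟨M, hM0, fun t => ((hM _ (clamp_mem t)).1).trans ?_⟩
  nlinarith [(clamp_mem t).2]

lemma exists_lipschitz (h : IsFlatPotential g) :
    ∃ M, 0 ≤ M ∧ ∀ s t, |g (clamp s) - g (clamp t)| ≤ M * |s - t| := by
  obtain ⟨M, hM0, hM⟩ := h.exists_deriv_le
  refine ⟨M, hM0, fun s t => ?_⟩
  have := Convex.norm_image_sub_le_of_norm_hasDerivWithin_le (s := univ)
    (f := fun s => g (clamp s)) (f' := fun t => deriv01 g (clamp t)) (C := M)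
    (fun x _ => (h.hasDerivAt x).hasDerivWithinAt) (fun x _ => hM x) convex_univ
    (mem_univ t) (mem_univ s)
  simpa using this

lemma exists_le (h : IsFlatPotential g) : ∃ M, 0 ≤ M ∧ ∀ t, g (clamp t) ≤ M := by
  obtain ⟨L, hL0, hL⟩ := h.exists_lipschitz
  refine ⟨L + |g 0|, by positivity, fun t => ?_⟩
  have h1 := hL (clamp t) 0
  rw [clamp_of_mem (clamp_mem t), clamp_of_nonpos le_rfl] at h1
  have h2 : |clamp t - 0| ≤ 1 := by
    rw [sub_zero, abs_of_nonneg (clamp_mem t).1]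
    exact (clamp_mem t).2
  have h3 := le_abs_self (g (clamp t) - g 0)
  have h4 := le_abs_self (g 0)
  nlinarith

end IsFlatPotential

lemma norm_sub_le_of_deriv {f f' : ℝ → ℝ} {a b C : ℝ} (hab : Icc a b ⊆ Icc 0 1)
    (hf : ∀ t ∈ Icc (0 : ℝ) 1, HasDerivWithinAt f (f' t) (Icc 0 1) t)
    (hC : ∀ t ∈ Icc a b, |f' t| ≤ C) {x y : ℝ} (hx : x ∈ Icc a b) (hy : y ∈ Icc a b) :
    |f y - f x| ≤ C * |y - x| := by
  have := Convex.norm_image_sub_le_of_norm_hasDerivWithin_le (s := Icc a b) (f := f) (f' := f')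
    (C := C) (fun t ht => (hf t (hab ht)).mono hab) (fun t ht => hC t ht) (convex_Icc a b) hx hy
  simpa using this

/-- `W'` has bounded derivative and vanishes at the wells, so it vanishes linearly there and `W`
quadratically. The resulting linear bound on `√W` is what makes `V'` vanish linearly too. -/
lemma IsDoubleWell.isFlatPotential_and {W : ℝ → ℝ} (hW : IsDoubleWell W) :
    IsFlatPotential W ∧ ∃ M, 0 ≤ M ∧ ∀ t ∈ Icc (0 : ℝ) 1,
      Real.sqrt (W t) ≤ M * t ∧ Real.sqrt (W t) ≤ M * (1 - t) := by
  have hud := uniqueDiffOn_Icc (show (0 : ℝ) < 1 by norm_num)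
  have hd : ∀ t ∈ Icc (0 : ℝ) 1, HasDerivWithinAt W (deriv01 W t) (Icc 0 1) t := fun t ht =>
    ((hW.contDiffOn.differentiableOn (by norm_num)) t ht).hasDerivWithinAt
  have hd1 : ContDiffOn ℝ 1 (deriv01 W) (Icc 0 1) :=
    hW.contDiffOn.derivWithin hud (by norm_num)
  have hd2c : ContinuousOn (derivWithin (deriv01 W) (Icc 0 1)) (Icc 0 1) :=
    hd1.continuousOn_derivWithin hud (by norm_num)
  have hd2 : ∀ t ∈ Icc (0 : ℝ) 1, HasDerivWithinAt (deriv01 W)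
      (derivWithin (deriv01 W) (Icc 0 1) t) (Icc 0 1) t := fun t ht =>
    ((hd1.differentiableOn (by norm_num)) t ht).hasDerivWithinAt
  obtain ⟨M, hM⟩ := isCompact_Icc.exists_bound_of_continuousOn hd2c
  have hM0 : 0 ≤ M := (norm_nonneg _).trans (hM 0 (by simp))
  have b0 : ∀ t ∈ Icc (0 : ℝ) 1, |deriv01 W t| ≤ M * t := by
    intro t ht
    have := norm_sub_le_of_deriv subset_rfl hd2 hM (x := 0) (by simp) ht
    rw [hW.deriv_zero, sub_zero, sub_zero, abs_of_nonneg ht.1] at this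
    exact this
  have b1 : ∀ t ∈ Icc (0 : ℝ) 1, |deriv01 W t| ≤ M * (1 - t) := by
    intro t ht
    have := norm_sub_le_of_deriv subset_rfl hd2 hM (x := 1) (by simp) ht
    rw [hW.deriv_one, sub_zero, abs_sub_comm, abs_of_nonneg (sub_nonneg.2 ht.2)] at this
    exact this
  have hnn : ∀ t ∈ Icc (0 : ℝ) 1, 0 ≤ W t := by
    intro t ht
    rcases eq_or_lt_of_le ht.1 with h | h
    · rw [← h, hW.zero]
    rcases eq_or_lt_of_le ht.2 with h' | h'
    · rw [h', hW.one]
    exact (hW.pos t ⟨h, h'⟩).le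
  refine ⟨⟨hnn, hd, hd1.continuousOn, M, hM0, fun t ht => ⟨b0 t ht, b1 t ht⟩⟩,
    Real.sqrt M, Real.sqrt_nonneg _, fun t ht => ⟨?_, ?_⟩⟩
  -- On `[0,t]` the derivative is at most `M t`, so the mean value inequality gives `W t ≤ M t²`.
  · have h := norm_sub_le_of_deriv (a := 0) (b := t) (C := M * t)
      (Icc_subset_Icc_right ht.2) hd (fun s hs => (b0 s ⟨hs.1, hs.2.trans ht.2⟩).trans
        (by nlinarith [hs.2])) (x := 0) (y := t) (by simp [ht.1]) (by simp [ht.1])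
    rw [hW.zero, sub_zero, sub_zero, abs_of_nonneg (hnn t ht), abs_of_nonneg ht.1] at h
    rw [← Real.sqrt_sq ht.1, ← Real.sqrt_mul hM0]
    apply Real.sqrt_le_sqrt
    rw [Real.sqrt_sq ht.1]
    nlinarith
  · have h := norm_sub_le_of_deriv (a := t) (b := 1) (C := M * (1 - t))
      (Icc_subset_Icc_left ht.1) hd (fun s hs => (b1 s ⟨ht.1.trans hs.1, hs.2⟩).trans
        (by nlinarith [hs.1])) (x := 1) (y := t) (by simp [ht.2]) (by simp [ht.2])
    rw [hW.one, sub_zero, abs_of_nonneg (hnn t ht), abs_sub_comm,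
      abs_of_nonneg (sub_nonneg.2 ht.2)] at h
    rw [← Real.sqrt_sq (sub_nonneg.2 ht.2), ← Real.sqrt_mul hM0]
    apply Real.sqrt_le_sqrt
    nlinarith

lemma IsDoubleWell.isFlatPotential {W : ℝ → ℝ} (hW : IsDoubleWell W) : IsFlatPotential W :=
  hW.isFlatPotential_and.1

lemma IsDoubleWell.sqrt_intervalIntegrable {W : ℝ → ℝ} (hW : IsDoubleWell W) {a b : ℝ}
    (ha : a ∈ Icc (0 : ℝ) 1) (hb : b ∈ Icc (0 : ℝ) 1) :
    IntervalIntegrable (fun s => Real.sqrt (W s)) volume a b := by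
  apply ContinuousOn.intervalIntegrable
  exact (Real.continuous_sqrt.comp_continuousOn hW.contDiffOn.continuousOn).mono
    (uIcc_subset_Icc ha hb)

lemma IsDoubleWell.phi_pos {W : ℝ → ℝ} (hW : IsDoubleWell W) {t : ℝ} (h0 : 0 < t) (h1 : t ≤ 1) :
    0 < phi W t := by
  unfold phi
  apply intervalIntegral.intervalIntegral_pos_of_pos_on
    (hW.sqrt_intervalIntegrable (by simp) ⟨h0.le, h1⟩) _ h0
  intro x hx
  exact Real.sqrt_pos.2 (hW.pos x ⟨hx.1, hx.2.trans_le h1⟩)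

lemma IsDoubleWell.phi_nonneg {W : ℝ → ℝ} (hW : IsDoubleWell W) {t : ℝ} (h : t ∈ Icc (0 : ℝ) 1) :
    0 ≤ phi W t := by
  rcases eq_or_lt_of_le h.1 with h0 | h0
  · rw [← h0]
    simp [phi]
  · exact (hW.phi_pos h0 h.2).le

lemma IsDoubleWell.phi_le_one {W : ℝ → ℝ} (hW : IsDoubleWell W) {t : ℝ} (h : t ∈ Icc (0 : ℝ) 1) :
    phi W t ≤ 1 := by
  rw [← hW.normalized, phi, ← intervalIntegral.integral_add_adjacent_intervals (c := 1)
    (hW.sqrt_intervalIntegrable (by simp) h) (hW.sqrt_intervalIntegrable h (by simp))]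
  have := intervalIntegral.integral_nonneg (μ := volume) (f := fun s => Real.sqrt (W s)) h.2
    (fun s _ => Real.sqrt_nonneg _)
  linarith

lemma IsDoubleWell.hasDerivWithinAt_volPot {W : ℝ → ℝ} (hW : IsDoubleWell W) {n : ℕ} (hn : 1 ≤ n)
    {t : ℝ} (h : t ∈ Icc (0 : ℝ) 1) :
    HasDerivWithinAt (volPot n W) (Real.sqrt (W t) * (((n : ℝ) + 1) / n) *
      phi W t ^ (((n : ℝ) + 1) / n - 1)) (Icc 0 1) t := by
  have hn' : (0 : ℝ) < n := by exact_mod_cast hn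
  -- Clamping makes the integrand continuous on the line, so the fundamental theorem applies at the
  -- end points as well.
  have hc : Continuous fun s => Real.sqrt (W (clamp s)) :=
    Real.continuous_sqrt.comp hW.isFlatPotential.continuous
  have h1 : HasDerivAt (fun t => ∫ s in (0 : ℝ)..t, Real.sqrt (W (clamp s)))
      (Real.sqrt (W (clamp t))) t :=
    intervalIntegral.integral_hasDerivAt_right (hc.intervalIntegrable _ _)
      (hc.stronglyMeasurableAtFilter _ _) hc.continuousAt
  have h2 : HasDerivWithinAt (phi W) (Real.sqrt (W t)) (Icc 0 1) t := by
    rw [clamp_of_mem h] at h1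
    have hcongr : ∀ x ∈ Icc (0 : ℝ) 1, phi W x = ∫ s in (0 : ℝ)..x, Real.sqrt (W (clamp s)) := by
      intro x hx
      apply intervalIntegral.integral_congr
      intro s hs
      rw [uIcc_of_le hx.1] at hs
      simp [clamp_of_mem (show s ∈ Icc (0 : ℝ) 1 from ⟨hs.1, hs.2.trans hx.2⟩)]
    exact h1.hasDerivWithinAt.congr hcongr (hcongr t h)
  exact h2.rpow_const (Or.inr (by rw [le_div_iff₀ hn']; linarith))

lemma IsDoubleWell.deriv01_volPot {W : ℝ → ℝ} (hW : IsDoubleWell W) {n : ℕ} (hn : 1 ≤ n)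
    {t : ℝ} (h : t ∈ Icc (0 : ℝ) 1) :
    deriv01 (volPot n W) t = Real.sqrt (W t) * (((n : ℝ) + 1) / n) *
      phi W t ^ (((n : ℝ) + 1) / n - 1) :=
  (hW.hasDerivWithinAt_volPot hn h).derivWithin
    (uniqueDiffOn_Icc (show (0 : ℝ) < 1 by norm_num) t h)

/-- In `V' = ((n+1)/n) √W Φ^{1/n}` the factor `√W` vanishes linearly at both wells, and `Φ^{1/n} ≤
1` by the normalization of `W`. -/
lemma IsDoubleWell.isFlatPotential_volPot {W : ℝ → ℝ} (hW : IsDoubleWell W) {n : ℕ}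
    (hn : 1 ≤ n) : IsFlatPotential (volPot n W) := by
  have hn' : (0 : ℝ) < n := by exact_mod_cast hn
  have hp : 0 ≤ ((n : ℝ) + 1) / n - 1 := by
    rw [sub_nonneg, le_div_iff₀ hn']
    linarith
  have hphi : ContinuousOn (phi W) (Icc 0 1) := by
    have := intervalIntegral.continuousOn_primitive_interval (μ := volume)
      (f := fun s => Real.sqrt (W s)) (a := 0) (b := 1)
      (by
        rw [← intervalIntegrable_iff']
        exact hW.sqrt_intervalIntegrable (by simp) (by simp))
    rwa [uIcc_of_le zero_le_one] at this
  obtain ⟨M, hM0, hM⟩ := hW.isFlatPotential_and.2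
  refine ⟨fun t ht => Real.rpow_nonneg (hW.phi_nonneg ht) _, fun t ht => ?_, ?_,
    M * (((n : ℝ) + 1) / n), by positivity, fun t ht => ?_⟩
  · rw [hW.deriv01_volPot hn ht]
    exact hW.hasDerivWithinAt_volPot hn ht
  · refine ContinuousOn.congr ?_ (fun t ht => hW.deriv01_volPot hn ht)
    refine ((Real.continuous_sqrt.comp_continuousOn hW.contDiffOn.continuousOn).mul
      continuousOn_const).mul (hphi.rpow_const fun x _ => Or.inr hp)
  · rw [hW.deriv01_volPot hn ht, abs_of_nonneg (by
      have := hW.phi_nonneg ht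
      positivity)]
    have h1 : phi W t ^ (((n : ℝ) + 1) / n - 1) ≤ 1 :=
      Real.rpow_le_one (hW.phi_nonneg ht) (hW.phi_le_one ht) hp
    have key : ∀ B, Real.sqrt (W t) ≤ M * B → Real.sqrt (W t) * (((n : ℝ) + 1) / n) *
      phi W t ^ (((n : ℝ) + 1) / n - 1) ≤ M * (((n : ℝ) + 1) / n) * B := by
      intro B hB
      calc Real.sqrt (W t) * (((n : ℝ) + 1) / n) * phi W t ^ (((n : ℝ) + 1) / n - 1)
          ≤ Real.sqrt (W t) * (((n : ℝ) + 1) / n) * 1 := by gcongr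
        _ ≤ (M * B) * (((n : ℝ) + 1) / n) := by rw [mul_one]; gcongr
        _ = _ := by ring
    exact ⟨key _ (hM t ht).1, key _ (hM t ht).2⟩

/-- Between the wells both `√W` and `Φ` are positive, hence so is `V'`. This limits the values of
`u` when no volume-correcting direction exists. -/
lemma IsDoubleWell.eq_zero_or_one_of_deriv01_volPot {W : ℝ → ℝ} (hW : IsDoubleWell W) {n : ℕ}
    (hn : 1 ≤ n) {t : ℝ} (h : t ∈ Icc (0 : ℝ) 1) (ht : deriv01 (volPot n W) t = 0) :
    t = 0 ∨ t = 1 := by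
  by_contra! hc
  have h0 : 0 < t := lt_of_le_of_ne h.1 (Ne.symm hc.1)
  have h1 : t < 1 := lt_of_le_of_ne h.2 hc.2
  rw [hW.deriv01_volPot hn h] at ht
  have := hW.phi_pos h0 h.2
  have h2 := Real.sqrt_pos.2 (hW.pos t ⟨h0, h1⟩)
  have hn' : (0 : ℝ) < n := by exact_mod_cast hn
  have : 0 < Real.sqrt (W t) * (((n : ℝ) + 1) / n) * phi W t ^ (((n : ℝ) + 1) / n - 1) := by
    positivity
  linarith

lemma IsDoubleWell.volPot_one {W : ℝ → ℝ} (hW : IsDoubleWell W) {n : ℕ} : volPot n W 1 = 1 := by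
  unfold volPot phi
  rw [hW.normalized, Real.one_rpow]

end ACPlateau

end

noncomputable section

namespace ACPlateau

open scoped Convolution

/-! ### Mollification -/

section Mollification

variable {n : ℕ} {E : Type*} [NormedAddCommGroup E]

/-- Composition with a continuous family of measure preserving maps is continuous in `L¹`;
translations form such a family. -/
lemma tendsto_lintegral_translate_sub {g : Amb n → E} (hg : Integrable g) :
    Tendsto (fun t : Amb n => ∫⁻ x, ‖g (x - t) - g x‖ₑ) (𝓝 0) (𝓝 0) := by
  have hgp : MemLp g 1 := memLp_one_iff_integrable.2 hg
  let τ : Amb n → C(Amb n, Amb n) := fun t => ⟨fun x => x - t, by fun_prop⟩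
  have hτ : Continuous τ :=
    ContinuousMap.continuous_of_continuous_uncurry τ (by
      change Continuous fun p : Amb n × Amb n => p.2 - p.1
      fun_prop)
  have hmp : ∀ t, MeasurePreserving (τ t) (volume : Measure (Amb n)) volume := fun t =>
    measurePreserving_sub_right volume t
  have hc : Continuous fun t => Lp.compMeasurePreserving (τ t) (hmp t) (hgp.toLp g) :=
    continuous_const.compMeasurePreservingLp hτ hmp (by norm_num)
  have h0 := tendsto_iff_edist_tendsto_0.1 (hc.tendsto 0)
  refine h0.congr fun t => ?_
  rw [Lp.edist_def, eLpNorm_one_eq_lintegral_enorm]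
  apply lintegral_congr_ae
  have e1 := Lp.coeFn_compMeasurePreserving (hgp.toLp g) (hmp t)
  have e2 := Lp.coeFn_compMeasurePreserving (hgp.toLp g) (hmp 0)
  have e3 := (hmp t).quasiMeasurePreserving.ae_eq_comp hgp.coeFn_toLp
  have e4 := (hmp 0).quasiMeasurePreserving.ae_eq_comp hgp.coeFn_toLp
  filter_upwards [e1, e2, e3, e4] with x h1 h2 h3 h4
  simp only [Pi.sub_apply]
  rw [h1, h2, h3, h4]
  simp [τ]

variable [NormedSpace ℝ E]

/-- A sequence of smooth bump functions at the origin with shrinking supports. -/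
def bumpSeq (n k : ℕ) : ContDiffBump (0 : Amb n) where
  rIn := 1 / (2 * ((k : ℝ) + 1))
  rOut := 1 / ((k : ℝ) + 1)
  rIn_pos := by positivity
  rIn_lt_rOut := by
    have : (0 : ℝ) < k + 1 := by positivity
    apply one_div_lt_one_div_of_lt this
    linarith

lemma tendsto_bumpSeq_rOut (n : ℕ) : Tendsto (fun k => (bumpSeq n k).rOut) atTop (𝓝 0) :=
  tendsto_one_div_add_atTop_nhds_zero_nat

/-- The mollifying kernels. -/
def mollKernel (n k : ℕ) : Amb n → ℝ := (bumpSeq n k).normed volume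

/-- The mollification of `g` at scale `1 / (k + 1)`. -/
def mollify (k : ℕ) (g : Amb n → E) : Amb n → E :=
  mollKernel n k ⋆[ContinuousLinearMap.lsmul ℝ ℝ, volume] g

lemma mollKernel_nonneg (n k : ℕ) (x : Amb n) : 0 ≤ mollKernel n k x :=
  (bumpSeq n k).nonneg_normed x

lemma contDiff_mollKernel (n k : ℕ) : ContDiff ℝ ∞ (mollKernel n k) :=
  (bumpSeq n k).contDiff_normed

lemma hasCompactSupport_mollKernel (n k : ℕ) : HasCompactSupport (mollKernel n k) :=
  (bumpSeq n k).hasCompactSupport_normed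

lemma integral_mollKernel (n k : ℕ) : ∫ x, mollKernel n k x = 1 :=
  (bumpSeq n k).integral_normed

lemma integrable_mollKernel (n k : ℕ) : Integrable (mollKernel n k) :=
  (contDiff_mollKernel n k).continuous.integrable_of_hasCompactSupport
    (hasCompactSupport_mollKernel n k)

lemma support_mollKernel (n k : ℕ) :
    Function.support (mollKernel n k) = Metric.ball 0 (1 / ((k : ℝ) + 1)) :=
  (bumpSeq n k).support_normed_eq

lemma mollify_apply (k : ℕ) (g : Amb n → E) (x : Amb n) :
    mollify k g x = ∫ t, mollKernel n k t • g (x - t) := rfl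

lemma mollify_apply' (k : ℕ) (g : Amb n → E) (x : Amb n) :
    mollify k g x = ∫ t, mollKernel n k (x - t) • g t := by
  rw [mollify, convolution_eq_swap]
  rfl

lemma ae_tendsto_mollify [CompleteSpace E] {g : Amb n → E} (hg : LocallyIntegrable g) :
    ∀ᵐ x, Tendsto (fun k => mollify k g x) atTop (𝓝 (g x)) := by
  -- The outer radius of each bump is exactly twice the inner one, whence the ratio `2`.
  refine ContDiffBump.ae_convolution_tendsto_right_of_locallyIntegrable (K := 2)
    (tendsto_bumpSeq_rOut n) (Eventually.of_forall fun k => ?_) hg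
  change 1 / ((k : ℝ) + 1) ≤ 2 * (1 / (2 * ((k : ℝ) + 1)))
  have : (0 : ℝ) < k + 1 := by positivity
  field_simp
  exact le_rfl

/-- By Tonelli the `L¹` error is at most the kernel average of the translation errors `‖g(· - t) -
g‖₁`, and these are small on the shrinking supports of the kernels. -/
lemma tendsto_lintegral_mollify_sub [CompleteSpace E] {g : Amb n → E} (hg : Integrable g) :
    Tendsto (fun k => ∫⁻ x, ‖mollify k g x - g x‖ₑ) atTop (𝓝 0) := by
  rw [ENNReal.tendsto_nhds_zero]
  intro η hη
  have h1 := (ENNReal.tendsto_nhds_zero.1 (tendsto_lintegral_translate_sub hg)) η hη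
  obtain ⟨r, hr, hball⟩ := Metric.eventually_nhds_iff.1 h1
  have h2 : ∀ᶠ k in atTop, (bumpSeq n k).rOut < r :=
    (tendsto_bumpSeq_rOut n).eventually_lt_const hr
  filter_upwards [h2] with k hk
  have hconv : ∀ᵐ x, Integrable fun t => mollKernel n k t • g (x - t) :=
    (integrable_mollKernel n k).ae_convolution_exists (ContinuousLinearMap.lsmul ℝ ℝ) hg
  have step : ∀ᵐ x, ‖mollify k g x - g x‖ₑ
      ≤ ∫⁻ t, ENNReal.ofReal (mollKernel n k t) * ‖g (x - t) - g x‖ₑ := by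
    filter_upwards [hconv] with x hx
    have e : mollify k g x - g x = ∫ t, mollKernel n k t • (g (x - t) - g x) := by
      simp_rw [smul_sub]
      rw [integral_sub hx ((integrable_mollKernel n k).smul_const _), integral_smul_const,
        integral_mollKernel, one_smul, mollify_apply]
    rw [e]
    refine (enorm_integral_le_lintegral_enorm _).trans (le_of_eq ?_)
    refine lintegral_congr fun t => ?_
    rw [enorm_smul, Real.enorm_of_nonneg (mollKernel_nonneg n k t)]
  have hmeas : AEMeasurable (Function.uncurry fun (x t : Amb n) =>
      ENNReal.ofReal (mollKernel n k t) * ‖g (x - t) - g x‖ₑ) (volume.prod volume) := by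
    have hs : AEStronglyMeasurable (fun p : Amb n × Amb n => g (p.1 - p.2) - g p.1)
        (volume.prod volume) := by
      refine AEStronglyMeasurable.sub ?_ ?_
      · exact hg.1.comp_quasiMeasurePreserving (quasiMeasurePreserving_sub_of_right_invariant _ _)
      · exact hg.1.comp_fst
    refine AEMeasurable.mul ?_ hs.enorm
    exact ((contDiff_mollKernel n k).continuous.comp continuous_snd).measurable.ennreal_ofReal.aemeasurable
  calc ∫⁻ x, ‖mollify k g x - g x‖ₑ
      ≤ ∫⁻ x, ∫⁻ t, ENNReal.ofReal (mollKernel n k t) * ‖g (x - t) - g x‖ₑ :=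
        lintegral_mono_ae step
    _ = ∫⁻ t, ∫⁻ x, ENNReal.ofReal (mollKernel n k t) * ‖g (x - t) - g x‖ₑ :=
        lintegral_lintegral_swap hmeas
    _ ≤ ∫⁻ t, ENNReal.ofReal (mollKernel n k t) * η := by
        refine lintegral_mono fun t => ?_
        rw [lintegral_const_mul' _ _ ENNReal.ofReal_ne_top]
        by_cases ht : mollKernel n k t = 0
        · simp [ht]
        · have ht' : t ∈ Function.support (mollKernel n k) := ht
          rw [support_mollKernel] at ht'
          gcongr
          exact hball (lt_trans ht' hk)
    _ = η := by
        rw [lintegral_mul_const _ ((contDiff_mollKernel n k).continuous.measurable.ennreal_ofReal),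
          ← ofReal_integral_eq_lintegral_ofReal (integrable_mollKernel n k)
            (Eventually.of_forall (mollKernel_nonneg n k)), integral_mollKernel]
        simp

lemma contDiff_mollify (k : ℕ) {g : Amb n → E} (hg : LocallyIntegrable g) :
    ContDiff ℝ ∞ (mollify k g) :=
  (hasCompactSupport_mollKernel n k).contDiff_convolution_left (n := ⊤) _
    (contDiff_mollKernel n k) hg

lemma fderiv_integral_kernel {κ : Amb n → ℝ} (hκ : ContDiff ℝ ∞ κ) (hc : HasCompactSupport κ)
    {g : Amb n → ℝ} (hg : LocallyIntegrable g) (x e : Amb n) :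
    fderiv ℝ (fun x => ∫ t, κ (x - t) * g t) x e = ∫ t, fderiv ℝ κ (x - t) e * g t := by
  have hd : ContDiff ℝ 1 κ := hκ.of_le (by norm_num)
  have h := hc.hasFDerivAt_convolution_left
    (μ := (volume : Measure (Amb n))) (ContinuousLinearMap.lsmul ℝ ℝ) hd hg x
  have he : (fun x => ∫ t, κ (x - t) * g t)
      = (κ ⋆[ContinuousLinearMap.lsmul ℝ ℝ, volume] g : Amb n → ℝ) := by
    ext x
    rw [convolution_eq_swap]
    rfl
  rw [he, h.fderiv, convolution_eq_swap, ContinuousLinearMap.integral_apply]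
  · rfl
  · have := (hc.fderiv ℝ).convolutionExists_left
      (μ := (volume : Measure (Amb n)))
      ((ContinuousLinearMap.lsmul ℝ ℝ : ℝ →L[ℝ] ℝ →L[ℝ] ℝ).precompL (Amb n))
      (hd.continuous_fderiv (by norm_num)) hg x
    exact this.integrable_swap

lemma mollify_eq_integral_kernel (k : ℕ) (g : Amb n → ℝ) :
    mollify k g = fun x => ∫ t, mollKernel n k (x - t) * g t := by
  ext x
  rw [mollify_apply']
  rfl

lemma fderiv_mollify_apply (k : ℕ) {g : Amb n → ℝ} (hg : LocallyIntegrable g) (x e : Amb n) :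
    fderiv ℝ (mollify k g) x e = ∫ t, fderiv ℝ (mollKernel n k) (x - t) e * g t := by
  rw [mollify_eq_integral_kernel]
  exact fderiv_integral_kernel (contDiff_mollKernel n k) (hasCompactSupport_mollKernel n k) hg x e

end Mollification

end ACPlateau

end

noncomputable section

namespace ACPlateau

open scoped Convolution Manifold

/-! ### Test functions -/

section TestFunctions

variable {n : ℕ} {Ω : Set (Amb n)} {F : Type*} [NormedAddCommGroup F] [NormedSpace ℝ F]

lemma IsTest.mono {Ω' : Set (Amb n)} {φ : Amb n → F} (h : IsTest Ω φ) (hs : Ω ⊆ Ω') :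
    IsTest Ω' φ :=
  ⟨h.smooth, h.compact, h.support.trans hs⟩

lemma IsTest.eq_zero {φ : Amb n → F} (h : IsTest Ω φ) {x : Amb n} (hx : x ∉ Ω) : φ x = 0 :=
  image_eq_zero_of_notMem_tsupport fun hx' => hx (h.support hx')

lemma IsTest.smul_left {φ : Amb n → F} (h : IsTest Ω φ) {b : Amb n → ℝ} (hb : ContDiff ℝ ∞ b) :
    IsTest Ω fun x => b x • φ x :=
  ⟨hb.smul h.smooth, h.compact.smul_left,
    (tsupport_smul_subset_right b φ).trans h.support⟩

lemma IsTest.neg {φ : Amb n → F} (h : IsTest Ω φ) : IsTest Ω fun x => -φ x := by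
  have := h.smul_left (b := fun _ => (-1 : ℝ)) contDiff_const
  simpa using this

lemma IsTest.const_smul {φ : Amb n → F} (h : IsTest Ω φ) (c : ℝ) : IsTest Ω fun x => c • φ x :=
  h.smul_left (b := fun _ => c) contDiff_const

lemma IsTest.const_mul {φ : Amb n → ℝ} (h : IsTest Ω φ) (c : ℝ) : IsTest Ω fun x => c * φ x :=
  h.const_smul c

lemma IsTest.mul_left {φ : Amb n → ℝ} (h : IsTest Ω φ) {b : Amb n → ℝ} (hb : ContDiff ℝ ∞ b) :
    IsTest Ω fun x => b x * φ x :=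
  h.smul_left hb

lemma isTest_zero : IsTest Ω (fun _ => (0 : F)) :=
  ⟨contDiff_const, HasCompactSupport.zero, by
    have : tsupport (fun _ : Amb n => (0 : F)) = ∅ := by
      rw [tsupport_eq_empty_iff]
      rfl
    rw [this]
    exact empty_subset _⟩

lemma IsTest.add {φ ψ : Amb n → F} (h : IsTest Ω φ) (h' : IsTest Ω ψ) :
    IsTest Ω fun x => φ x + ψ x :=
  ⟨h.smooth.add h'.smooth, h.compact.add h'.compact,
    (tsupport_add φ ψ).trans (union_subset h.support h'.support)⟩

lemma IsTest.differentiable {φ : Amb n → F} (h : IsTest Ω φ) : Differentiable ℝ φ :=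
  h.smooth.differentiable (by norm_num)

lemma IsTest.continuous_fderiv {φ : Amb n → F} (h : IsTest Ω φ) : Continuous (fderiv ℝ φ) :=
  h.smooth.continuous_fderiv (by norm_num)

lemma IsTest.fderiv_apply {φ : Amb n → F} (h : IsTest Ω φ) (e : Amb n) :
    IsTest Ω fun x => fderiv ℝ φ x e :=
  ⟨(h.smooth.fderiv_right (m := ∞) (by norm_num)).clm_apply contDiff_const, h.compact.fderiv_apply ℝ e,
    (tsupport_fderiv_apply_subset ℝ e).trans h.support⟩

lemma fderiv_eq_zero_of_notMem_tsupport {φ : Amb n → F} {x : Amb n} (hx : x ∉ tsupport φ) :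
    fderiv ℝ φ x = 0 :=
  image_eq_zero_of_notMem_tsupport fun h => hx (tsupport_fderiv_subset ℝ h)

lemma IsTest.fderiv_eq_zero {φ : Amb n → F} (h : IsTest Ω φ) {x : Amb n} (hx : x ∉ Ω) :
    fderiv ℝ φ x = 0 :=
  fderiv_eq_zero_of_notMem_tsupport fun hx' => hx (h.support hx')

lemma exists_cutoff (hΩ : IsOpen Ω) {K : Set (Amb n)} (hK : IsCompact K) (hKΩ : K ⊆ Ω) :
    ∃ χ : Amb n → ℝ, IsTest Ω χ ∧ (∀ᶠ x in 𝓝ˢ K, χ x = 1) ∧ ∀ x, χ x ∈ Icc (0 : ℝ) 1 := by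
  obtain ⟨L, hL, hKL, hLΩ⟩ := exists_compact_between hK hΩ hKΩ
  obtain ⟨f, h1, h0, hf⟩ := exists_contMDiffMap_one_nhds_of_subset_interior (n := ⊤)
    𝓘(ℝ, Amb n) hK.isClosed hKL
  have hsub : tsupport f ⊆ L := by
    refine closure_minimal (fun x hx => ?_) hL.isClosed
    by_contra hxL
    exact hx (h0 x hxL)
  exact ⟨f, ⟨f.contMDiff.contDiff, hL.of_isClosed_subset (isClosed_tsupport _) hsub,
    hsub.trans hLΩ⟩, h1, hf⟩

end TestFunctions

/-! ### Calculus of weak gradients -/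

section Sobolev

variable {n : ℕ} {Ω : Set (Amb n)} {u : Amb n → ℝ} {G : Amb n → Amb n}

lemma setIntegral_mul_test {φ : Amb n → ℝ} (hφ : ∀ x ∉ Ω, φ x = 0) (f : Amb n → ℝ) :
    ∫ x in Ω, f x * φ x = ∫ x, f x * φ x :=
  setIntegral_eq_integral_of_forall_compl_eq_zero fun x hx => by simp [hφ x hx]

lemma integrable_mul_of_support {K : Set (Amb n)} (hK : IsCompact K) {f φ : Amb n → ℝ}
    (hf : IntegrableOn f K) (hφ : Continuous φ) (h0 : ∀ x ∉ K, φ x = 0) :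
    Integrable fun x => f x * φ x := by
  rw [← integrableOn_iff_integrable_of_support_subset (s := K)]
  · exact hf.mul_continuousOn hφ.continuousOn hK
  · intro x hx
    by_contra h
    exact hx (by simp [h0 x h])

lemma IsW12loc.integrableOn (hu : IsW12loc Ω u G) {K : Set (Amb n)} (hK : IsCompact K)
    (h : K ⊆ Ω) : IntegrableOn u K := by
  have : IsFiniteMeasure (volume.restrict K) := ⟨by simpa using hK.measure_lt_top⟩
  exact (hu.memLp K h hK).integrable (by norm_num)

lemma IsW12loc.integrableOn_grad (hu : IsW12loc Ω u G) {K : Set (Amb n)} (hK : IsCompact K)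
    (h : K ⊆ Ω) : IntegrableOn G K := by
  have : IsFiniteMeasure (volume.restrict K) := ⟨by simpa using hK.measure_lt_top⟩
  exact (hu.memLp_grad K h hK).integrable (by norm_num)

lemma IsW12loc.integrableOn_inner (hu : IsW12loc Ω u G) {K : Set (Amb n)} (hK : IsCompact K)
    (h : K ⊆ Ω) (e : Amb n) : IntegrableOn (fun x => inner ℝ (G x) e) K :=
  (hu.integrableOn_grad hK h).inner_const e

/-- Passage to the limit in the identity defining weak derivatives. -/
lemma weak_limit {φ : Amb n → ℝ} (hφ : IsTest Ω φ) (e : Amb n) {v h : Amb n → ℝ}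
    {vk hk : ℕ → Amb n → ℝ}
    (hw : ∀ k, ∫ x in Ω, vk k x * fderiv ℝ φ x e = - ∫ x in Ω, hk k x * φ x)
    (hv : IntegrableOn v (tsupport φ)) (hh : IntegrableOn h (tsupport φ))
    (hvk : ∀ k, IntegrableOn (vk k) (tsupport φ)) (hhk : ∀ k, IntegrableOn (hk k) (tsupport φ))
    (tv : Tendsto (fun k => ∫⁻ x in tsupport φ, ‖vk k x - v x‖ₑ) atTop (𝓝 0))
    (th : Tendsto (fun k => ∫⁻ x in tsupport φ, ‖hk k x - h x‖ₑ) atTop (𝓝 0)) :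
    ∫ x in Ω, v x * fderiv ℝ φ x e = - ∫ x in Ω, h x * φ x := by
  have hKc : IsCompact (tsupport φ) := hφ.compact
  -- Pairing with a continuous factor supported in the compact set `tsupport φ` is continuous for
  -- `L¹` convergence there; this is used for `c = ∂ₑφ` and for `c = φ`.
  have key : ∀ {c : Amb n → ℝ} (_ : Continuous c) (_ : ∀ x ∉ tsupport φ, c x = 0)
      {f : Amb n → ℝ} {fk : ℕ → Amb n → ℝ} (_ : IntegrableOn f (tsupport φ))
      (_ : ∀ k, IntegrableOn (fk k) (tsupport φ))
      (_ : Tendsto (fun k => ∫⁻ x in tsupport φ, ‖fk k x - f x‖ₑ) atTop (𝓝 0)),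
      Tendsto (fun k => ∫ x in Ω, fk k x * c x) atTop (𝓝 (∫ x in Ω, f x * c x)) := by
    intro c hc hc0 f fk hf hfk ht
    have e1 : ∀ g : Amb n → ℝ, ∫ x in Ω, g x * c x = ∫ x in tsupport φ, g x * c x := by
      intro g
      rw [setIntegral_mul_test (fun x hx => hc0 x fun h => hx (hφ.support h)),
        setIntegral_mul_test hc0]
    simp_rw [e1]
    obtain ⟨C, hC⟩ := hKc.exists_bound_of_continuousOn hc.continuousOn
    refine tendsto_integral_of_L1 _ (hf.mul_continuousOn hc.continuousOn hKc).1
      (Eventually.of_forall fun k => (hfk k).mul_continuousOn hc.continuousOn hKc) ?_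
    have h2 : Tendsto (fun k => ENNReal.ofReal C * ∫⁻ x in tsupport φ, ‖fk k x - f x‖ₑ) atTop
        (𝓝 0) := by
      simpa using ENNReal.Tendsto.const_mul ht (Or.inr ENNReal.ofReal_ne_top)
    refine tendsto_of_tendsto_of_tendsto_of_le_of_le tendsto_const_nhds h2 (fun _ => zero_le)
      fun k => ?_
    change _ ≤ ENNReal.ofReal C * ∫⁻ x in tsupport φ, ‖fk k x - f x‖ₑ
    rw [← lintegral_const_mul' _ _ ENNReal.ofReal_ne_top]
    refine setLIntegral_mono' (isClosed_tsupport φ).measurableSet fun x hx => ?_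
    rw [← sub_mul, enorm_mul, mul_comm]
    gcongr
    rw [← ofReal_norm]
    exact ENNReal.ofReal_le_ofReal (hC x hx)
  have t1 := key (c := fun x => fderiv ℝ φ x e) (hφ.continuous_fderiv.clm_apply continuous_const)
    (fun x hx => by rw [fderiv_eq_zero_of_notMem_tsupport hx]; rfl) hv hvk tv
  have t2 := key hφ.smooth.continuous (fun x hx => image_eq_zero_of_notMem_tsupport hx) hh hhk th
  simp_rw [hw] at t1
  exact tendsto_nhds_unique t1 t2.neg

lemma weak_of_contDiff {v : Amb n → ℝ} (hv : ContDiff ℝ 1 v) {φ : Amb n → ℝ} (hφ : IsTest Ω φ)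
    (e : Amb n) :
    ∫ x in Ω, v x * fderiv ℝ φ x e = - ∫ x in Ω, fderiv ℝ v x e * φ x := by
  rw [setIntegral_mul_test (fun x hx => by rw [hφ.fderiv_eq_zero hx]; rfl),
    setIntegral_mul_test (fun x hx => hφ.eq_zero hx)]
  have hc : Continuous fun x => fderiv ℝ v x e :=
    (hv.continuous_fderiv (by norm_num)).clm_apply continuous_const
  have hφ' := hφ.fderiv_apply e
  refine integral_mul_fderiv_eq_neg_fderiv_mul_of_integrable ?_ ?_ ?_
    (fun x _ => hv.differentiable (by norm_num) x) fun x _ => hφ.differentiable x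
  · exact (hc.mul hφ.smooth.continuous).integrable_of_hasCompactSupport hφ.compact.mul_left
  · exact (hv.continuous.mul hφ'.smooth.continuous).integrable_of_hasCompactSupport
      hφ'.compact.mul_left
  · exact (hv.continuous.mul hφ.smooth.continuous).integrable_of_hasCompactSupport
      hφ.compact.mul_left

lemma continuous_gradient {a : Amb n → ℝ} (ha : ContDiff ℝ ∞ a) : Continuous (gradient a) := by
  unfold gradient
  exact (InnerProductSpace.toDual ℝ (Amb n)).symm.continuous.comp
    (ha.continuous_fderiv (by norm_num))

lemma gradient_eq_zero_of_fderiv {a : Amb n → ℝ} {x : Amb n} (h : fderiv ℝ a x = 0) :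
    gradient a x = 0 := by
  simp [gradient, h]

/-- Products of local `L²` functions with continuous functions. -/
lemma memLp_continuous_smul {E : Type*} [NormedAddCommGroup E] [NormedSpace ℝ E]
    {K : Set (Amb n)} (hK : IsCompact K) {f : Amb n → E} (hf : MemLp f 2 (volume.restrict K))
    {c : Amb n → ℝ} (hc : Continuous c) :
    MemLp (fun x => c x • f x) 2 (volume.restrict K) := by
  obtain ⟨C, hC⟩ := hK.exists_bound_of_continuousOn hc.continuousOn
  refine hf.of_le_mul (c := C) (hc.aestronglyMeasurable.smul hf.1) ?_
  filter_upwards [ae_restrict_mem hK.measurableSet] with x hx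
  rw [norm_smul]
  exact mul_le_mul_of_nonneg_right (hC x hx) (norm_nonneg _)

lemma memLp_smul_continuous {E : Type*} [NormedAddCommGroup E] [NormedSpace ℝ E]
    {K : Set (Amb n)} (hK : IsCompact K) {f : Amb n → ℝ} (hf : MemLp f 2 (volume.restrict K))
    {c : Amb n → E} (hc : Continuous c) :
    MemLp (fun x => f x • c x) 2 (volume.restrict K) := by
  obtain ⟨C, hC⟩ := hK.exists_bound_of_continuousOn hc.continuousOn
  refine hf.of_le_mul (c := C) (hf.1.smul hc.aestronglyMeasurable) ?_
  filter_upwards [ae_restrict_mem hK.measurableSet] with x hx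
  rw [norm_smul, mul_comm]
  exact mul_le_mul_of_nonneg_right (hC x hx) (norm_nonneg _)

lemma memLp_continuous {E : Type*} [NormedAddCommGroup E]
    {K : Set (Amb n)} (hK : IsCompact K) {c : Amb n → E} (hc : Continuous c) :
    MemLp c 2 (volume.restrict K) := by
  have : IsFiniteMeasure (volume.restrict K) := ⟨by simpa using hK.measure_lt_top⟩
  obtain ⟨C, hC⟩ := hK.exists_bound_of_continuousOn hc.continuousOn
  refine MemLp.of_bound hc.aestronglyMeasurable C ?_
  filter_upwards [ae_restrict_mem hK.measurableSet] with x hx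
  exact hC x hx

/-- Multiplication by a smooth function. -/
lemma IsW12loc.smul_smooth (hu : IsW12loc Ω u G) {b : Amb n → ℝ} (hb : ContDiff ℝ ∞ b) :
    IsW12loc Ω (fun x => b x * u x) (fun x => b x • G x + u x • gradient b x) where
  memLp K h hK := memLp_continuous_smul hK (hu.memLp K h hK) hb.continuous
  memLp_grad K h hK := (memLp_continuous_smul hK (hu.memLp_grad K h hK) hb.continuous).add
    (memLp_smul_continuous hK (hu.memLp K h hK) (continuous_gradient hb))
  weak φ hφ e := by
    have hbd : Differentiable ℝ b := hb.differentiable (by norm_num)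
    have h1 := hu.weak _ (hφ.mul_left hb) e
    have hf : ∀ x, fderiv ℝ (fun x => b x * φ x) x e
        = b x * fderiv ℝ φ x e + φ x * fderiv ℝ b x e := by
      intro x
      rw [fderiv_fun_mul (hbd x) (hφ.differentiable x)]
      simp
    simp_rw [hf, mul_add] at h1
    have hc := hφ.compact
    have hKu := hu.integrableOn hc hφ.support
    have hKG := hu.integrableOn_inner hc hφ.support e
    have i1 : Integrable (fun x => u x * (b x * fderiv ℝ φ x e)) :=
      integrable_mul_of_support hc hKu (hb.continuous.mul (hφ.fderiv_apply e).smooth.continuous)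
        (fun x hx => by simp [fderiv_eq_zero_of_notMem_tsupport hx])
    have i2 : Integrable (fun x => u x * (φ x * fderiv ℝ b x e)) :=
      integrable_mul_of_support hc hKu (hφ.smooth.continuous.mul
        ((hb.continuous_fderiv (by norm_num)).clm_apply continuous_const))
        (fun x hx => by simp [image_eq_zero_of_notMem_tsupport hx])
    have i3 : Integrable (fun x => inner ℝ (G x) e * (b x * φ x)) :=
      integrable_mul_of_support hc hKG (hb.continuous.mul hφ.smooth.continuous)
        (fun x hx => by simp [image_eq_zero_of_notMem_tsupport hx])
    rw [integral_add i1.integrableOn i2.integrableOn] at h1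
    have e1 : ∫ x in Ω, b x * u x * fderiv ℝ φ x e = ∫ x in Ω, u x * (b x * fderiv ℝ φ x e) := by
      congr 1
      ext x
      ring
    have e2 : ∫ x in Ω, inner ℝ (b x • G x + u x • gradient b x) e * φ x
        = (∫ x in Ω, inner ℝ (G x) e * (b x * φ x)) + ∫ x in Ω, u x * (φ x * fderiv ℝ b x e) := by
      rw [← integral_add i3.integrableOn i2.integrableOn]
      congr 1
      ext x
      rw [inner_add_left, real_inner_smul_left, real_inner_smul_left, inner_gradient_left]
      ring
    rw [e1, e2]
    linarith

lemma isW12loc_smooth {a : Amb n → ℝ} (ha : ContDiff ℝ ∞ a) : IsW12loc Ω a (gradient a) where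
  memLp K _ hK := memLp_continuous hK ha.continuous
  memLp_grad K _ hK := memLp_continuous hK (continuous_gradient ha)
  weak φ hφ e := by
    simp_rw [inner_gradient_left]
    exact weak_of_contDiff (ha.of_le (by norm_num)) hφ e

lemma IsW12loc.add (hu : IsW12loc Ω u G) {u' : Amb n → ℝ} {G' : Amb n → Amb n}
    (hu' : IsW12loc Ω u' G') : IsW12loc Ω (fun x => u x + u' x) (fun x => G x + G' x) where
  memLp K h hK := (hu.memLp K h hK).add (hu'.memLp K h hK)
  memLp_grad K h hK := (hu.memLp_grad K h hK).add (hu'.memLp_grad K h hK)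
  weak φ hφ e := by
    have hc := hφ.compact
    have i1 : ∀ {w : Amb n → ℝ} {H : Amb n → Amb n}, IsW12loc Ω w H →
        Integrable (fun x => w x * fderiv ℝ φ x e) := fun hw =>
      integrable_mul_of_support hc (hw.integrableOn hc hφ.support)
        (hφ.fderiv_apply e).smooth.continuous
        (fun x hx => by simp [fderiv_eq_zero_of_notMem_tsupport hx])
    have i2 : ∀ {w : Amb n → ℝ} {H : Amb n → Amb n}, IsW12loc Ω w H →
        Integrable (fun x => inner ℝ (H x) e * φ x) := fun hw =>
      integrable_mul_of_support hc (hw.integrableOn_inner hc hφ.support e)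
        hφ.smooth.continuous (fun x hx => image_eq_zero_of_notMem_tsupport hx)
    simp_rw [inner_add_left, add_mul]
    rw [integral_add (i1 hu).integrableOn (i1 hu').integrableOn,
      integral_add (i2 hu).integrableOn (i2 hu').integrableOn, hu.weak φ hφ e, hu'.weak φ hφ e]
    ring

lemma IsW12loc.neg (hu : IsW12loc Ω u G) : IsW12loc Ω (fun x => -u x) (fun x => -G x) := by
  have h := hu.smul_smooth (b := fun _ => (-1 : ℝ)) contDiff_const
  have : gradient (fun _ : Amb n => (-1 : ℝ)) = fun _ => 0 := gradient_fun_const' _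
  simpa [this] using h

/-- Smooth approximation of local Sobolev functions on compact sets. -/
lemma IsW12loc.exists_smooth_approx (hΩ : IsOpen Ω) (hu : IsW12loc Ω u G) {K : Set (Amb n)}
    (hK : IsCompact K) (hKΩ : K ⊆ Ω) :
    ∃ U : ℕ → Amb n → ℝ, (∀ k, ContDiff ℝ ∞ (U k)) ∧
      Tendsto (fun k => ∫⁻ x in K, ‖U k x - u x‖ₑ) atTop (𝓝 0) ∧
      Tendsto (fun k => ∫⁻ x in K, ‖gradient (U k) x - G x‖ₑ) atTop (𝓝 0) ∧
      ∀ᵐ x ∂(volume.restrict K), Tendsto (fun k => U k x) atTop (𝓝 (u x)) := by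
  -- Cutting off gives a function `w` with weak gradient `H` on the whole space, both integrable and
  -- unchanged on `K`, to which mollification applies.
  obtain ⟨χ, hχ, hχ1, -⟩ := exists_cutoff hΩ hK hKΩ
  have hw := hu.smul_smooth hχ.smooth
  set w : Amb n → ℝ := fun x => χ x * u x with hwdef
  set H : Amb n → Amb n := fun x => χ x • G x + u x • gradient χ x with hHdef
  have hχc := hχ.compact
  have w0 : ∀ x ∉ tsupport χ, w x = 0 := fun x hx => by
    simp [hwdef, image_eq_zero_of_notMem_tsupport hx]
  have H0 : ∀ x ∉ tsupport χ, H x = 0 := fun x hx => by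
    simp [hHdef, image_eq_zero_of_notMem_tsupport hx,
      gradient_eq_zero_of_fderiv (fderiv_eq_zero_of_notMem_tsupport hx)]
  have hwi : Integrable w := by
    rw [← integrableOn_iff_integrable_of_support_subset (s := tsupport χ)
      (fun x hx => by_contra fun h => hx (w0 x h))]
    exact hw.integrableOn hχc hχ.support
  have hHi : Integrable H := by
    rw [← integrableOn_iff_integrable_of_support_subset (s := tsupport χ)
      (fun x hx => by_contra fun h => hx (H0 x h))]
    exact hw.integrableOn_grad hχc hχ.support
  have hwK : ∀ x ∈ K, w x = u x := fun x hx => by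
    have : χ x = 1 := hχ1.self_of_nhdsSet x hx
    simp [hwdef, this]
  have hHK : ∀ x ∈ K, H x = G x := fun x hx => by
    have h1 : χ =ᶠ[𝓝 x] fun _ => (1 : ℝ) := hχ1.filter_mono (nhds_le_nhdsSet hx)
    have h2 : χ x = 1 := h1.self_of_nhds
    have h3 : gradient χ x = 0 := by
      rw [h1.gradient_eq, gradient_fun_const]
    simp [hHdef, h2, h3]
  -- A second cutoff `χ'`, equal to `1` near the support of `χ`, turns any `ψ` into a test function
  -- in `Ω` without changing the integrals against `w` and `H`.
  have weakglob : ∀ ψ : Amb n → ℝ, ContDiff ℝ ∞ ψ → HasCompactSupport ψ → ∀ e : Amb n,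
      ∫ x, w x * fderiv ℝ ψ x e = - ∫ x, inner ℝ (H x) e * ψ x := by
    obtain ⟨χ', hχ', hχ1', -⟩ := exists_cutoff hΩ hχc hχ.support
    intro ψ hψ hψc e
    have ht : IsTest Ω fun x => ψ x * χ' x := hχ'.mul_left hψ
    have h := hw.weak _ ht e
    have hout : ∀ x ∉ Ω, x ∉ tsupport χ := fun x hx h => hx (hχ.support h)
    rw [setIntegral_eq_integral_of_forall_compl_eq_zero
        (fun x hx => by simp [w0 x (hout x hx)]),
      setIntegral_eq_integral_of_forall_compl_eq_zero
        (fun x hx => by simp [H0 x (hout x hx)])] at h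
    have e1 : ∀ x, w x * fderiv ℝ (fun x => ψ x * χ' x) x e = w x * fderiv ℝ ψ x e := by
      intro x
      by_cases hx : x ∈ tsupport χ
      · have h1 : (fun x => ψ x * χ' x) =ᶠ[𝓝 x] ψ := by
          filter_upwards [hχ1'.filter_mono (nhds_le_nhdsSet hx)] with y hy
          simp [hy]
        rw [h1.fderiv_eq]
      · simp [w0 x hx]
    have e2 : ∀ x, inner ℝ (H x) e * (ψ x * χ' x) = inner ℝ (H x) e * ψ x := by
      intro x
      by_cases hx : x ∈ tsupport χ
      · have : χ' x = 1 := hχ1'.self_of_nhdsSet x hx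
        simp [this]
      · simp [H0 x hx]
    simp_rw [e1, e2] at h
    exact h
  -- The weak identity is tested with the reflected kernel `t ↦ ρ(x - t)`; the sign from the
  -- reflection cancels the sign of integration by parts.
  have hgrad : ∀ k x, gradient (mollify k w) x = mollify k H x := by
    intro k x
    refine ext_inner_right ℝ fun e => ?_
    rw [inner_gradient_left, fderiv_mollify_apply k hwi.locallyIntegrable, mollify_apply']
    have hker : ContDiff ℝ ∞ fun t => mollKernel n k (x - t) :=
      (contDiff_mollKernel n k).comp (contDiff_const.sub contDiff_id)
    have hkerc : HasCompactSupport fun t => mollKernel n k (x - t) :=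
      (hasCompactSupport_mollKernel n k).comp_homeomorph (Homeomorph.subLeft x)
    have hd : ∀ t, fderiv ℝ (fun t => mollKernel n k (x - t)) t e
        = - fderiv ℝ (mollKernel n k) (x - t) e := by
      intro t
      have h1 : HasFDerivAt (fun t : Amb n => x - t) (-(ContinuousLinearMap.id ℝ (Amb n))) t :=
        (hasFDerivAt_id t).const_sub x
      have h2 : HasFDerivAt (mollKernel n k) (fderiv ℝ (mollKernel n k) (x - t)) (x - t) :=
        ((contDiff_mollKernel n k).differentiable (by norm_num) _).hasFDerivAt
      have h3 : HasFDerivAt (fun t => mollKernel n k (x - t)) _ t := h2.comp t h1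
      rw [h3.fderiv]
      simp
    have hwk := weakglob _ hker hkerc e
    simp_rw [hd, mul_neg, integral_neg, neg_inj] at hwk
    have hIntgr : Integrable fun t => mollKernel n k (x - t) • H t := by
      have := (hasCompactSupport_mollKernel n k).convolutionExists_left
        (μ := (volume : Measure (Amb n))) (ContinuousLinearMap.lsmul ℝ ℝ)
        (contDiff_mollKernel n k).continuous hHi.locallyIntegrable x
      exact this.integrable_swap
    rw [real_inner_comm, ← integral_inner hIntgr]
    have e1 : ∫ t, fderiv ℝ (mollKernel n k) (x - t) e * w t
        = ∫ t, w t * fderiv ℝ (mollKernel n k) (x - t) e := by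
      congr 1
      ext t
      ring
    rw [e1, hwk]
    congr 1
    ext t
    rw [real_inner_smul_right, real_inner_comm]
    ring
  refine ⟨fun k => mollify k w, fun k => contDiff_mollify k hwi.locallyIntegrable, ?_, ?_, ?_⟩
  · refine tendsto_of_tendsto_of_tendsto_of_le_of_le tendsto_const_nhds
      (tendsto_lintegral_mollify_sub hwi) (fun _ => zero_le) fun k => ?_
    change ∫⁻ x in K, ‖mollify k w x - u x‖ₑ ≤ ∫⁻ x, ‖mollify k w x - w x‖ₑ
    rw [setLIntegral_congr_fun (g := fun x => ‖mollify k w x - w x‖ₑ) hK.measurableSet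
      (fun x hx => by simp [hwK x hx])]
    exact setLIntegral_le_lintegral _ _
  · refine tendsto_of_tendsto_of_tendsto_of_le_of_le tendsto_const_nhds
      (tendsto_lintegral_mollify_sub hHi) (fun _ => zero_le) fun k => ?_
    change ∫⁻ x in K, ‖gradient (mollify k w) x - G x‖ₑ ≤ ∫⁻ x, ‖mollify k H x - H x‖ₑ
    rw [setLIntegral_congr_fun (g := fun x => ‖mollify k H x - H x‖ₑ) hK.measurableSet
      (fun x hx => by simp [hHK x hx, hgrad])]
    exact setLIntegral_le_lintegral _ _
  · filter_upwards [ae_restrict_of_ae (ae_tendsto_mollify hwi.locallyIntegrable),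
      ae_restrict_mem hK.measurableSet] with x hx hxK
    rwa [hwK x hxK] at hx

end Sobolev

end ACPlateau

end

noncomputable section

namespace ACPlateau

/-! ### Chain rule and truncation for weak gradients. -/

section ChainRule

variable {n : ℕ} {Ω : Set (Amb n)} {u : Amb n → ℝ} {G : Amb n → Amb n}

lemma IsW12loc.aestronglyMeasurable (hu : IsW12loc Ω u G) {K : Set (Amb n)} (hK : IsCompact K)
    (h : K ⊆ Ω) : AEStronglyMeasurable u (volume.restrict K) := (hu.memLp K h hK).1

/-- The chain rule for `C¹` functions with bounded derivative. -/
lemma IsW12loc.comp_contDiff (hΩ : IsOpen Ω) (hu : IsW12loc Ω u G) {F F' : ℝ → ℝ}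
    (hF : ∀ t, HasDerivAt F (F' t) t) (hc : Continuous F') {M : ℝ} (hM : ∀ t, |F' t| ≤ M) :
    IsW12loc Ω (fun x => F (u x)) (fun x => F' (u x) • G x) := by
  have hlip : ∀ s t, |F s - F t| ≤ M * |s - t| := fun s t => by
    have := Convex.norm_image_sub_le_of_norm_hasDerivWithin_le (s := univ) (f := F) (f' := F')
      (C := M) (fun x _ => (hF x).hasDerivWithinAt) (fun x _ => hM x) convex_univ
      (mem_univ t) (mem_univ s)
    simpa using this
  have hFc : Continuous F := continuous_iff_continuousAt.2 fun t => (hF t).continuousAt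
  have hFd : deriv F = F' := funext fun t => (hF t).deriv
  have hF1 : ContDiff ℝ 1 F := contDiff_one_iff_deriv.2
    ⟨fun t => (hF t).differentiableAt, by rwa [hFd]⟩
  have m1 : ∀ K ⊆ Ω, IsCompact K → MemLp (fun x => F (u x)) 2 (volume.restrict K) := by
    intro K h hK
    have : IsFiniteMeasure (volume.restrict K) := ⟨by simpa using hK.measure_lt_top⟩
    have h1 : MemLp (fun x => F (u x) - F 0) 2 (volume.restrict K) := by
      refine (hu.memLp K h hK).of_le_mul (c := M)
        ((hFc.comp_aestronglyMeasurable (hu.memLp K h hK).1).sub aestronglyMeasurable_const) ?_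
      filter_upwards with x
      simpa using hlip (u x) 0
    convert h1.add (memLp_const (F 0)) using 1
    ext x
    simp
  have m2 : ∀ K ⊆ Ω, IsCompact K → MemLp (fun x => F' (u x) • G x) 2 (volume.restrict K) := by
    intro K h hK
    refine (hu.memLp_grad K h hK).of_le_mul (c := M)
      ((hc.comp_aestronglyMeasurable (hu.memLp K h hK).1).smul (hu.memLp_grad K h hK).1) ?_
    filter_upwards with x
    rw [norm_smul]
    exact mul_le_mul_of_nonneg_right (hM _) (norm_nonneg _)
  refine ⟨m1, m2, fun φ hφ e => ?_⟩
  have hK : IsCompact (tsupport φ) := hφ.compact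
  have : IsFiniteMeasure (volume.restrict (tsupport φ)) := ⟨by simpa using hK.measure_lt_top⟩
  obtain ⟨U, hU, tU, tG, aeU⟩ := hu.exists_smooth_approx hΩ hK hφ.support
  have hM0 : 0 ≤ M := (abs_nonneg _).trans (hM 0)
  have hder : ∀ k x, fderiv ℝ (fun x => F (U k x)) x e = F' (U k x) * inner ℝ (gradient (U k) x) e := by
    intro k x
    have h1 : HasFDerivAt (fun x => F (U k x)) _ x := (hF (U k x)).comp_hasFDerivAt x
      (((hU k).differentiable (by norm_num)) x).hasFDerivAt
    rw [h1.fderiv, inner_gradient_left]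
    simp
  have hGi := hu.integrableOn_grad hK hφ.support
  refine weak_limit hφ e (vk := fun k x => F (U k x))
    (hk := fun k x => F' (U k x) * inner ℝ (gradient (U k) x) e) (fun k => ?_) ?_ ?_ (fun k => ?_)
    (fun k => ?_) ?_ ?_
  · have h := weak_of_contDiff (Ω := Ω) (v := fun x => F (U k x))
      (hF1.comp ((hU k).of_le (by norm_num))) hφ e
    simp_rw [hder] at h
    exact h
  · exact (m1 _ hφ.support hK).integrable (by norm_num)
  · exact ((m2 _ hφ.support hK).integrable (by norm_num)).inner_const e
  · exact (hFc.comp (hU k).continuous).continuousOn.integrableOn_compact hK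
  · exact ((hc.comp (hU k).continuous).mul
      ((continuous_gradient (hU k)).inner continuous_const)).continuousOn.integrableOn_compact hK
  · have h2 : Tendsto (fun k => ENNReal.ofReal M * ∫⁻ x in tsupport φ, ‖U k x - u x‖ₑ) atTop
        (𝓝 0) := by
      simpa using ENNReal.Tendsto.const_mul tU (Or.inr ENNReal.ofReal_ne_top)
    refine tendsto_of_tendsto_of_tendsto_of_le_of_le tendsto_const_nhds h2 (fun _ => zero_le)
      fun k => ?_
    change _ ≤ ENNReal.ofReal M * ∫⁻ x in tsupport φ, ‖U k x - u x‖ₑ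
    rw [← lintegral_const_mul' _ _ ENNReal.ofReal_ne_top]
    refine lintegral_mono fun x => ?_
    rw [← ofReal_norm, ← ofReal_norm, ← ENNReal.ofReal_mul hM0]
    exact ENNReal.ofReal_le_ofReal (hlip _ _)
  -- The error splits as `F'(Uₖ)(∇Uₖ - G) + (F'(Uₖ) - F'(u)) G`. The first term is controlled by
  -- `L¹` convergence of gradients, the second by dominated convergence along the a.e. convergence
  -- of `Uₖ`.
  · have t1 : Tendsto (fun k => ENNReal.ofReal (M * ‖e‖) *
        ∫⁻ x in tsupport φ, ‖gradient (U k) x - G x‖ₑ) atTop (𝓝 0) := by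
      simpa using ENNReal.Tendsto.const_mul tG (Or.inr ENNReal.ofReal_ne_top)
    have t2 : Tendsto (fun k => ∫⁻ x in tsupport φ, ‖(F' (U k x) - F' (u x)) * inner ℝ (G x) e‖ₑ)
        atTop (𝓝 0) := by
      have hbi : Integrable (fun x => 2 * M * ‖inner ℝ (G x) e‖) (volume.restrict (tsupport φ)) :=
        ((hGi.inner_const e).norm).const_mul _
      have := tendsto_lintegral_of_dominated_convergence'
        (μ := volume.restrict (tsupport φ))
        (F := fun k x => ‖(F' (U k x) - F' (u x)) * inner ℝ (G x) e‖ₑ) (f := fun _ => 0)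
        (fun x => ‖2 * M * ‖inner ℝ (G x) e‖‖ₑ) (fun k => ?_) (fun k => ?_) ?_ ?_
      · simpa using this
      · have ms : AEStronglyMeasurable u (volume.restrict (tsupport φ)) :=
          hu.aestronglyMeasurable hK hφ.support
        exact (((hc.comp (hU k).continuous).aestronglyMeasurable.sub
          (hc.comp_aestronglyMeasurable ms)).mul (hGi.inner_const e).1).enorm
      · filter_upwards with x
        rw [← ofReal_norm, ← ofReal_norm]
        apply ENNReal.ofReal_le_ofReal
        rw [norm_mul, Real.norm_of_nonneg (r := 2 * M * _) (by positivity)]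
        gcongr
        have a1 := hM (U k x)
        have a2 := hM (u x)
        rw [Real.norm_eq_abs]
        calc |F' (U k x) - F' (u x)| ≤ |F' (U k x)| + |F' (u x)| := abs_sub _ _
          _ ≤ 2 * M := by linarith
      · exact hbi.2.ne
      · filter_upwards [aeU] with x hx
        have h3 : Tendsto (fun k => (F' (U k x) - F' (u x)) * inner ℝ (G x) e) atTop (𝓝 0) := by
          have := (((hc.tendsto (u x)).comp hx).sub_const (F' (u x))).mul_const (inner ℝ (G x) e)
          simpa using this
        simpa using h3.enorm
    have t3 := t1.add t2
    rw [add_zero] at t3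
    refine tendsto_of_tendsto_of_tendsto_of_le_of_le tendsto_const_nhds t3 (fun _ => zero_le)
      fun k => ?_
    simp only
    rw [← lintegral_const_mul' _ _ ENNReal.ofReal_ne_top, ← lintegral_add_left']
    · refine lintegral_mono fun x => ?_
      have e1 : F' (U k x) * inner ℝ (gradient (U k) x) e - inner ℝ (F' (u x) • G x) e
          = F' (U k x) * inner ℝ (gradient (U k) x - G x) e
            + (F' (U k x) - F' (u x)) * inner ℝ (G x) e := by
        rw [real_inner_smul_left, inner_sub_left]
        ring
      rw [e1]
      refine (enorm_add_le _ _).trans (add_le_add ?_ le_rfl)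
      rw [← ofReal_norm, ← ofReal_norm, ← ENNReal.ofReal_mul (by positivity)]
      apply ENNReal.ofReal_le_ofReal
      rw [norm_mul, mul_assoc]
      gcongr
      · exact hM _
      · rw [mul_comm]
        exact norm_inner_le_norm _ _
    · exact (((continuous_gradient (hU k)).aestronglyMeasurable.sub hGi.1).enorm).const_mul _

/-- A bounded version of the derivative of the positive part. -/
def posDer (t : ℝ) : ℝ := if 0 < t then 1 else if t = 0 then 1 / 2 else 0

lemma measurable_posDer : Measurable posDer :=
  Measurable.ite measurableSet_Ioi measurable_const
    (Measurable.ite (measurableSet_singleton 0) measurable_const measurable_const)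

lemma abs_posDer_le (t : ℝ) : |posDer t| ≤ 1 := by
  unfold posDer
  split_ifs <;> norm_num

/-- The positive part is the uniform limit of `(t + √(t² + a²))/2` as `a → 0`. The derivatives are
bounded by `1` and converge everywhere to `posDer`, with value `1/2` at `t = 0`, so the vanishing of
the gradient on `{u = 0}` need not be known. -/
lemma IsW12loc.posPart (hΩ : IsOpen Ω) (hu : IsW12loc Ω u G) :
    IsW12loc Ω (fun x => max (u x) 0) (fun x => posDer (u x) • G x) := by
  have m1 : ∀ K ⊆ Ω, IsCompact K → MemLp (fun x => max (u x) 0) 2 (volume.restrict K) := by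
    intro K h hK
    refine (hu.memLp K h hK).of_le (by
      exact (continuous_id.max continuous_const).comp_aestronglyMeasurable (hu.memLp K h hK).1) ?_
    filter_upwards with x
    simp only [Real.norm_eq_abs]
    rcases le_total (u x) 0 with h | h
    · simp [max_eq_right h]
    · simp [max_eq_left h]
  have m2 : ∀ K ⊆ Ω, IsCompact K → MemLp (fun x => posDer (u x) • G x) 2 (volume.restrict K) := by
    intro K h hK
    refine (hu.memLp_grad K h hK).of_le
      ((measurable_posDer.comp_aemeasurable
        (hu.memLp K h hK).1.aemeasurable).aestronglyMeasurable.smul (hu.memLp_grad K h hK).1) ?_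
    filter_upwards with x
    rw [norm_smul]
    exact mul_le_of_le_one_left (norm_nonneg _) (abs_posDer_le _)
  refine ⟨m1, m2, fun φ hφ e => ?_⟩
  have hK : IsCompact (tsupport φ) := hφ.compact
  have : IsFiniteMeasure (volume.restrict (tsupport φ)) := ⟨by simpa using hK.measure_lt_top⟩
  let a : ℕ → ℝ := fun k => 1 / ((k : ℝ) + 1)
  have ha : ∀ k, 0 < a k := fun k => by positivity
  have hat : Tendsto a atTop (𝓝 0) := tendsto_one_div_add_atTop_nhds_zero_nat
  let R : ℕ → ℝ → ℝ := fun k t => Real.sqrt (t ^ 2 + a k ^ 2)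
  have hRpos : ∀ k t, 0 < R k t := fun k t => Real.sqrt_pos.2 (by have := ha k; positivity)
  have hR1 : ∀ k t, |t| ≤ R k t := fun k t => Real.abs_le_sqrt (by nlinarith [sq_nonneg (a k)])
  have hR2 : ∀ k t, R k t ≤ |t| + a k := fun k t => by
    apply Real.sqrt_le_iff.2
    have := ha k
    refine ⟨by positivity, ?_⟩
    nlinarith [sq_abs t, abs_nonneg t]
  have hRc : ∀ k, Continuous (R k) := fun k => by
    simp only [R]
    fun_prop
  let F : ℕ → ℝ → ℝ := fun k t => (t + R k t) / 2
  let F' : ℕ → ℝ → ℝ := fun k t => (1 + t / R k t) / 2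
  have hF : ∀ k t, HasDerivAt (F k) (F' k t) t := by
    intro k t
    have h1 : HasDerivAt (fun t : ℝ => t ^ 2 + a k ^ 2) (2 * t) t := by
      simpa using (hasDerivAt_pow 2 t).add_const (a k ^ 2)
    have h2 : HasDerivAt (R k) (2 * t / (2 * Real.sqrt (t ^ 2 + a k ^ 2))) t :=
      h1.sqrt (by have := ha k; positivity)
    have h3 := ((hasDerivAt_id t).add h2).div_const 2
    refine h3.congr_deriv ?_
    rw [mul_div_mul_left _ _ two_ne_zero]
  have hF'c : ∀ k, Continuous (F' k) := fun k =>
    (continuous_const.add (continuous_id.div (hRc k) fun t => (hRpos k t).ne')).div_const 2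
  have hq : ∀ k t, |t / R k t| ≤ 1 := fun k t => by
    rw [abs_div, abs_of_pos (hRpos k t), div_le_one (hRpos k t)]
    exact hR1 k t
  have hF'b : ∀ k t, |F' k t| ≤ 1 := fun k t => by
    have h := abs_le.1 (hq k t)
    rw [abs_le]
    constructor <;> simp only [F'] <;> linarith [h.1, h.2]
  have hFm : ∀ k t, |F k t - max t 0| ≤ a k := fun k t => by
    have h1 := hR1 k t
    have h2 := hR2 k t
    have h3 := ha k
    simp only [F]
    rcases le_total t 0 with h | h
    · rw [max_eq_right h]
      rw [abs_of_nonpos h] at h1 h2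
      rw [abs_le]
      constructor <;> linarith
    · rw [max_eq_left h]
      rw [abs_of_nonneg h] at h1 h2
      rw [abs_le]
      constructor <;> linarith
  have hF't : ∀ t, Tendsto (fun k => F' k t) atTop (𝓝 (posDer t)) := by
    intro t
    have hRt : Tendsto (fun k => R k t) atTop (𝓝 |t|) := by
      have h1 : Tendsto (fun k => |t| + a k) atTop (𝓝 |t|) := by simpa using hat.const_add |t|
      exact tendsto_of_tendsto_of_tendsto_of_le_of_le tendsto_const_nhds h1
        (fun k => hR1 k t) fun k => hR2 k t
    by_cases h0 : t = 0
    · subst h0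
      simp [F', posDer]
    · have h1 := ((tendsto_const_nhds (x := t)).div hRt (abs_ne_zero.2 h0)).const_add 1
      have h2 := h1.div_const 2
      suffices h3 : posDer t = (1 + t / |t|) / 2 by
        rw [h3]
        exact h2
      unfold posDer
      rcases lt_or_gt_of_ne h0 with h | h
      · rw [if_neg (not_lt.2 h.le), if_neg h0, abs_of_neg h, div_neg, div_self h0]
        norm_num
      · rw [if_pos h, abs_of_pos h, div_self h0]
        norm_num
  have hW : ∀ k, IsW12loc Ω (fun x => F k (u x)) (fun x => F' k (u x) • G x) := fun k =>
    hu.comp_contDiff hΩ (hF k) (hF'c k) (hF'b k)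
  have hGi := hu.integrableOn_grad hK hφ.support
  have ms : AEStronglyMeasurable u (volume.restrict (tsupport φ)) :=
    hu.aestronglyMeasurable hK hφ.support
  refine weak_limit hφ e (vk := fun k x => F k (u x))
    (hk := fun k x => inner ℝ (F' k (u x) • G x) e) (fun k => (hW k).weak φ hφ e) ?_ ?_
    (fun k => (hW k).integrableOn hK hφ.support)
    (fun k => (hW k).integrableOn_inner hK hφ.support e) ?_ ?_
  · exact (m1 _ hφ.support hK).integrable (by norm_num)
  · exact ((m2 _ hφ.support hK).integrable (by norm_num)).inner_const e
  · have h2 : Tendsto (fun k => ENNReal.ofReal (a k) * volume (tsupport φ)) atTop (𝓝 0) := by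
      have := ENNReal.Tendsto.mul_const (b := volume (tsupport φ))
        (ENNReal.tendsto_ofReal hat) (Or.inr hK.measure_lt_top.ne)
      simpa using this
    refine tendsto_of_tendsto_of_tendsto_of_le_of_le tendsto_const_nhds h2 (fun _ => zero_le)
      fun k => ?_
    calc ∫⁻ x in tsupport φ, ‖F k (u x) - max (u x) 0‖ₑ
        ≤ ∫⁻ x in tsupport φ, ENNReal.ofReal (a k) := by
          refine lintegral_mono fun x => ?_
          rw [← ofReal_norm]
          exact ENNReal.ofReal_le_ofReal (hFm k _)
      _ = _ := by simp
  · have := tendsto_lintegral_of_dominated_convergence'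
      (μ := volume.restrict (tsupport φ))
      (F := fun k x => ‖inner ℝ (F' k (u x) • G x) e - inner ℝ (posDer (u x) • G x) e‖ₑ)
      (f := fun _ => 0)
      (fun x => ‖2 * ‖inner ℝ (G x) e‖‖ₑ) (fun k => ?_) (fun k => ?_) ?_ ?_
    · simpa using this
    · exact (((hW k).integrableOn_inner hK hφ.support e).1.sub
        (((m2 _ hφ.support hK).integrable (by norm_num)).inner_const e).1).enorm
    · filter_upwards with x
      rw [← ofReal_norm, ← ofReal_norm]
      apply ENNReal.ofReal_le_ofReal
      rw [real_inner_smul_left, real_inner_smul_left, ← sub_mul, norm_mul,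
        Real.norm_of_nonneg (r := 2 * _) (by positivity)]
      gcongr
      have a1 := hF'b k (u x)
      have a2 := abs_posDer_le (u x)
      rw [Real.norm_eq_abs]
      calc |F' k (u x) - posDer (u x)| ≤ |F' k (u x)| + |posDer (u x)| := abs_sub _ _
        _ ≤ 2 := by linarith
    · exact (((hGi.inner_const e).norm).const_mul 2).2.ne
    · filter_upwards with x
      have h3 : Tendsto (fun k => inner ℝ (F' k (u x) • G x) e - inner ℝ (posDer (u x) • G x) e)
          atTop (𝓝 0) := by
        simp_rw [real_inner_smul_left]
        have := (((hF't (u x)).mul_const (inner ℝ (G x) e)).sub_const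
          (posDer (u x) * inner ℝ (G x) e))
        simpa using this
      simpa using h3.enorm

/-- Truncation decreases the gradient. -/
lemma IsW12loc.clamp (hΩ : IsOpen Ω) (hu : IsW12loc Ω u G) :
    ∃ c : Amb n → ℝ, (∀ x, |c x| ≤ 1) ∧
      IsW12loc Ω (fun x => clamp (u x)) (fun x => c x • G x) := by
  have one : IsW12loc Ω (fun _ => (1 : ℝ)) (fun _ => 0) := by
    have := isW12loc_smooth (Ω := Ω) (a := fun _ : Amb n => (1 : ℝ)) contDiff_const
    rwa [gradient_fun_const'] at this
  -- Truncation is two positive parts: `clamp t = 1 - (1 - t⁺)⁺`.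
  have h1 := (hu.posPart hΩ).neg.add one
  have h2 := (h1.posPart hΩ).neg.add one
  refine ⟨fun x => posDer (-(max (u x) 0) + 1) * posDer (u x), fun x => ?_, ?_⟩
  · rw [abs_mul]
    exact mul_le_one₀ (abs_posDer_le _) (abs_nonneg _) (abs_posDer_le _)
  · convert h2 using 1
    · ext x
      unfold ACPlateau.clamp
      grind
    · ext1 x
      simp [smul_smul]

end ChainRule

/-! ### Composition with diffeomorphisms -/

section Diffeo

variable {n : ℕ} {Ω : Set (Amb n)} {u : Amb n → ℝ} {G : Amb n → Amb n}

/-- Smooth diffeomorphisms of the ambient space. -/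
structure IsDiffeo (f : Amb n ≃ₜ Amb n) : Prop where
  smooth : ContDiff ℝ ∞ f
  smooth_symm : ContDiff ℝ ∞ f.symm

lemma IsDiffeo.symm {f : Amb n ≃ₜ Amb n} (h : IsDiffeo f) : IsDiffeo f.symm :=
  ⟨h.smooth_symm, h.smooth⟩

lemma IsDiffeo.hasFDerivAt {f : Amb n ≃ₜ Amb n} (h : IsDiffeo f) (x : Amb n) :
    HasFDerivAt f (fderiv ℝ f x) x :=
  (h.smooth.differentiable (by norm_num) x).hasFDerivAt

lemma IsDiffeo.continuous_fderiv {f : Amb n ≃ₜ Amb n} (h : IsDiffeo f) :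
    Continuous (fderiv ℝ f) := h.smooth.continuous_fderiv (by norm_num)

lemma IsDiffeo.fderiv_comp_symm {f : Amb n ≃ₜ Amb n} (h : IsDiffeo f) (x : Amb n) :
    (fderiv ℝ f.symm (f x)).comp (fderiv ℝ f x) = ContinuousLinearMap.id ℝ (Amb n) := by
  have h1 := (h.symm.hasFDerivAt (f x)).comp x (h.hasFDerivAt x)
  have h2 : (f.symm ∘ f : Amb n → Amb n) = id := by
    ext1 y
    simp
  rw [h2] at h1
  exact h1.unique (hasFDerivAt_id x)

/-- Measures of images of subsets of a compact set under a diffeomorphism. -/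
lemma IsDiffeo.exists_volume_image_le {f : Amb n ≃ₜ Amb n} (h : IsDiffeo f) {K : Set (Amb n)}
    (hK : IsCompact K) : ∃ C : ℝ, 0 ≤ C ∧ ∀ s ⊆ K, MeasurableSet s →
      volume (f '' s) ≤ ENNReal.ofReal C * volume s := by
  obtain ⟨C, hC⟩ := hK.exists_bound_of_continuousOn
    (ContinuousLinearMap.continuous_det.comp h.continuous_fderiv).continuousOn
  refine ⟨max C 0, le_max_right _ _, fun s hs hm => ?_⟩
  rw [← lintegral_abs_det_fderiv_eq_addHaar_image volume hm
    (fun x _ => (h.hasFDerivAt x).hasFDerivWithinAt) f.injective.injOn]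
  calc ∫⁻ x in s, ENNReal.ofReal |(fderiv ℝ f x).det|
      ≤ ∫⁻ x in s, ENNReal.ofReal (max C 0) :=
        setLIntegral_mono' hm fun x hx =>
          ENNReal.ofReal_le_ofReal ((hC x (hs hx)).trans (le_max_left _ _))
    _ = _ := by simp

lemma IsDiffeo.exists_map_restrict_le {f : Amb n ≃ₜ Amb n} (h : IsDiffeo f) {K : Set (Amb n)}
    (hK : IsCompact K) : ∃ C : ℝ, 0 ≤ C ∧
      Measure.map f.symm (volume.restrict K)
        ≤ ENNReal.ofReal C • volume.restrict (f.symm '' K) := by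
  have hK' : IsCompact (f.symm '' K) := hK.image f.symm.continuous
  obtain ⟨C, hC0, hC⟩ := h.exists_volume_image_le hK'
  refine ⟨C, hC0, Measure.le_iff.2 fun s hs => ?_⟩
  rw [Measure.map_apply f.symm.continuous.measurable hs,
    Measure.restrict_apply (f.symm.continuous.measurable hs), Measure.smul_apply,
    Measure.restrict_apply hs, smul_eq_mul]
  have : f.symm ⁻¹' s ∩ K = f '' (s ∩ f.symm '' K) := by
    ext y
    constructor
    · rintro ⟨h1, h2⟩
      exact ⟨f.symm y, ⟨h1, mem_image_of_mem _ h2⟩, by simp⟩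
    · rintro ⟨x, ⟨h1, z, hz, rfl⟩, rfl⟩
      simpa using ⟨h1, hz⟩
  rw [this]
  exact hC _ inter_subset_right (hs.inter hK'.measurableSet)

/-- Smooth approximations on the compact set `f⁻¹(tsupport φ)` obey the classical chain rule. Their
`L¹` convergence survives composition because on compact sets the push-forward of Lebesgue measure
by `f⁻¹` is at most a constant times Lebesgue measure. -/
lemma IsW12loc.comp_diffeo (hΩ : IsOpen Ω) (hu : IsW12loc Ω u G) {f : Amb n ≃ₜ Amb n}
    (hf : IsDiffeo f) (hfΩ : f.symm '' Ω ⊆ Ω) :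
    IsW12loc Ω (fun y => u (f.symm y))
      (fun y => (fderiv ℝ f.symm y).adjoint (G (f.symm y))) := by
  have m0 : ∀ {E : Type} [NormedAddCommGroup E] {w : Amb n → E} {K : Set (Amb n)}, K ⊆ Ω →
      IsCompact K → (∀ K ⊆ Ω, IsCompact K → MemLp w 2 (volume.restrict K)) →
      MemLp (fun y => w (f.symm y)) 2 (volume.restrict K) := by
    intro E _ w K h hK hw
    obtain ⟨C, -, hC⟩ := hf.exists_map_restrict_le hK
    have h1 := hw (f.symm '' K) ((image_mono h).trans hfΩ) (hK.image f.symm.continuous)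
    have h2 : MemLp w 2 (Measure.map f.symm (volume.restrict K)) :=
      h1.of_measure_le_smul ENNReal.ofReal_ne_top hC
    exact h2.comp_of_map f.symm.continuous.measurable.aemeasurable
  have m1 : ∀ K ⊆ Ω, IsCompact K → MemLp (fun y => u (f.symm y)) 2 (volume.restrict K) :=
    fun K h hK => m0 h hK hu.memLp
  have hadj : Continuous fun y => (fderiv ℝ f.symm y).adjoint :=
    ContinuousLinearMap.adjoint.continuous.comp hf.symm.continuous_fderiv
  have m2 : ∀ K ⊆ Ω, IsCompact K →
      MemLp (fun y => (fderiv ℝ f.symm y).adjoint (G (f.symm y))) 2 (volume.restrict K) := by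
    intro K h hK
    have h1 := m0 h hK hu.memLp_grad
    obtain ⟨C, hC⟩ := hK.exists_bound_of_continuousOn hadj.continuousOn
    refine h1.of_le_mul (c := C) ?_ ?_
    · exact isBoundedBilinearMap_apply.continuous.comp_aestronglyMeasurable
        (hadj.aestronglyMeasurable.prodMk h1.1)
    · filter_upwards [ae_restrict_mem hK.measurableSet] with x hx
      exact (ContinuousLinearMap.le_opNorm _ _).trans
        (mul_le_mul_of_nonneg_right (hC x hx) (norm_nonneg _))
  refine ⟨m1, m2, fun φ hφ e => ?_⟩
  have hK : IsCompact (tsupport φ) := hφ.compact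
  have : IsFiniteMeasure (volume.restrict (tsupport φ)) := ⟨by simpa using hK.measure_lt_top⟩
  obtain ⟨U, hU, tU, tG, -⟩ := hu.exists_smooth_approx hΩ (hK.image f.symm.continuous)
    ((image_mono hφ.support).trans hfΩ)
  obtain ⟨C, hC0, hC⟩ := hf.exists_map_restrict_le hK
  have hpush : ∀ h : Amb n → ℝ≥0∞, AEMeasurable h (volume.restrict (f.symm '' tsupport φ)) →
      ∫⁻ y in tsupport φ, h (f.symm y)
        ≤ ENNReal.ofReal C * ∫⁻ x in f.symm '' tsupport φ, h x := by
    intro h hm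
    have hm' : AEMeasurable h (Measure.map f.symm (volume.restrict (tsupport φ))) :=
      (hm.smul_measure _).mono_measure hC
    rw [← lintegral_map' hm' f.symm.continuous.measurable.aemeasurable,
      ← smul_eq_mul, ← lintegral_smul_measure]
    exact lintegral_mono' hC le_rfl
  obtain ⟨D, hD⟩ := hK.exists_bound_of_continuousOn hf.symm.continuous_fderiv.continuousOn
  have hD0 : ∀ x ∈ tsupport φ, 0 ≤ D := fun x hx => (norm_nonneg _).trans (hD x hx)
  have hder : ∀ k y, fderiv ℝ (fun y => U k (f.symm y)) y e
      = inner ℝ (gradient (U k) (f.symm y)) (fderiv ℝ f.symm y e) := by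
    intro k y
    have h1 : HasFDerivAt (fun y => U k (f.symm y)) _ y :=
      (((hU k).differentiable (by norm_num)) (f.symm y)).hasFDerivAt.comp y
        (hf.symm.hasFDerivAt y)
    rw [h1.fderiv, inner_gradient_left]
    rfl
  have hUs : ∀ k, ContDiff ℝ ∞ fun y => U k (f.symm y) := fun k => (hU k).comp hf.smooth_symm
  have hKs : f.symm '' tsupport φ ⊆ Ω := (image_mono hφ.support).trans hfΩ
  have hK' := hK.image f.symm.continuous
  refine weak_limit hφ e (vk := fun k y => U k (f.symm y))
    (hk := fun k y => inner ℝ (gradient (U k) (f.symm y)) (fderiv ℝ f.symm y e))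
    (fun k => ?_) ?_ ?_ (fun k => ?_) (fun k => ?_) ?_ ?_
  · have h := weak_of_contDiff (Ω := Ω) ((hUs k).of_le (by norm_num)) hφ e
    simp_rw [hder] at h
    exact h
  · exact (m1 _ hφ.support hK).integrable (by norm_num)
  · exact ((m2 _ hφ.support hK).integrable (by norm_num)).inner_const e
  · exact (hUs k).continuous.continuousOn.integrableOn_compact hK
  · exact (((continuous_gradient (hU k)).comp f.symm.continuous).inner
      (hf.symm.continuous_fderiv.clm_apply continuous_const)).continuousOn.integrableOn_compact hK
  · have t1 : Tendsto (fun k => ENNReal.ofReal C *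
        ∫⁻ x in f.symm '' tsupport φ, ‖U k x - u x‖ₑ) atTop (𝓝 0) := by
      simpa using ENNReal.Tendsto.const_mul tU (Or.inr ENNReal.ofReal_ne_top)
    refine tendsto_of_tendsto_of_tendsto_of_le_of_le tendsto_const_nhds t1 (fun _ => zero_le)
      fun k => ?_
    exact hpush (fun x => ‖U k x - u x‖ₑ)
      ((hU k).continuous.aestronglyMeasurable.sub (hu.memLp _ hKs hK').1).enorm
  · have t1 : Tendsto (fun k => ENNReal.ofReal (D * ‖e‖) * (ENNReal.ofReal C *
        ∫⁻ x in f.symm '' tsupport φ, ‖gradient (U k) x - G x‖ₑ)) atTop (𝓝 0) := by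
      have h := ENNReal.Tendsto.const_mul tG (Or.inr (ENNReal.ofReal_ne_top (r := C)))
      simpa using ENNReal.Tendsto.const_mul h (Or.inr (ENNReal.ofReal_ne_top (r := D * ‖e‖)))
    refine tendsto_of_tendsto_of_tendsto_of_le_of_le tendsto_const_nhds t1 (fun _ => zero_le)
      fun k => ?_
    refine le_trans ?_ (mul_le_mul_right (hpush (fun x => ‖gradient (U k) x - G x‖ₑ)
      ((continuous_gradient (hU k)).aestronglyMeasurable.sub
        (hu.memLp_grad _ hKs hK').1).enorm) _)
    rw [← lintegral_const_mul' _ _ ENNReal.ofReal_ne_top]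
    refine setLIntegral_mono' hK.measurableSet fun y hy => ?_
    rw [ContinuousLinearMap.adjoint_inner_left, ← inner_sub_left, ← ofReal_norm, ← ofReal_norm,
      ← ENNReal.ofReal_mul (mul_nonneg (hD0 y hy) (norm_nonneg _))]
    apply ENNReal.ofReal_le_ofReal
    rw [mul_comm]
    refine (norm_inner_le_norm _ _).trans (mul_le_mul_of_nonneg_left ?_ (norm_nonneg _))
    exact (ContinuousLinearMap.le_opNorm _ _).trans
      (mul_le_mul_of_nonneg_right (hD y hy) (norm_nonneg _))

end Diffeo

end ACPlateau

end

noncomputable section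

namespace ACPlateau

/-! ### Mean values of smooth functions -/

section SmoothMean

variable {n : ℕ}

/-- The standard basis of the ambient space. -/
def ebasis (n : ℕ) (i : Fin (n + 1)) : Amb n := EuclideanSpace.single i 1

/-- The Laplacian. -/
def lap (f : Amb n → ℝ) (x : Amb n) : ℝ :=
  ∑ i, fderiv ℝ (fun y => fderiv ℝ f y (ebasis n i)) x (ebasis n i)

lemma inner_ebasis (y : Amb n) (i : Fin (n + 1)) : inner ℝ y (ebasis n i) = y i := by
  simp [ebasis, EuclideanSpace.inner_single_right]

lemma sum_smul_ebasis (y : Amb n) : ∑ i, y i • ebasis n i = y := by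
  ext j
  simp [ebasis, Pi.single_apply]

lemma contDiff_fderiv_apply {f : Amb n → ℝ} (hf : ContDiff ℝ ∞ f) (e : Amb n) :
    ContDiff ℝ ∞ fun y => fderiv ℝ f y e :=
  (hf.fderiv_right (m := ∞) (by norm_num)).clm_apply contDiff_const

lemma continuous_lap {f : Amb n → ℝ} (hf : ContDiff ℝ ∞ f) : Continuous (lap f) :=
  continuous_finsetSum _ fun i _ =>
    (contDiff_fderiv_apply (contDiff_fderiv_apply hf _) (ebasis n i)).continuous

/-- The function `(1 - |y|²)₊`. -/
def parab (y : Amb n) : ℝ := 1 - min ‖y‖ 1 ^ 2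

lemma parab_nonneg (y : Amb n) : 0 ≤ parab y := by
  unfold parab
  have h1 : min ‖y‖ 1 ≤ 1 := min_le_right _ _
  have h0 : 0 ≤ min ‖y‖ 1 := le_min (norm_nonneg _) zero_le_one
  nlinarith

lemma parab_le_one (y : Amb n) : parab y ≤ 1 := by
  unfold parab
  nlinarith [sq_nonneg (min ‖y‖ 1)]

lemma parab_eq_zero {y : Amb n} (h : 1 ≤ ‖y‖) : parab y = 0 := by
  simp [parab, min_eq_right h]

lemma parab_of_lt {y : Amb n} (h : ‖y‖ < 1) : parab y = 1 - ‖y‖ ^ 2 := by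
  simp [parab, min_eq_left h.le]

/-- The Lipschitz bound justifies integration by parts against `parab` on the whole space, so no
boundary integral over the sphere occurs. -/
lemma lipschitz_parab : LipschitzWith 2 (parab (n := n)) := by
  refine LipschitzWith.of_dist_le_mul fun x y => ?_
  rw [Real.dist_eq]
  unfold parab
  have hx1 : min ‖x‖ 1 ≤ 1 := min_le_right _ _
  have hx0 : 0 ≤ min ‖x‖ 1 := le_min (norm_nonneg _) zero_le_one
  have hy1 : min ‖y‖ 1 ≤ 1 := min_le_right _ _
  have hy0 : 0 ≤ min ‖y‖ 1 := le_min (norm_nonneg _) zero_le_one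
  have h1 : |min ‖x‖ 1 - min ‖y‖ 1| ≤ dist x y := by
    refine (abs_min_sub_min_le_max _ _ _ _).trans ?_
    rw [sub_self, abs_zero, max_eq_left (abs_nonneg _), dist_eq_norm]
    exact abs_norm_sub_norm_le x y
  have h2 : 1 - min ‖x‖ 1 ^ 2 - (1 - min ‖y‖ 1 ^ 2)
      = (min ‖y‖ 1 - min ‖x‖ 1) * (min ‖x‖ 1 + min ‖y‖ 1) := by ring
  rw [h2, abs_mul, abs_sub_comm, abs_of_nonneg (a := min ‖x‖ 1 + min ‖y‖ 1) (by positivity),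
    mul_comm]
  have h3 : min ‖x‖ 1 + min ‖y‖ 1 ≤ 2 := by linarith
  exact mul_le_mul h3 h1 (abs_nonneg _) (by norm_num)

lemma lineDeriv_parab_of_lt {y : Amb n} (h : ‖y‖ < 1) (v : Amb n) :
    lineDeriv ℝ (parab (n := n)) y v = -2 * inner ℝ y v := by
  have he : parab =ᶠ[𝓝 y] fun y : Amb n => 1 - ‖y‖ ^ 2 := by
    filter_upwards [(continuous_norm.tendsto y).eventually_lt_const h] with z hz
    exact parab_of_lt hz
  have hd : HasFDerivAt (fun y : Amb n => 1 - ‖y‖ ^ 2) (-(2 • innerSL ℝ y)) y :=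
    (hasStrictFDerivAt_norm_sq y).hasFDerivAt.const_sub 1
  have hd' : HasFDerivAt (parab (n := n)) (-(2 • innerSL ℝ y)) y := hd.congr_of_eventuallyEq he
  rw [hd'.differentiableAt.lineDeriv_eq_fderiv, hd'.fderiv]
  simp

lemma lineDeriv_parab_of_gt {y : Amb n} (h : 1 < ‖y‖) (v : Amb n) :
    lineDeriv ℝ (parab (n := n)) y v = 0 := by
  have he : parab =ᶠ[𝓝 y] fun _ : Amb n => (0 : ℝ) := by
    filter_upwards [(continuous_norm.tendsto y).eventually_const_lt h] with z hz
    exact parab_eq_zero hz.le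
  have hd : HasFDerivAt (parab (n := n)) (0 : Amb n →L[ℝ] ℝ) y :=
    (hasFDerivAt_const 0 y).congr_of_eventuallyEq he
  rw [hd.differentiableAt.lineDeriv_eq_fderiv, hd.fderiv]
  simp

/-- Integration by parts on the unit ball against `(1 - |y|²)`. -/
lemma integral_ball_mul_inner {g : Amb n → ℝ} (hg : ContDiff ℝ ∞ g) (hgc : HasCompactSupport g)
    (e : Amb n) : 2 * ∫ y in Metric.ball 0 1, g y * inner ℝ y e
      = ∫ y in Metric.ball 0 1, parab y * fderiv ℝ g y e := by
  obtain ⟨D, hD⟩ := ContDiff.lipschitzWith_of_hasCompactSupport hgc hg (by norm_num)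
  have h := LipschitzWith.integral_lineDeriv_mul_eq (μ := (volume : Measure (Amb n)))
    lipschitz_parab hD hgc e
  have e1 : ∫ y, lineDeriv ℝ (parab (n := n)) y e * g y
      = ∫ y in Metric.ball 0 1, -2 * (g y * inner ℝ y e) := by
    rw [← integral_indicator Metric.isOpen_ball.measurableSet]
    refine integral_congr_ae ?_
    -- The gradient of `parab` is `-2y` inside the unit ball and `0` outside; the sphere in between
    -- is null.
    have hs : ∀ᵐ y : Amb n, y ∉ Metric.sphere (0 : Amb n) 1 := by
      rw [ae_iff]
      simp only [not_not, ofPred_mem_eq]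
      exact Measure.addHaar_sphere (volume : Measure (Amb n)) 0 1
    filter_upwards [hs] with y hy
    rw [mem_sphere_zero_iff_norm] at hy
    rcases lt_or_gt_of_ne hy with h | h
    · rw [indicator_of_mem (by simpa using h), lineDeriv_parab_of_lt h]
      ring
    · rw [indicator_of_notMem (by simpa using h.le), lineDeriv_parab_of_gt h, zero_mul]
  have e2 : ∫ y, lineDeriv ℝ g y (-e) * parab y
      = ∫ y in Metric.ball 0 1, -(parab y * fderiv ℝ g y e) := by
    rw [← integral_indicator Metric.isOpen_ball.measurableSet]
    congr 1
    ext y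
    rw [(hg.differentiable (by norm_num) y).lineDeriv_eq_fderiv, map_neg]
    by_cases h : y ∈ Metric.ball (0 : Amb n) 1
    · rw [indicator_of_mem h]
      ring
    · rw [indicator_of_notMem h, parab_eq_zero (by simpa using h), mul_zero]
  rw [e1, e2, integral_neg, integral_const_mul] at h
  linarith

lemma hasDerivAt_integral_dilate {f : Amb n → ℝ} (hf : ContDiff ℝ ∞ f) (hc : HasCompactSupport f)
    (x : Amb n) (r : ℝ) :
    HasDerivAt (fun r => ∫ y in Metric.ball (0 : Amb n) 1, f (x + r • y))
      (∫ y in Metric.ball (0 : Amb n) 1, fderiv ℝ f (x + r • y) y) r := by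
  have hfc := hf.continuous
  have hf' := hf.continuous_fderiv (by norm_num)
  obtain ⟨M, hM⟩ := (hc.fderiv ℝ).exists_bound_of_continuous hf'
  have : IsFiniteMeasure (volume.restrict (Metric.ball (0 : Amb n) 1)) :=
    ⟨by simpa using measure_ball_lt_top⟩
  obtain ⟨M0, hM0⟩ := hc.exists_bound_of_continuous hfc
  refine (hasDerivAt_integral_of_dominated_loc_of_deriv_le (s := univ) (bound := fun _ => M)
    (F' := fun r y => fderiv ℝ f (x + r • y) y) univ_mem
    (Eventually.of_forall fun r => ?_) ?_ ?_ ?_ (integrable_const M) ?_).2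
  · exact (hfc.comp (by fun_prop)).aestronglyMeasurable
  · refine Integrable.of_bound (hfc.comp (by fun_prop)).aestronglyMeasurable M0 ?_
    filter_upwards with y
    exact hM0 _
  · have : Continuous fun y => fderiv ℝ f (x + r • y) y :=
      (hf'.comp (by fun_prop)).clm_apply continuous_id
    exact this.aestronglyMeasurable
  · filter_upwards [ae_restrict_mem Metric.isOpen_ball.measurableSet] with y hy s _
    refine (ContinuousLinearMap.le_opNorm _ _).trans ?_
    have h1 : ‖y‖ ≤ 1 := by
      rw [mem_ball_zero_iff] at hy
      exact hy.le
    exact (mul_le_of_le_one_right (norm_nonneg _) h1).trans (hM _)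
  · filter_upwards with y s _
    have h1 : HasDerivAt (fun s : ℝ => x + s • y) y s := by
      simpa using ((hasDerivAt_id s).smul_const y).const_add x
    exact ((hf.differentiable (by norm_num) _).hasFDerivAt).comp_hasDerivAt s h1

/-- The derivative of the mean values of a function in terms of its Laplacian. -/
lemma integral_fderiv_dilate {f : Amb n → ℝ} (hf : ContDiff ℝ ∞ f) (hc : HasCompactSupport f)
    (x : Amb n) {r : ℝ} (hr : 0 < r) :
    ∫ y in Metric.ball (0 : Amb n) 1, fderiv ℝ f (x + r • y) y
      = r / 2 * ∫ y in Metric.ball (0 : Amb n) 1, parab y * lap f (x + r • y) := by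
  let φ : Amb n ≃ₜ Amb n := (Homeomorph.smulOfNeZero r hr.ne').trans (Homeomorph.addLeft x)
  have hφ : ∀ y, φ y = x + r • y := fun y => rfl
  have hφs : ContDiff ℝ ∞ φ := by
    have : (φ : Amb n → Amb n) = fun y => x + r • y := rfl
    rw [this]
    fun_prop
  have hderφ : ∀ y, HasFDerivAt (fun y : Amb n => x + r • y)
      (r • ContinuousLinearMap.id ℝ (Amb n)) y := fun y =>
    ((hasFDerivAt_id y).const_smul r).const_add x
  have hgs : ∀ i, ContDiff ℝ ∞ fun y => fderiv ℝ f (x + r • y) (ebasis n i) := fun i =>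
    (contDiff_fderiv_apply hf (ebasis n i)).comp hφs
  have hgc : ∀ i, HasCompactSupport fun y => fderiv ℝ f (x + r • y) (ebasis n i) := fun i =>
    (hc.fderiv_apply ℝ (ebasis n i)).comp_homeomorph φ
  have key := fun i => integral_ball_mul_inner (hgs i) (hgc i) (ebasis n i)
  have hder : ∀ i y, fderiv ℝ (fun y => fderiv ℝ f (x + r • y) (ebasis n i)) y (ebasis n i)
      = r * fderiv ℝ (fun y => fderiv ℝ f y (ebasis n i)) (x + r • y) (ebasis n i) := by
    intro i y
    have h0 : HasFDerivAt (fun y => fderiv ℝ f y (ebasis n i)) _ (x + r • y) :=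
      ((contDiff_fderiv_apply hf (ebasis n i)).differentiable (by norm_num) _).hasFDerivAt
    have h1 : HasFDerivAt (fun y => fderiv ℝ f (x + r • y) (ebasis n i)) _ y :=
      HasFDerivAt.comp (f := fun y => x + r • y) y h0 (hderφ y)
    rw [h1.fderiv]
    simp
  have hIntgr : ∀ h : Amb n → ℝ, Continuous h → IntegrableOn h (Metric.ball 0 1) := fun h hh =>
    (hh.continuousOn.integrableOn_compact (isCompact_closedBall 0 1)).mono_set
      Metric.ball_subset_closedBall
  have e1 : ∫ y in Metric.ball (0 : Amb n) 1, fderiv ℝ f (x + r • y) y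
      = ∑ i, ∫ y in Metric.ball (0 : Amb n) 1,
          fderiv ℝ f (x + r • y) (ebasis n i) * inner ℝ y (ebasis n i) := by
    rw [← integral_finsetSum]
    · congr 1
      ext y
      conv_lhs => rw [← sum_smul_ebasis y]
      rw [map_sum]
      refine Finset.sum_congr rfl fun i _ => ?_
      rw [map_smul, inner_ebasis, smul_eq_mul, sum_smul_ebasis]
      ring
    · intro i _
      exact hIntgr _ ((hgs i).continuous.mul (continuous_id.inner continuous_const))
  have e2 : ∫ y in Metric.ball (0 : Amb n) 1, parab y * lap f (x + r • y)
      = ∑ i, ∫ y in Metric.ball (0 : Amb n) 1, parab y *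
          fderiv ℝ (fun y => fderiv ℝ f y (ebasis n i)) (x + r • y) (ebasis n i) := by
    rw [← integral_finsetSum]
    · congr 1
      ext y
      rw [lap, Finset.mul_sum]
    · intro i _
      exact hIntgr _ (lipschitz_parab.continuous.mul
        ((contDiff_fderiv_apply (contDiff_fderiv_apply hf _) _).continuous.comp hφs.continuous))
  rw [e1, e2, Finset.mul_sum]
  refine Finset.sum_congr rfl fun i _ => ?_
  have h := key i
  simp_rw [hder] at h
  have e3 : ∫ y in Metric.ball (0 : Amb n) 1, parab y *
        (r * fderiv ℝ (fun y => fderiv ℝ f y (ebasis n i)) (x + r • y) (ebasis n i))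
      = r * ∫ y in Metric.ball (0 : Amb n) 1, parab y *
        fderiv ℝ (fun y => fderiv ℝ f y (ebasis n i)) (x + r • y) (ebasis n i) := by
    rw [← integral_const_mul]
    congr 1
    ext y
    ring
  rw [e3] at h
  linarith

/-- The weighted mean values of a smooth nonnegative function with `Δf ≤ C f` are monotone. -/
lemma antitoneOn_integral_dilate {f : Amb n → ℝ} (hf : ContDiff ℝ ∞ f) (hc : HasCompactSupport f)
    {x : Amb n} {R C : ℝ} (hC : 0 ≤ C) (h0 : ∀ y ∈ Metric.ball x R, 0 ≤ f y)
    (hl : ∀ y ∈ Metric.ball x R, lap f y ≤ C * f y) :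
    AntitoneOn (fun r => Real.exp (-(C * r ^ 2 / 4)) *
      ∫ y in Metric.ball (0 : Amb n) 1, f (x + r • y)) (Icc 0 R) := by
  -- The logarithmic derivative `-C r / 2` of the weight exactly absorbs the bound `(r/2) C ∫ f` on
  -- the derivative of the integral.
  have hexp : ∀ r : ℝ, HasDerivAt (fun r => Real.exp (-(C * r ^ 2 / 4)))
      (Real.exp (-(C * r ^ 2 / 4)) * (-(C * (2 * r) / 4))) r := by
    intro r
    have h1 : HasDerivAt (fun r : ℝ => -(C * r ^ 2 / 4)) (-(C * (2 * r) / 4)) r := by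
      have := (((hasDerivAt_pow 2 r).const_mul C).div_const 4).fun_neg
      simpa using this
    exact h1.exp
  have hd := fun r => (hexp r).mul (hasDerivAt_integral_dilate hf hc x r)
  refine antitoneOn_of_deriv_nonpos (convex_Icc 0 R) (fun r _ => (hd r).continuousAt.continuousWithinAt)
    (fun r _ => (hd r).differentiableAt.differentiableWithinAt) fun r hr => ?_
  rw [interior_Icc] at hr
  have hmem : ∀ y ∈ Metric.ball (0 : Amb n) 1, x + r • y ∈ Metric.ball x R := by
    intro y hy
    rw [mem_ball_zero_iff] at hy
    rw [mem_ball_iff_norm, add_sub_cancel_left, norm_smul, Real.norm_of_nonneg hr.1.le]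
    nlinarith [norm_nonneg y, hr.1, hr.2]
  have hcont : Continuous fun y : Amb n => x + r • y := by fun_prop
  have hIntgr : ∀ h : Amb n → ℝ, Continuous h → IntegrableOn h (Metric.ball 0 1) := fun h hh =>
    (hh.continuousOn.integrableOn_compact (isCompact_closedBall 0 1)).mono_set
      Metric.ball_subset_closedBall
  -- Since `0 ≤ parab ≤ 1` and `f ≥ 0`, the factor `parab` can be dropped after `Δf ≤ C f` has been
  -- used.
  have hle : ∫ y in Metric.ball (0 : Amb n) 1, parab y * lap f (x + r • y)
      ≤ ∫ y in Metric.ball (0 : Amb n) 1, C * f (x + r • y) := by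
    refine setIntegral_mono_on (hIntgr _ (lipschitz_parab.continuous.mul
      ((continuous_lap hf).comp hcont))) (hIntgr _ (continuous_const.mul (hf.continuous.comp hcont)))
      Metric.isOpen_ball.measurableSet fun y hy => ?_
    have h1 := hl _ (hmem y hy)
    have h2 := mul_nonneg hC (h0 _ (hmem y hy))
    have h3 := parab_nonneg y
    have h4 := parab_le_one y
    calc parab y * lap f (x + r • y) ≤ parab y * (C * f (x + r • y)) := by gcongr
      _ ≤ 1 * (C * f (x + r • y)) := by gcongr
      _ = _ := one_mul _
  rw [integral_const_mul] at hle
  have hderiv : deriv (fun r => Real.exp (-(C * r ^ 2 / 4)) *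
      ∫ y in Metric.ball (0 : Amb n) 1, f (x + r • y)) r = _ := (hd r).deriv
  rw [hderiv, integral_fderiv_dilate hf hc x hr.1]
  have hE := Real.exp_pos (-(C * r ^ 2 / 4))
  have h5 : r / 2 * ∫ y in Metric.ball (0 : Amb n) 1, parab y * lap f (x + r • y)
      ≤ r / 2 * (C * ∫ y in Metric.ball (0 : Amb n) 1, f (x + r • y)) :=
    mul_le_mul_of_nonneg_left hle (by linarith [hr.1])
  have h6 := mul_le_mul_of_nonneg_left h5 hE.le
  calc _ ≤ Real.exp (-(C * r ^ 2 / 4)) * (-(C * (2 * r) / 4)) *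
        (∫ y in Metric.ball (0 : Amb n) 1, f (x + r • y)) + Real.exp (-(C * r ^ 2 / 4)) *
        (r / 2 * (C * ∫ y in Metric.ball (0 : Amb n) 1, f (x + r • y))) := by gcongr
    _ = 0 := by ring

end SmoothMean

end ACPlateau

end

noncomputable section

namespace ACPlateau

/-! ### Mean values of weak supersolutions -/

section Supersolutions

variable {n : ℕ}

/-- `z ∈ [0,1]` is a distributional solution of `Δz ≤ C z` in `U`. -/
structure IsSupersol (U : Set (Amb n)) (z : Amb n → ℝ) (C : ℝ) : Prop where
  meas : AEStronglyMeasurable z volume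
  range : ∀ᵐ x, z x ∈ Icc (0 : ℝ) 1
  ineq : ∀ φ : Amb n → ℝ, IsTest U φ → (∀ x, 0 ≤ φ x) →
    ∫ x, z x * lap φ x ≤ C * ∫ x, z x * φ x

lemma integral_dilate_eq (g : Amb n → ℝ) (x : Amb n) {r : ℝ} (hr : 0 < r) :
    ∫ y in Metric.ball (0 : Amb n) 1, g (x + r • y)
      = (r ^ (n + 1))⁻¹ * ∫ y in Metric.ball x r, g y := by
  have h := Measure.setIntegral_comp_smul_of_pos (volume : Measure (Amb n))
    (fun y => g (x + y)) (Metric.ball (0 : Amb n) 1) hr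
  rw [h, smul_unitBall_of_pos hr, smul_eq_mul]
  congr 1
  · simp
  · have h2 := (measurePreserving_add_left (volume : Measure (Amb n)) x).setIntegral_preimage_emb
      (Homeomorph.addLeft x).measurableEmbedding g (Metric.ball x r)
    rw [← h2]
    congr 2
    ext y
    simp

lemma average_ball_eq (g : Amb n → ℝ) (x : Amb n) {r : ℝ} (hr : 0 < r) :
    ⨍ y in Metric.ball x r, g y = (volume.real (Metric.ball (0 : Amb n) 1))⁻¹ *
      ((r ^ (n + 1))⁻¹ * ∫ y in Metric.ball x r, g y) := by
  rw [setAverage_eq, smul_eq_mul, measureReal_def, Measure.addHaar_ball _ x hr.le,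
    ENNReal.toReal_mul, ENNReal.toReal_ofReal (by positivity), ← measureReal_def, mul_inv]
  simp
  ring

lemma volume_real_ball_pos (x : Amb n) {r : ℝ} (hr : 0 < r) : 0 < volume.real (Metric.ball x r) :=
  ENNReal.toReal_pos (Metric.measure_ball_pos _ _ hr).ne' measure_ball_lt_top.ne

/-- Both derivatives fall on the kernel, and the two signs produced by the reflection `t ↦ x - t`
cancel. The result is a pairing of `g` with the Laplacian of a test function, as in the definition
of `IsSupersol`. -/
lemma lap_mollify (k : ℕ) {g : Amb n → ℝ} (hg : LocallyIntegrable g) (x : Amb n) :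
    lap (mollify k g) x = ∫ t, g t * lap (fun t => mollKernel n k (x - t)) t := by
  have hK := contDiff_mollKernel n k
  have hKc := hasCompactSupport_mollKernel n k
  have e1 : ∀ e, (fun y => fderiv ℝ (mollify k g) y e)
      = fun y => ∫ t, fderiv ℝ (mollKernel n k) (y - t) e * g t := fun e =>
    funext fun y => fderiv_mollify_apply k hg y e
  have hdiff : ∀ {κ : Amb n → ℝ}, ContDiff ℝ ∞ κ → ∀ t e,
      fderiv ℝ (fun t => κ (x - t)) t e = - fderiv ℝ κ (x - t) e := by
    intro κ hκ t e
    have h1 : HasFDerivAt (fun t : Amb n => x - t) (-(ContinuousLinearMap.id ℝ (Amb n))) t :=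
      (hasFDerivAt_id t).const_sub x
    have h2 : HasFDerivAt κ (fderiv ℝ κ (x - t)) (x - t) :=
      (hκ.differentiable (by norm_num) _).hasFDerivAt
    have h3 : HasFDerivAt (fun t => κ (x - t)) _ t := h2.comp t h1
    rw [h3.fderiv]
    simp
  have e2 : ∀ t, lap (fun t => mollKernel n k (x - t)) t = lap (mollKernel n k) (x - t) := by
    intro t
    unfold lap
    refine Finset.sum_congr rfl fun i _ => ?_
    have : (fun t => fderiv ℝ (fun t => mollKernel n k (x - t)) t (ebasis n i))
        = fun t => -fderiv ℝ (mollKernel n k) (x - t) (ebasis n i) :=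
      funext fun t => hdiff hK t _
    rw [this, fderiv_fun_neg, neg_apply,
      hdiff (contDiff_fderiv_apply hK (ebasis n i)), neg_neg]
  simp_rw [e2]
  unfold lap
  simp_rw [e1, Finset.mul_sum]
  rw [integral_finsetSum]
  · refine Finset.sum_congr rfl fun i _ => ?_
    rw [fderiv_integral_kernel (contDiff_fderiv_apply hK (ebasis n i))
      (hKc.fderiv_apply ℝ (ebasis n i)) hg]
    congr 1
    ext t
    ring
  · intro i _
    have hc2 : HasCompactSupport fun y =>
        fderiv ℝ (fun y => fderiv ℝ (mollKernel n k) y (ebasis n i)) y (ebasis n i) :=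
      (hKc.fderiv_apply ℝ (ebasis n i)).fderiv_apply ℝ (ebasis n i)
    have := hc2.convolutionExists_left
      (μ := (volume : Measure (Amb n))) (ContinuousLinearMap.lsmul ℝ ℝ)
      (contDiff_fderiv_apply (contDiff_fderiv_apply hK (ebasis n i)) (ebasis n i)).continuous hg x
    refine this.integrable_swap.congr (Eventually.of_forall fun t => ?_)
    simp [mul_comm]

namespace IsSupersol

variable {U : Set (Amb n)} {z : Amb n → ℝ} {C : ℝ}

lemma locallyIntegrable (h : IsSupersol U z C) : LocallyIntegrable z := by
  refine (locallyIntegrable_const (1 : ℝ)).mono h.meas ?_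
  filter_upwards [h.range] with x hx
  rw [Real.norm_of_nonneg hx.1, norm_one]
  exact hx.2

lemma integrableOn_ball (h : IsSupersol U z C) (x : Amb n) (r : ℝ) :
    IntegrableOn z (Metric.ball x r) :=
  (h.locallyIntegrable.integrableOn_isCompact (isCompact_closedBall x r)).mono_set
    Metric.ball_subset_closedBall

lemma setIntegral_nonneg (h : IsSupersol U z C) (s : Set (Amb n)) : 0 ≤ ∫ y in s, z y :=
  integral_nonneg_of_ae (by
    filter_upwards [ae_restrict_of_ae h.range] with x hx
    exact hx.1)

lemma average_nonneg (h : IsSupersol U z C) (x : Amb n) (r : ℝ) :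
    0 ≤ ⨍ y in Metric.ball x r, z y := by
  rw [setAverage_eq]
  exact smul_nonneg (by positivity) (h.setIntegral_nonneg _)

lemma average_le_one (h : IsSupersol U z C) (x : Amb n) {r : ℝ} (hr : 0 < r) :
    ⨍ y in Metric.ball x r, z y ≤ 1 := by
  have hv := volume_real_ball_pos x hr
  rw [setAverage_eq, smul_eq_mul, inv_mul_le_iff₀ hv, mul_one]
  have h1 : ∫ y in Metric.ball x r, z y ≤ ∫ y in Metric.ball x r, (1 : ℝ) := by
    refine setIntegral_mono_ae (h.integrableOn_ball x r)
      (integrableOn_const measure_ball_lt_top.ne) ?_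
    filter_upwards [h.range] with y hy
    exact hy.2
  simpa using h1

/-- Mollifications of `z`, truncated to the closed `R`-ball, satisfy `Δf ≤ C f` at points whose
distance to the boundary of the ball exceeds the mollification radius, since the translated kernel
is then an admissible nonnegative test function. The monotonicity for smooth functions passes to the
limit in `L¹`. -/
lemma antitoneOn_average (h : IsSupersol U z C) (hC : 0 ≤ C) {x : Amb n} {R : ℝ}
    (hR : Metric.closedBall x R ⊆ U) :
    AntitoneOn (fun r => Real.exp (-(C * r ^ 2 / 4)) * ⨍ y in Metric.ball x r, z y) (Ioo 0 R) := by
  let w : Amb n → ℝ := (Metric.closedBall x R).indicator z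
  have hwi : Integrable w := by
    rw [integrable_indicator_iff Metric.isClosed_closedBall.measurableSet]
    exact h.locallyIntegrable.integrableOn_isCompact (isCompact_closedBall x R)
  have hw0 : ∀ᵐ y, 0 ≤ w y := by
    filter_upwards [h.range] with y hy
    exact indicator_nonneg (fun _ _ => hy.1) y
  have hwc : HasCompactSupport w :=
    HasCompactSupport.intro (isCompact_closedBall x R) fun y hy => indicator_of_notMem hy _
  have hmc : ∀ k, HasCompactSupport (mollify k w) := fun k =>
    (hasCompactSupport_mollKernel n k).convolution _ hwc
  have hms : ∀ k, ContDiff ℝ ∞ (mollify k w) := fun k => contDiff_mollify k hwi.locallyIntegrable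
  have hm0 : ∀ k y, 0 ≤ mollify k w y := by
    intro k y
    rw [mollify_apply']
    refine integral_nonneg_of_ae ?_
    filter_upwards [hw0] with t ht
    exact mul_nonneg (mollKernel_nonneg n k _) ht
  have hlap : ∀ (k : ℕ) y, Metric.closedBall y (1 / ((k : ℝ) + 1)) ⊆ Metric.closedBall x R →
      lap (mollify k w) y ≤ C * mollify k w y := by
    intro k y hy
    have hts : tsupport (fun t => mollKernel n k (y - t)) ⊆ Metric.closedBall x R := by
      have : tsupport (fun t => mollKernel n k (y - t))
          ⊆ Metric.closedBall y (1 / ((k : ℝ) + 1)) := by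
        refine closure_minimal (fun t ht => ?_) Metric.isClosed_closedBall
        have h1 : y - t ∈ Function.support (mollKernel n k) := ht
        rw [support_mollKernel, mem_ball_zero_iff] at h1
        rw [mem_closedBall_iff_norm, norm_sub_rev]
        exact h1.le
      exact this.trans hy
    have htest : IsTest U fun t => mollKernel n k (y - t) :=
      ⟨(contDiff_mollKernel n k).comp (contDiff_const.sub contDiff_id),
        (hasCompactSupport_mollKernel n k).comp_homeomorph (Homeomorph.subLeft y),
        hts.trans hR⟩
    have hi := h.ineq _ htest fun t => mollKernel_nonneg n k _
    rw [lap_mollify k hwi.locallyIntegrable, mollify_apply']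
    have e1 : ∀ t, w t * lap (fun t => mollKernel n k (y - t)) t
        = z t * lap (fun t => mollKernel n k (y - t)) t := by
      intro t
      by_cases ht : t ∈ Metric.closedBall x R
      · simp only [w, indicator_of_mem ht]
      · have h0 : lap (fun t => mollKernel n k (y - t)) t = 0 := by
          unfold lap
          refine Finset.sum_eq_zero fun i _ => ?_
          have h1 : t ∉ tsupport fun t => fderiv ℝ (fun t => mollKernel n k (y - t)) t (ebasis n i) :=
            fun h' => ht (hts (tsupport_fderiv_apply_subset ℝ _ h'))
          rw [fderiv_eq_zero_of_notMem_tsupport h1]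
          rfl
        rw [h0, mul_zero, mul_zero]
    have e2 : ∀ t, mollKernel n k (y - t) • w t = z t * mollKernel n k (y - t) := by
      intro t
      by_cases ht : t ∈ Metric.closedBall x R
      · simp only [w, indicator_of_mem ht, smul_eq_mul, mul_comm]
      · have : mollKernel n k (y - t) = 0 :=
          image_eq_zero_of_notMem_tsupport (f := fun t => mollKernel n k (y - t))
            fun h' => ht (hts h')
        simp [this]
    simp_rw [e1, e2]
    exact hi
  have hlim : ∀ r ∈ Ioo 0 R, Tendsto (fun k => ∫ y in Metric.ball (0 : Amb n) 1,
      mollify k w (x + r • y)) atTop (𝓝 ((r ^ (n + 1))⁻¹ * ∫ y in Metric.ball x r, z y)) := by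
    intro r hr
    simp_rw [fun k => integral_dilate_eq (mollify k w) x hr.1]
    refine Tendsto.const_mul _ ?_
    have e1 : ∫ y in Metric.ball x r, z y = ∫ y in Metric.ball x r, w y := by
      refine setIntegral_congr_fun Metric.isOpen_ball.measurableSet fun y hy => ?_
      simp only [w]
      rw [indicator_of_mem]
      exact Metric.ball_subset_closedBall (Metric.ball_subset_ball hr.2.le hy)
    rw [e1]
    refine tendsto_setIntegral_of_L1 _ hwi.1 (Eventually.of_forall fun k =>
      ((hms k).continuous.integrable_of_hasCompactSupport (hmc k)))
      (tendsto_lintegral_mollify_sub hwi) _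
  intro r hr s hs hrs
  have hk : ∀ᶠ k : ℕ in atTop, 1 / ((k : ℝ) + 1) < (R - s) / 2 :=
    tendsto_one_div_add_atTop_nhds_zero_nat.eventually_lt_const (by linarith [hs.2])
  simp only [average_ball_eq z x hr.1, average_ball_eq z x hs.1]
  have hB := volume_real_ball_pos (0 : Amb n) one_pos
  have key : Real.exp (-(C * s ^ 2 / 4)) * ((s ^ (n + 1))⁻¹ * ∫ y in Metric.ball x s, z y)
      ≤ Real.exp (-(C * r ^ 2 / 4)) * ((r ^ (n + 1))⁻¹ * ∫ y in Metric.ball x r, z y) := by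
    refine le_of_tendsto_of_tendsto ((hlim s hs).const_mul _) ((hlim r hr).const_mul _) ?_
    filter_upwards [hk] with k hk
    -- Halfway between `s` and `R`, every point keeps distance at least `(R - s)/2` from the
    -- boundary of the `R`-ball, more than the mollification radius.
    have hant := antitoneOn_integral_dilate (hms k) (hmc k) (x := x) (R := (R + s) / 2) hC
      (fun y _ => hm0 k y) fun y hy => hlap k y ?_
    · exact hant ⟨hr.1.le, by linarith [hr.2, hs.2]⟩ ⟨hs.1.le, by linarith [hs.2]⟩ hrs
    · refine Metric.closedBall_subset_closedBall' ?_
      rw [Metric.mem_ball] at hy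
      linarith
  calc _ = (volume.real (Metric.ball (0 : Amb n) 1))⁻¹ *
        (Real.exp (-(C * s ^ 2 / 4)) * ((s ^ (n + 1))⁻¹ * ∫ y in Metric.ball x s, z y)) := by ring
    _ ≤ (volume.real (Metric.ball (0 : Amb n) 1))⁻¹ *
        (Real.exp (-(C * r ^ 2 / 4)) * ((r ^ (n + 1))⁻¹ * ∫ y in Metric.ball x r, z y)) := by
      gcongr
    _ = _ := by ring

/-- Existence of the limits of averages, with the mean value inequality. -/
lemma exists_limit (h : IsSupersol U z C) (hC : 0 ≤ C) (hU : IsOpen U) :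
    ∃ z' : Amb n → ℝ, (∀ x ∈ U, Tendsto (fun r => ⨍ y in Metric.ball x r, z y) (𝓝[>] 0) (𝓝 (z' x)))
      ∧ ∀ x R, Metric.closedBall x R ⊆ U → ∀ r ∈ Ioo 0 R,
        Real.exp (-(C * r ^ 2 / 4)) * ⨍ y in Metric.ball x r, z y ≤ z' x := by
  have hexp : Tendsto (fun r : ℝ => Real.exp (-(C * r ^ 2 / 4))) (𝓝[>] 0) (𝓝 1) := by
    have : Continuous fun r : ℝ => Real.exp (-(C * r ^ 2 / 4)) := by fun_prop
    have h1 := this.tendsto 0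
    simp only [ne_eq, OfNat.ofNat_ne_zero, not_false_eq_true, zero_pow, mul_zero, zero_div,
      neg_zero, Real.exp_zero] at h1
    exact h1.mono_left nhdsWithin_le_nhds
  have main : ∀ x ∈ U, ∃ m, Tendsto (fun r => ⨍ y in Metric.ball x r, z y) (𝓝[>] 0) (𝓝 m) := by
    intro x hx
    obtain ⟨R, hR, hRU⟩ := Metric.nhds_basis_closedBall.mem_iff.1 (hU.mem_nhds hx)
    have hanti := h.antitoneOn_average hC hRU
    have hmono := hanti.neg
    have hbdd : BddBelow ((-fun r => Real.exp (-(C * r ^ 2 / 4)) *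
        ⨍ y in Metric.ball x r, z y) '' Ioo 0 R) := by
      refine ⟨-1, ?_⟩
      rintro _ ⟨r, hr, rfl⟩
      simp only [Pi.neg_apply, neg_le_neg_iff]
      have h1 := h.average_le_one x hr.1
      have h0 := h.average_nonneg x r
      have h2 : Real.exp (-(C * r ^ 2 / 4)) ≤ 1 := by
        rw [Real.exp_le_one_iff]
        have : 0 ≤ C * r ^ 2 / 4 := by positivity
        linarith
      exact mul_le_one₀ h2 h0 h1
    have ht := MonotoneOn.tendsto_nhdsWithin_Ioo_right ⟨R / 2, by constructor <;> linarith⟩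
      hmono hbdd
    -- The weighted averages converge by monotonicity and boundedness; dividing by the weight, which
    -- tends to `1`, gives convergence of the averages.
    have ht2 := (ht.neg).div hexp one_ne_zero
    refine ⟨_, ht2.congr fun r => ?_⟩
    simp only [neg_neg, Pi.div_apply]
    rw [mul_div_cancel_left₀ _ (Real.exp_pos _).ne']
  classical
  choose! z' hz' using main
  refine ⟨z', hz', fun x R hR r hr => ?_⟩
  have hx : x ∈ U := hR (Metric.mem_closedBall_self (hr.1.trans hr.2).le)
  have ht := hexp.mul (hz' x hx)
  rw [one_mul] at ht
  refine ge_of_tendsto ht ?_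
  filter_upwards [Ioo_mem_nhdsGT hr.1] with s hs
  exact h.antitoneOn_average hC hR ⟨hs.1, hs.2.trans hr.2⟩ hr hs.2.le

end IsSupersol

end Supersolutions

end ACPlateau

end

noncomputable section

namespace ACPlateau

/-! ### The Lebesgue representative of a supersolution -/

section Representative

variable {n : ℕ} {Ω U : Set (Amb n)} {z z' : Amb n → ℝ} {C : ℝ}

lemma average_ball_eq_closedBall (g : Amb n → ℝ) (x : Amb n) (r : ℝ) :
    ⨍ y in Metric.ball x r, g y = ⨍ y in Metric.closedBall x r, g y := by
  have : Metric.ball x r =ᵐ[volume] Metric.closedBall x r := by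
    have h := union_ae_eq_left_of_ae_eq_empty (s := Metric.ball x r)
      (ae_eq_empty.2 (Measure.addHaar_sphere (volume : Measure (Amb n)) x r))
    rw [Metric.ball_union_sphere] at h
    exact h.symm
  rw [Measure.restrict_congr_set this]

lemma ae_eq_of_tendsto_average (hz : LocallyIntegrable z) (hΩ : MeasurableSet Ω)
    (ht : ∀ x ∈ Ω, Tendsto (fun r => ⨍ y in Metric.ball x r, z y) (𝓝[>] 0) (𝓝 (z' x))) :
    z' =ᵐ[volume.restrict Ω] z := by
  filter_upwards [ae_restrict_of_ae (IsUnifLocDoublingMeasure.ae_tendsto_average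
    (volume : Measure (Amb n)) hz 1), ae_restrict_mem hΩ] with x hx hxΩ
  have h1 := hx (l := 𝓝[>] (0 : ℝ)) (fun _ => x) (fun r => r) tendsto_id (by
    filter_upwards [self_mem_nhdsWithin] with r hr
    exact Metric.mem_closedBall_self (by simpa using le_of_lt hr))
  simp_rw [← average_ball_eq_closedBall] at h1
  exact tendsto_nhds_unique (ht x hxΩ) h1

lemma average_eq_of_ae_eq {x : Amb n} {r c : ℝ} (hr : 0 < r)
    (h : ∀ᵐ y ∂(volume.restrict (Metric.ball x r)), z y = c) : ⨍ y in Metric.ball x r, z y = c := by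
  have hv := volume_real_ball_pos x hr
  rw [setAverage_eq, integral_congr_ae h]
  simp [hv.ne']

lemma limit_eq_of_ae_eq {x y : Amb n} {r c m : ℝ}
    (h : ∀ᵐ y ∂(volume.restrict (Metric.ball x r)), z y = c) (hy : y ∈ Metric.ball x r)
    (ht : Tendsto (fun r => ⨍ y in Metric.ball y r, z y) (𝓝[>] 0) (𝓝 m)) : m = c := by
  refine tendsto_nhds_unique ht (tendsto_const_nhds.congr' ?_)
  obtain ⟨s, hs, hsub⟩ := Metric.isOpen_iff.1 Metric.isOpen_ball y hy
  filter_upwards [Ioo_mem_nhdsGT hs] with t ht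
  exact (average_eq_of_ae_eq ht.1 (ae_restrict_of_ae_restrict_of_subset
    ((Metric.ball_subset_ball ht.2.le).trans hsub) h)).symm

namespace IsSupersol

lemma ae_eq_zero (h : IsSupersol U z C) {x : Amb n} {r : ℝ} (hr : 0 < r)
    (h0 : ⨍ y in Metric.ball x r, z y ≤ 0) :
    ∀ᵐ y ∂(volume.restrict (Metric.ball x r)), z y = 0 := by
  have hv := volume_real_ball_pos x hr
  have h1 : ∫ y in Metric.ball x r, z y = 0 := by
    refine le_antisymm ?_ (h.setIntegral_nonneg _)
    rw [setAverage_eq, smul_eq_mul] at h0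
    by_contra hc
    have := mul_pos (inv_pos.2 hv) (not_le.1 hc)
    linarith
  have h2 := (integral_eq_zero_iff_of_nonneg_ae (by
    filter_upwards [ae_restrict_of_ae h.range] with y hy
    exact hy.1) (h.integrableOn_ball x r)).1 h1
  filter_upwards [h2] with y hy
  exact hy

/-- If the weighted average on `B_r(x)` exceeds `c`, then slightly increasing `r` to `s` leaves
room: for `y` near `x` the ball `B_s(y)` contains `B_r(x)`, so by `z ≥ 0` the weighted average on
`B_s(y)` still exceeds `c`, and it bounds `z'(y)` from below. -/
lemma lowerSemicontinuousOn (h : IsSupersol U z C) (hU : IsOpen U)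
    (hm : ∀ x R, Metric.closedBall x R ⊆ U → ∀ r ∈ Ioo 0 R,
        Real.exp (-(C * r ^ 2 / 4)) * ⨍ y in Metric.ball x r, z y ≤ z' x)
    (ht : ∀ x ∈ U, Tendsto (fun r => ⨍ y in Metric.ball x r, z y) (𝓝[>] 0) (𝓝 (z' x))) :
    LowerSemicontinuousOn z' U := by
  intro x hx c hc
  obtain ⟨R, hR, hRU⟩ := Metric.nhds_basis_closedBall.mem_iff.1 (hU.mem_nhds hx)
  have hexp : Tendsto (fun r : ℝ => Real.exp (-(C * r ^ 2 / 4))) (𝓝[>] 0) (𝓝 1) := by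
    have : Continuous fun r : ℝ => Real.exp (-(C * r ^ 2 / 4)) := by fun_prop
    have h1 := this.tendsto 0
    simp only [ne_eq, OfNat.ofNat_ne_zero, not_false_eq_true, zero_pow, mul_zero, zero_div,
      neg_zero, Real.exp_zero] at h1
    exact h1.mono_left nhdsWithin_le_nhds
  have h1 := hexp.mul (ht x hx)
  rw [one_mul] at h1
  obtain ⟨r, hr, hrR⟩ := ((h1.eventually_const_lt hc).and (Ioo_mem_nhdsGT (half_pos hR))).exists
  have hB := volume_real_ball_pos (0 : Amb n) one_pos
  let I := ∫ y in Metric.ball x r, z y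
  let g : ℝ → ℝ := fun s => Real.exp (-(C * s ^ 2 / 4)) *
    ((volume.real (Metric.ball (0 : Amb n) 1))⁻¹ * ((s ^ (n + 1))⁻¹ * I))
  have hg : ContinuousAt g r := by
    have : r ^ (n + 1) ≠ 0 := pow_ne_zero _ hrR.1.ne'
    simp only [g]
    fun_prop (disch := assumption)
  have hgr : c < g r := by
    simp only [g, I]
    rw [← average_ball_eq z x hrR.1]
    exact hr
  have hev : ∀ᶠ s in 𝓝[>] r, c < g s :=
    (hg.eventually_const_lt hgr).filter_mono nhdsWithin_le_nhds
  obtain ⟨s, hs, hsr⟩ := (hev.and (Ioo_mem_nhdsGT hrR.2)).exists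
  have hs0 : 0 < s := hrR.1.trans hsr.1
  have hnear : Metric.ball x (min (s - r) (R / 2 - s)) ∈ 𝓝[U] x :=
    mem_nhdsWithin_of_mem_nhds (Metric.ball_mem_nhds _
      (lt_min (by linarith [hsr.1]) (by linarith [hsr.2])))
  filter_upwards [hnear] with y hy
  rw [Metric.mem_ball, lt_min_iff] at hy
  have hsub : Metric.ball x r ⊆ Metric.ball y s := by
    refine Metric.ball_subset_ball' ?_
    rw [dist_comm]
    linarith
  have hcl : Metric.closedBall y (R / 2) ⊆ U := by
    refine (Metric.closedBall_subset_closedBall' ?_).trans hRU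
    linarith
  refine lt_of_lt_of_le hs (le_trans ?_ (hm y _ hcl s ⟨hs0, hsr.2⟩))
  rw [average_ball_eq z y hs0]
  simp only [g, I]
  gcongr
  · filter_upwards [ae_restrict_of_ae h.range] with w hw
    exact hw.1
  · exact h.integrableOn_ball y s

end IsSupersol

lemma lsc_isOpen (hΩ : IsOpen Ω) (hl : LowerSemicontinuousOn z' Ω) (c : ℝ) :
    IsOpen {x | x ∈ Ω ∧ c < z' x} := by
  rw [isOpen_iff_mem_nhds]
  rintro x ⟨hx, hc⟩
  have h1 := hl x hx c hc
  rw [hΩ.nhdsWithin_eq hx] at h1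
  filter_upwards [h1, hΩ.mem_nhds hx] with y hy hyΩ
  exact ⟨hyΩ, hy⟩

/-- Regularity of nonnegative supersolutions, and the strong minimum principle. -/
theorem IsSupersol.exists_representative (hΩ : IsOpen Ω) (h : IsSupersol Ω z C) (hC : 0 ≤ C) :
    ∃ z' : Amb n → ℝ,
      (∀ x ∈ Ω, Tendsto (fun r => ⨍ y in Metric.ball x r, z y) (𝓝[>] 0) (𝓝 (z' x))) ∧
      z' =ᵐ[volume.restrict Ω] z ∧ LowerSemicontinuousOn z' Ω ∧ (∀ x ∈ Ω, z' x ∈ Icc (0 : ℝ) 1) ∧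
      ∀ x ∈ Ω, (∀ y ∈ connectedComponentIn Ω x, z' y = 0) ∨
        ∀ y ∈ connectedComponentIn Ω x, 0 < z' y := by
  obtain ⟨z', ht, hm⟩ := h.exists_limit hC hΩ
  have hl := h.lowerSemicontinuousOn hΩ hm ht
  have hr : ∀ x ∈ Ω, z' x ∈ Icc (0 : ℝ) 1 := fun x hx =>
    ⟨ge_of_tendsto (ht x hx) (Eventually.of_forall fun r => h.average_nonneg x r),
      le_of_tendsto (ht x hx) (by
        filter_upwards [self_mem_nhdsWithin] with r hr
        exact h.average_le_one x hr)⟩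
  refine ⟨z', ht, ae_eq_of_tendsto_average h.locallyIntegrable hΩ.measurableSet ht, hl, hr,
    fun x hx => ?_⟩
  -- At a zero the mean value inequality makes the average over a ball nonpositive, so `z = 0` a.e.
  -- in that ball and `z'` vanishes throughout it.
  have hopen0 : IsOpen {y | y ∈ Ω ∧ z' y = 0} := by
    rw [isOpen_iff_mem_nhds]
    rintro y ⟨hy, hy0⟩
    obtain ⟨R, hR, hRU⟩ := Metric.nhds_basis_closedBall.mem_iff.1 (hΩ.mem_nhds hy)
    have h1 := hm y R hRU (R / 2) ⟨by linarith, by linarith⟩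
    rw [hy0] at h1
    have h2 : ⨍ w in Metric.ball y (R / 2), z w ≤ 0 := by
      by_contra hc
      have := mul_pos (Real.exp_pos (-(C * (R / 2) ^ 2 / 4))) (not_le.1 hc)
      linarith
    have h3 := h.ae_eq_zero (by linarith) h2
    filter_upwards [Metric.ball_mem_nhds y (show 0 < R / 2 by linarith)] with w hw
    have hwΩ : w ∈ Ω := hRU (Metric.ball_subset_closedBall
      (Metric.ball_subset_ball (by linarith) hw))
    exact ⟨hwΩ, limit_eq_of_ae_eq h3 hw (ht w hwΩ)⟩
  have hopen1 := lsc_isOpen hΩ hl 0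
  have hdisj : Disjoint {y | y ∈ Ω ∧ z' y = 0} {y | y ∈ Ω ∧ 0 < z' y} := by
    rw [Set.disjoint_left]
    rintro y ⟨-, h1⟩ ⟨-, h2⟩
    linarith
  have hcov : connectedComponentIn Ω x ⊆ {y | y ∈ Ω ∧ z' y = 0} ∪ {y | y ∈ Ω ∧ 0 < z' y} := by
    intro y hy
    have hyΩ := connectedComponentIn_subset Ω x hy
    rcases eq_or_lt_of_le (hr y hyΩ).1 with h0 | h0
    · exact Or.inl ⟨hyΩ, h0.symm⟩
    · exact Or.inr ⟨hyΩ, h0⟩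
  have hxm : x ∈ connectedComponentIn Ω x := mem_connectedComponentIn hx
  rcases hcov hxm with h0 | h0
  · exact Or.inl fun y hy => (isPreconnected_connectedComponentIn.subset_left_of_subset_union
      hopen0 hopen1 hdisj hcov ⟨x, hxm, h0⟩ hy).2
  · exact Or.inr fun y hy => (isPreconnected_connectedComponentIn.subset_right_of_subset_union
      hopen0 hopen1 hdisj hcov ⟨x, hxm, h0⟩ hy).2

/-- If `z = 1` on a ball touching `p` from the inside, then the representative is `1` at `p`. -/
lemma one_le_of_touching (hΩ : IsOpen Ω) (hz : LocallyIntegrable z)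
    (hae : z' =ᵐ[volume.restrict Ω] z) (hl : LowerSemicontinuousOn z' Ω)
    {p y : Amb n} (hp : p ∈ Ω)
    (ht : Tendsto (fun r => ⨍ y in Metric.ball p r, z y) (𝓝[>] 0) (𝓝 (z' p)))
    (hd : 0 < dist y p) (h1 : ∀ᵐ w ∂(volume.restrict (Metric.ball y (dist y p))), z w = 1) :
    1 ≤ z' p := by
  by_contra! hlt
  set m := z' p with hmdef
  set d := dist y p with hddef
  -- `θ` is the volume fraction in `B_r(p)` of a ball of half the radius on which `z = 1`. Elsewhere
  -- near `p`, lower semicontinuity gives `z ≥ m - η`, so averages are at least `m - η + θ (1 - m +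
  -- η)`; with `η = θ (1 - m)/2` this is at least `m + η`.
  let θ : ℝ := (1 / 2) ^ (n + 1)
  have hθ : 0 < θ := by positivity
  let η : ℝ := θ * (1 - m) / 2
  have hη : 0 < η := by
    have : 0 < 1 - m := by linarith
    positivity
  have hlm := hl p hp (m - η) (show m - η < m by linarith)
  rw [hΩ.nhdsWithin_eq hp] at hlm
  obtain ⟨r₀, hr₀, hball⟩ := Metric.eventually_nhds_iff_ball.1 (hlm.and (hΩ.mem_nhds hp))
  have key : ∀ᶠ r in 𝓝[>] (0 : ℝ), m + η ≤ ⨍ w in Metric.ball p r, z w := by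
    filter_upwards [Ioo_mem_nhdsGT (lt_min hr₀ hd)] with r hr
    have hrr₀ : r < r₀ := hr.2.trans_le (min_le_left _ _)
    have hrd : r < d := hr.2.trans_le (min_le_right _ _)
    have hsubΩ : Metric.ball p r ⊆ Ω := fun w hw =>
      (hball w (Metric.ball_subset_ball hrr₀.le hw)).2
    -- The centre at distance `r/2` from `p` towards `y`: the ball of radius `r/2` around it lies in
    -- both `B_r(p)` and `B_d(y)`.
    let q : Amb n := p + (r / (2 * d)) • (y - p)
    have hnyp : ‖y - p‖ = d := by rw [hddef, dist_eq_norm]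
    have hqp : dist q p = r / 2 := by
      simp only [q]
      rw [dist_eq_norm, add_sub_cancel_left, norm_smul, hnyp, Real.norm_of_nonneg (by
        have := hr.1; positivity)]
      field_simp
    have hqy : dist q y = d - r / 2 := by
      have : q - y = (r / (2 * d) - 1) • (y - p) := by
        simp only [q]
        rw [sub_smul, one_smul]
        abel
      rw [dist_eq_norm, this, norm_smul, hnyp, Real.norm_eq_abs, abs_of_nonpos, neg_sub, sub_mul,
        one_mul]
      · congr 1
        field_simp
      · rw [sub_nonpos, div_le_one (by positivity)]
        linarith [hr.1]
    have hH1 : Metric.ball q (r / 2) ⊆ Metric.ball p r :=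
      Metric.ball_subset_ball' (by rw [hqp]; linarith)
    have hH2 : Metric.ball q (r / 2) ⊆ Metric.ball y d :=
      Metric.ball_subset_ball' (by rw [hqy]; linarith)
    have hIntgr : IntegrableOn z (Metric.ball p r) :=
      (hz.integrableOn_isCompact (isCompact_closedBall p r)).mono_set Metric.ball_subset_closedBall
    have hconst : ∀ c : ℝ, IntegrableOn (fun _ => c) (Metric.ball p r) := fun c =>
      integrableOn_const measure_ball_lt_top.ne
    have hnn : ∀ᵐ w ∂(volume.restrict (Metric.ball p r)), 0 ≤ z w - (m - η) := by
      filter_upwards [ae_restrict_of_ae_restrict_of_subset hsubΩ hae,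
        ae_restrict_mem Metric.isOpen_ball.measurableSet] with w hw hwb
      rw [← hw]
      have := (hball w (Metric.ball_subset_ball hrr₀.le hwb)).1
      linarith
    have hle : ∫ w in Metric.ball q (r / 2), (z w - (m - η))
        ≤ ∫ w in Metric.ball p r, (z w - (m - η)) :=
      setIntegral_mono_set (hIntgr.sub (hconst _)) hnn (LE.le.eventuallyLE hH1)
    have e1 : ∫ w in Metric.ball q (r / 2), (z w - (m - η))
        = (1 - (m - η)) * volume.real (Metric.ball q (r / 2)) := by
      rw [integral_congr_ae (g := fun _ => 1 - (m - η))]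
      · simp [mul_comm]
      · filter_upwards [ae_restrict_of_ae_restrict_of_subset hH2 h1] with w hw
        rw [hw]
    have e2 : ∫ w in Metric.ball p r, (z w - (m - η))
        = (∫ w in Metric.ball p r, z w) - (m - η) * volume.real (Metric.ball p r) := by
      rw [integral_sub hIntgr (hconst _)]
      simp [mul_comm]
    have e3 : volume.real (Metric.ball q (r / 2)) = θ * volume.real (Metric.ball p r) := by
      rw [measureReal_def, measureReal_def, Measure.addHaar_ball _ q (by linarith [hr.1]),
        Measure.addHaar_ball _ p hr.1.le, ENNReal.toReal_mul, ENNReal.toReal_mul,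
        ENNReal.toReal_ofReal (by have := hr.1; positivity),
        ENNReal.toReal_ofReal (by have := hr.1; positivity)]
      simp only [θ, finrank_euclideanSpace, Fintype.card_fin]
      rw [div_eq_mul_one_div r 2, mul_pow]
      ring
    have hv := volume_real_ball_pos p hr.1
    rw [setAverage_eq, smul_eq_mul, ← div_eq_inv_mul, le_div_iff₀ hv]
    rw [e1, e2, e3] at hle
    have h2 : m + η ≤ (m - η) + θ * (1 - (m - η)) := by
      have : η * 2 = θ * (1 - m) := by simp only [η]; ring
      nlinarith
    calc (m + η) * volume.real (Metric.ball p r)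
        ≤ ((m - η) + θ * (1 - (m - η))) * volume.real (Metric.ball p r) := by gcongr
      _ ≤ ∫ w in Metric.ball p r, z w := by linarith
  have := ge_of_tendsto ht key
  linarith

/-- The strong maximum principle at the value `1`. -/
theorem eq_one_of_supersol (hΩ : IsOpen Ω) (hz : LocallyIntegrable z) (hz1 : ∀ x ∈ Ω, z' x ≤ 1)
    (ht : ∀ x ∈ Ω, Tendsto (fun r => ⨍ y in Metric.ball x r, z y) (𝓝[>] 0) (𝓝 (z' x)))
    (hae : z' =ᵐ[volume.restrict Ω] z) (hl : LowerSemicontinuousOn z' Ω)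
    {c : ℝ} (hc : c < 1) {w : Amb n → ℝ} (hw : ∀ x ∈ Ω, w x = 1 - z x) (hC : 0 ≤ C)
    (hs : IsSupersol {x | x ∈ Ω ∧ c < z' x} w C) (x : Amb n) :
    (∀ y ∈ connectedComponentIn Ω x, z' y < 1) ∨ ∀ y ∈ connectedComponentIn Ω x, z' y = 1 := by
  have hUo := lsc_isOpen hΩ hl c
  obtain ⟨w', hwt, hwm⟩ := hs.exists_limit hC hUo
  -- A point with `z' = 1` lies in the open set where `w = 1 - z` is a supersolution, and is a zero
  -- of the representative of `w`; so `w` vanishes a.e. near it.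
  have hone : ∀ y ∈ Ω, z' y = 1 → ∃ r, 0 < r ∧ Metric.ball y r ⊆ Ω ∧
      ∀ᵐ v ∂(volume.restrict (Metric.ball y r)), z v = 1 := by
    intro y hy hy1
    have hyU : y ∈ {x | x ∈ Ω ∧ c < z' x} := ⟨hy, by rw [hy1]; exact hc⟩
    obtain ⟨R, hR, hRU⟩ := Metric.nhds_basis_closedBall.mem_iff.1 (hUo.mem_nhds hyU)
    have hRΩ : Metric.closedBall y R ⊆ Ω := fun v hv => (hRU hv).1
    have hwlim : w' y = 0 := by
      have h1 : Tendsto (fun r => 1 - ⨍ v in Metric.ball y r, z v) (𝓝[>] 0) (𝓝 (1 - 1)) := by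
        have := (ht y hy).const_sub 1
        rwa [hy1] at this
      rw [sub_self] at h1
      refine tendsto_nhds_unique (hwt y hyU) (h1.congr' ?_)
      filter_upwards [Ioo_mem_nhdsGT hR] with r hr
      have hv := volume_real_ball_pos y hr.1
      have hone : IntegrableOn (fun _ => (1 : ℝ)) (Metric.ball y r) :=
        integrableOn_const measure_ball_lt_top.ne
      have hIntgr : IntegrableOn z (Metric.ball y r) :=
        (hz.integrableOn_isCompact (isCompact_closedBall y r)).mono_set
          Metric.ball_subset_closedBall
      rw [setAverage_eq, setAverage_eq, setIntegral_congr_fun (g := fun v => 1 - z v)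
        Metric.isOpen_ball.measurableSet (fun v hv' => hw v (hRΩ (Metric.ball_subset_closedBall
          (Metric.ball_subset_ball hr.2.le hv')))),
        integral_sub hone hIntgr]
      simp only [integral_const, smul_eq_mul, mul_one, measureReal_restrict_apply_univ]
      field_simp
    have h1 := hwm y R hRU (R / 2) ⟨by linarith, by linarith⟩
    rw [hwlim] at h1
    have h2 : ⨍ v in Metric.ball y (R / 2), w v ≤ 0 := by
      by_contra hc
      have := mul_pos (Real.exp_pos (-(C * (R / 2) ^ 2 / 4))) (not_le.1 hc)
      linarith
    have h3 := hs.ae_eq_zero (by linarith) h2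
    have hsub : Metric.ball y (R / 2) ⊆ Ω := (Metric.ball_subset_closedBall.trans
      (Metric.closedBall_subset_closedBall (by linarith))).trans hRΩ
    refine ⟨R / 2, by linarith, hsub, ?_⟩
    filter_upwards [h3, ae_restrict_mem Metric.isOpen_ball.measurableSet] with v hv hvb
    rw [hw v (hsub hvb)] at hv
    linarith
  have hopen : IsOpen {y | y ∈ Ω ∧ z' y = 1} := by
    rw [isOpen_iff_mem_nhds]
    rintro y ⟨hy, hy1⟩
    obtain ⟨r, hr, hsub, h1⟩ := hone y hy hy1
    filter_upwards [Metric.ball_mem_nhds y hr] with v hv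
    exact ⟨hsub hv, limit_eq_of_ae_eq h1 hv (ht v (hsub hv))⟩
  set D := {y | y ∈ Ω ∧ z' y = 1} with hD
  -- Lower semicontinuity does not exclude a downward jump at a limit point of `D`. Starting from a
  -- point `y` of `D` close to the limit point, a nearest point `p` of the complement of `D` is
  -- touched by a ball contained in `D`, which forces `z' p = 1`.
  have hclosed : ∀ p ∈ Ω, p ∈ closure D → p ∈ D := by
    intro p₀ hp₀ hcl
    by_contra hpD
    obtain ⟨R, hR, hRΩ⟩ := Metric.isOpen_iff.1 hΩ p₀ hp₀
    obtain ⟨y, hyD, hy⟩ := Metric.mem_closure_iff.1 hcl (R / 2) (by linarith)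
    obtain ⟨p, hp, hpd⟩ := hopen.isClosed_compl.exists_infDist_eq_dist ⟨p₀, hpD⟩ y
    have hdle : dist y p ≤ dist y p₀ := by
      rw [← hpd]
      exact Metric.infDist_le_dist_of_mem hpD
    have hpΩ : p ∈ Ω := by
      apply hRΩ
      rw [Metric.mem_ball]
      have := dist_triangle_left p p₀ y
      rw [dist_comm p₀ y] at hy
      linarith
    have hpos : 0 < dist y p := by
      rw [dist_pos]
      rintro rfl
      exact hp hyD
    have hsub : Metric.ball y (dist y p) ⊆ D := by
      rw [← hpd]
      exact Metric.ball_infDist_compl_subset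
    have h1 : ∀ᵐ v ∂(volume.restrict (Metric.ball y (dist y p))), z v = 1 := by
      filter_upwards [ae_restrict_of_ae_restrict_of_subset (hsub.trans fun v hv => hv.1) hae,
        ae_restrict_mem Metric.isOpen_ball.measurableSet] with v hv hvb
      rw [← hv]
      exact (hsub hvb).2
    have := one_le_of_touching hΩ hz hae hl hpΩ (ht p hpΩ) hpos h1
    exact hp ⟨hpΩ, le_antisymm (hz1 p hpΩ) this⟩
  by_cases hex : ∃ y ∈ connectedComponentIn Ω x, z' y = 1
  · right
    obtain ⟨y, hy, hy1⟩ := hex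
    have hyΩ := connectedComponentIn_subset Ω x hy
    have hcov : connectedComponentIn Ω x ⊆ D ∪ (closure D)ᶜ := by
      intro v hv
      by_cases hvc : v ∈ closure D
      · exact Or.inl (hclosed v (connectedComponentIn_subset Ω x hv) hvc)
      · exact Or.inr hvc
    have hdisj : Disjoint D (closure D)ᶜ :=
      Set.disjoint_left.2 fun v hv hv' => hv' (subset_closure hv)
    exact fun v hv => (isPreconnected_connectedComponentIn.subset_left_of_subset_union
      hopen isClosed_closure.isOpen_compl hdisj hcov ⟨y, hy, hyΩ, hy1⟩ hv).2
  · left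
    push Not at hex
    exact fun y hy => lt_of_le_of_ne (hz1 y (connectedComponentIn_subset Ω x hy)) (hex y hy)

/-- Unbounded components of the complement of a compact set have infinite volume. -/
lemma volume_component_eq_top {wire : Set (Amb n)} (hwire : IsCompact wire) {x : Amb n}
    (hb : ¬ Bornology.IsBounded (connectedComponentIn wireᶜ x)) :
    volume (connectedComponentIn wireᶜ x) = ⊤ := by
  obtain ⟨R₀, hR₀⟩ := hwire.isBounded.subset_closedBall (0 : Amb n)
  -- Some point of the component is farther than `L + R₀` from the origin; the `L`-ball around it
  -- misses the compact set and, being connected, stays in the component.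
  have key : ∀ L : ℝ, 0 < L → ENNReal.ofReal (L ^ (n + 1)) * volume (Metric.ball (0 : Amb n) 1)
      ≤ volume (connectedComponentIn wireᶜ x) := by
    intro L hL
    have : ∃ y ∈ connectedComponentIn wireᶜ x, L + R₀ < ‖y‖ := by
      by_contra! hc
      exact hb ((Metric.isBounded_closedBall (x := (0 : Amb n)) (r := L + R₀)).subset fun y hy =>
        mem_closedBall_zero_iff.2 (hc y hy))
    obtain ⟨y, hy, hyn⟩ := this
    have hsub : Metric.ball y L ⊆ wireᶜ := by
      intro v hv hvw
      have h1 := mem_closedBall_zero_iff.1 (hR₀ hvw)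
      rw [mem_ball_iff_norm] at hv
      have h2 : ‖y‖ ≤ ‖v‖ + ‖v - y‖ := by
        have := norm_sub_le v (v - y)
        simpa using this
      linarith
    have h3 : Metric.ball y L ⊆ connectedComponentIn wireᶜ x := by
      rw [connectedComponentIn_eq hy]
      exact (convex_ball y L).isPreconnected.subset_connectedComponentIn
        (Metric.mem_ball_self hL) hsub
    calc _ = volume (Metric.ball y L) := by
          rw [Measure.addHaar_ball _ y hL.le]
          simp
      _ ≤ _ := measure_mono h3
  have hpos : volume (Metric.ball (0 : Amb n) 1) ≠ 0 := (Metric.measure_ball_pos _ _ one_pos).ne'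
  have ht : Tendsto (fun L : ℝ => ENNReal.ofReal (L ^ (n + 1)) * volume (Metric.ball (0 : Amb n) 1))
      atTop (𝓝 ⊤) := by
    have h1 : Tendsto (fun L : ℝ => ENNReal.ofReal (L ^ (n + 1))) atTop (𝓝 ⊤) :=
      ENNReal.tendsto_ofReal_atTop.comp (tendsto_pow_atTop (by omega))
    have h2 := ENNReal.Tendsto.mul_const (b := volume (Metric.ball (0 : Amb n) 1)) h1
      (Or.inl ENNReal.top_ne_zero)
    rwa [ENNReal.top_mul hpos] at h2
  refine top_le_iff.1 (le_of_tendsto ht ?_)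
  filter_upwards [eventually_gt_atTop 0] with L hL
  exact key L hL

end Representative

end ACPlateau

end

noncomputable section

namespace ACPlateau

/-! ### Density points -/

section Density

variable {n : ℕ}

lemma densityPts_zero_mono {A B : Set (Amb n)} {x : Amb n} {r₀ : ℝ} (hr₀ : 0 < r₀)
    (h : A ∩ Metric.ball x r₀ ⊆ B) (hB : x ∈ densityPts 0 B) : x ∈ densityPts 0 A := by
  refine tendsto_of_tendsto_of_tendsto_of_le_of_le' tendsto_const_nhds hB
    (Eventually.of_forall fun _ => zero_le) ?_
  filter_upwards [Ioo_mem_nhdsGT hr₀] with r hr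
  gcongr ?_ / _
  refine measure_mono fun y hy => ⟨h ⟨hy.1, Metric.ball_subset_ball hr.2.le hy.2⟩, hy.2⟩

lemma densityPts_zero_union {A B : Set (Amb n)} {x : Amb n} (hA : x ∈ densityPts 0 A)
    (hB : x ∈ densityPts 0 B) : x ∈ densityPts 0 (A ∪ B) := by
  have h := Tendsto.add hA hB
  rw [add_zero] at h
  refine tendsto_of_tendsto_of_tendsto_of_le_of_le tendsto_const_nhds h (fun _ => zero_le)
    fun r => ?_
  simp only
  rw [← ENNReal.add_div]
  gcongr ?_ / _
  rw [union_inter_distrib_right]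
  exact measure_union_le _ _

lemma densityPts_zero_of_null {A : Set (Amb n)} {x : Amb n} (h : volume A = 0) :
    x ∈ densityPts 0 A := by
  refine (tendsto_const_nhds (x := (0 : ℝ≥0∞))).congr fun r => ?_
  rw [measure_mono_null inter_subset_left h, ENNReal.zero_div]

lemma not_densityPts_zero_of_nhds {A : Set (Amb n)} {x : Amb n} (h : A ∈ 𝓝 x) :
    x ∉ densityPts 0 A := by
  intro hd
  obtain ⟨r₀, hr₀, hsub⟩ := Metric.mem_nhds_iff.1 h
  have h1 : Tendsto (fun r : ℝ => volume (A ∩ Metric.ball x r) / volume (Metric.ball x r))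
      (𝓝[>] 0) (𝓝 1) := by
    refine (tendsto_const_nhds (x := (1 : ℝ≥0∞))).congr' ?_
    filter_upwards [Ioo_mem_nhdsGT hr₀] with r hr
    rw [inter_eq_right.2 ((Metric.ball_subset_ball hr.2.le).trans hsub),
      ENNReal.div_self (Metric.measure_ball_pos _ _ hr.1).ne' measure_ball_lt_top.ne]
  exact zero_ne_one (tendsto_nhds_unique hd h1)

/-- For measurable `A` the relative measures of `A` and of its complement in a ball add up to `1`.
Questions about density `1` thus reduce to density `0`. -/
lemma densityPts_one_iff {A : Set (Amb n)} (hA : MeasurableSet A) {x : Amb n} :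
    x ∈ densityPts 1 A ↔ x ∈ densityPts 0 Aᶜ := by
  have key : ∀ B : Set (Amb n), MeasurableSet B → ∀ r : ℝ, 0 < r →
      volume (Bᶜ ∩ Metric.ball x r) / volume (Metric.ball x r)
        = 1 - volume (B ∩ Metric.ball x r) / volume (Metric.ball x r) := by
    intro B hB r hr
    have hpos := (Metric.measure_ball_pos (volume : Measure (Amb n)) x hr).ne'
    have hfin : volume (Metric.ball x r) ≠ ⊤ := measure_ball_lt_top.ne
    have h1 := measure_inter_add_sdiff (μ := volume) (Metric.ball x r) hB
    rw [sdiff_eq, inter_comm, inter_comm (Metric.ball x r) Bᶜ] at h1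
    have h2 : volume (B ∩ Metric.ball x r) / volume (Metric.ball x r)
        + volume (Bᶜ ∩ Metric.ball x r) / volume (Metric.ball x r) = 1 := by
      rw [← ENNReal.add_div, h1, ENNReal.div_self hpos hfin]
    refine ENNReal.eq_sub_of_add_eq ?_ (by rw [add_comm]; exact h2)
    exact ((ENNReal.div_le_of_le_mul (by
      rw [one_mul]
      exact measure_mono inter_subset_right)).trans_lt ENNReal.one_lt_top).ne
  constructor
  · intro h
    have h1 := ENNReal.Tendsto.sub (tendsto_const_nhds (x := (1 : ℝ≥0∞))) h
      (Or.inl ENNReal.one_ne_top)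
    rw [tsub_self] at h1
    refine h1.congr' ?_
    filter_upwards [self_mem_nhdsWithin] with r hr
    exact (key A hA r hr).symm
  · intro h
    have h1 := ENNReal.Tendsto.sub (tendsto_const_nhds (x := (1 : ℝ≥0∞))) h
      (Or.inl ENNReal.one_ne_top)
    rw [tsub_zero] at h1
    refine h1.congr' ?_
    filter_upwards [self_mem_nhdsWithin] with r hr
    have := key Aᶜ hA.compl r hr
    rw [compl_compl] at this
    exact this.symm

/-- Near `f x` the inverse is `L`-Lipschitz, so `f(A) ∩ B_r(f x)` lies in `f(A ∩ B_{Lr}(x))`, and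
`f` expands volume near `x` by a bounded factor. Relative measures therefore grow at most by a
constant. -/
lemma densityPts_zero_image {f : Amb n ≃ₜ Amb n} (hf : IsDiffeo f) {A : Set (Amb n)} {x : Amb n}
    (hx : x ∈ densityPts 0 A) : f x ∈ densityPts 0 (f '' A) := by
  obtain ⟨C, hC0, hC⟩ := hf.exists_volume_image_le (isCompact_closedBall x 1)
  -- Passing to a measurable hull removes measurability from the volume bound; `A` is arbitrary
  -- here.
  have hC' : ∀ s ⊆ Metric.closedBall x 1, volume (f '' s) ≤ ENNReal.ofReal C * volume s := by
    intro s hs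
    rw [← measure_toMeasurable s]
    refine (measure_mono (image_mono (subset_inter (subset_toMeasurable volume s) hs))).trans ?_
    refine (hC _ inter_subset_right ((measurableSet_toMeasurable _ _).inter
      Metric.isClosed_closedBall.measurableSet)).trans ?_
    gcongr
    exact inter_subset_left
  obtain ⟨K, t, ht, hK⟩ := ((hf.smooth_symm.of_le (by norm_num) :
    ContDiff ℝ 1 f.symm).contDiffAt (x := f x)).exists_lipschitzOnWith
  obtain ⟨ρ, hρ, hρt⟩ := Metric.mem_nhds_iff.1 ht
  let L : ℝ := K + 1
  have hL : 0 < L := by positivity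
  have hlip : ∀ y ∈ Metric.ball (f x) ρ, dist (f.symm y) x ≤ L * dist y (f x) := by
    intro y hy
    have h1 := hK.dist_le_mul y (hρt hy) (f x) (mem_of_mem_nhds ht)
    rw [Homeomorph.symm_apply_apply] at h1
    refine h1.trans ?_
    gcongr
    simp [L]
  have hLt : Tendsto (fun r : ℝ => L * r) (𝓝[>] 0) (𝓝[>] 0) := by
    refine tendsto_nhdsWithin_of_tendsto_nhds_of_eventually_within _ ?_ ?_
    · have : Continuous fun r : ℝ => L * r := by fun_prop
      simpa using (this.tendsto 0).mono_left nhdsWithin_le_nhds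
    · filter_upwards [self_mem_nhdsWithin] with r hr
      exact mul_pos hL hr
  have h1 := Tendsto.comp hx hLt
  have h2 := ENNReal.Tendsto.const_mul h1
    (Or.inr (ENNReal.ofReal_ne_top (r := C * L ^ (n + 1))))
  rw [mul_zero] at h2
  refine tendsto_of_tendsto_of_tendsto_of_le_of_le' tendsto_const_nhds h2
    (Eventually.of_forall fun _ => zero_le) ?_
  filter_upwards [Ioo_mem_nhdsGT (lt_min hρ (one_div_pos.2 hL))] with r hr
  have hrρ : r < ρ := hr.2.trans_le (min_le_left _ _)
  have hr1 : L * r ≤ 1 := by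
    have : r < 1 / L := hr.2.trans_le (min_le_right _ _)
    rw [lt_div_iff₀ hL] at this
    linarith
  have hsub : f '' A ∩ Metric.ball (f x) r ⊆ f '' (A ∩ Metric.ball x (L * r)) := by
    rintro _ ⟨⟨y, hy, rfl⟩, hyr⟩
    refine ⟨y, ⟨hy, ?_⟩, rfl⟩
    have := hlip (f y) (Metric.ball_subset_ball hrρ.le hyr)
    rw [Homeomorph.symm_apply_apply] at this
    rw [Metric.mem_ball] at hyr ⊢
    exact this.trans_lt (mul_lt_mul_of_pos_left hyr hL)
  have hvol : volume (Metric.ball x (L * r)) = ENNReal.ofReal (L ^ (n + 1)) *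
      volume (Metric.ball (f x) r) := by
    rw [Measure.addHaar_ball_mul volume x hL.le r, Measure.addHaar_ball_center volume (f x)]
    simp
  have hpos := (Metric.measure_ball_pos (volume : Measure (Amb n)) (f x) hr.1).ne'
  have hfin : volume (Metric.ball (f x) r) ≠ ⊤ := measure_ball_lt_top.ne
  have hLn : ENNReal.ofReal (L ^ (n + 1)) ≠ 0 := by
    rw [ENNReal.ofReal_ne_zero_iff]
    positivity
  calc volume (f '' A ∩ Metric.ball (f x) r) / volume (Metric.ball (f x) r)
      ≤ ENNReal.ofReal C * volume (A ∩ Metric.ball x (L * r)) / volume (Metric.ball (f x) r) := by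
        gcongr ?_ / _
        refine (measure_mono hsub).trans (hC' _ ?_)
        exact inter_subset_right.trans (Metric.ball_subset_closedBall.trans
          (Metric.closedBall_subset_closedBall hr1))
    _ = ENNReal.ofReal (C * L ^ (n + 1)) * (volume (A ∩ Metric.ball x (L * r)) /
          volume (Metric.ball x (L * r))) := by
        rw [hvol, ENNReal.ofReal_mul hC0, ← mul_div_assoc, mul_assoc, mul_left_comm,
          ENNReal.mul_div_mul_left _ _ hLn ENNReal.ofReal_ne_top]

lemma densityPts_one_image {f : Amb n ≃ₜ Amb n} (hf : IsDiffeo f) {A : Set (Amb n)}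
    (hA : MeasurableSet A) {x : Amb n} (hx : x ∈ densityPts 1 A) :
    f x ∈ densityPts 1 (f '' A) := by
  rw [densityPts_one_iff hA] at hx
  rw [densityPts_one_iff (f.measurableEmbedding.measurableSet_image.2 hA),
    ← image_compl_eq f.bijective]
  exact densityPts_zero_image hf hx

lemma densityPts_one_of_image {f : Amb n ≃ₜ Amb n} (hf : IsDiffeo f) {A : Set (Amb n)}
    (hA : MeasurableSet A) {x : Amb n} (hx : f x ∈ densityPts 1 (f '' A)) :
    x ∈ densityPts 1 A := by
  have := densityPts_one_image hf.symm (f.measurableEmbedding.measurableSet_image.2 hA) hx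
  rwa [Homeomorph.symm_apply_apply, ← image_comp, f.symm_comp_self, image_id] at this

lemma densityPts_zero_of_image {f : Amb n ≃ₜ Amb n} (hf : IsDiffeo f) {A : Set (Amb n)}
    {x : Amb n} (hx : f x ∈ densityPts 0 (f '' A)) : x ∈ densityPts 0 A := by
  have := densityPts_zero_image hf.symm hx
  rwa [Homeomorph.symm_apply_apply, ← image_comp, f.symm_comp_self, image_id] at this

lemma essBdry_image_iff {f : Amb n ≃ₜ Amb n} (hf : IsDiffeo f) {A : Set (Amb n)}
    (hA : MeasurableSet A) {x : Amb n} : f x ∈ essBdry (f '' A) ↔ x ∈ essBdry A := by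
  unfold essBdry
  rw [mem_compl_iff, mem_compl_iff, not_iff_not]
  exact or_congr ⟨densityPts_zero_of_image hf, densityPts_zero_image hf⟩
    ⟨densityPts_one_of_image hf hA, densityPts_one_image hf hA⟩

/-! ### Images of spanning sets under diffeomorphisms -/

lemma EssDisconnects.mono {S S' T T₁ T₂ : Set (Amb n)} (h : EssDisconnects S T T₁ T₂)
    (hS : S ⊆ S') : EssDisconnects S' T T₁ T₂ :=
  { h with bdry := measure_mono_null (sdiff_subset_sdiff_right hS) h.bdry }

lemma IsSpanning.mono {Ω : Set (Amb n)} {C : Set (UnitAddCircle → Amb n)} {S S' : Set (Amb n)}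
    (h : IsSpanning Ω C S) (hS : S ⊆ S') : IsSpanning Ω C S' := by
  intro γ hγ Φ hΦ
  filter_upwards [h γ hγ Φ hΦ] with s hs
  filter_upwards [hs] with x hx
  obtain ⟨T₁, T₂, h1, h2⟩ := hx
  exact ⟨T₁, T₂, h1, h2.mono (union_subset_union_left _ hS)⟩

lemma IsDiffeo.volume_image_eq_zero {f : Amb n ≃ₜ Amb n} (hf : IsDiffeo f) {s : Set (Amb n)}
    (h : volume s = 0) : volume (f '' s) = 0 :=
  addHaar_image_eq_zero_of_differentiableOn_of_addHaar_eq_zero volume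
    (hf.smooth.differentiable (by norm_num)).differentiableOn h

lemma IsDiffeo.volume_image_pos {f : Amb n ≃ₜ Amb n} (hf : IsDiffeo f) {s : Set (Amb n)}
    (h : 0 < volume s) : 0 < volume (f '' s) := by
  rw [pos_iff_ne_zero] at h ⊢
  intro h0
  have := hf.symm.volume_image_eq_zero h0
  rw [← image_comp, f.symm_comp_self, image_id] at this
  exact h this

lemma hausdorff_image_null {f : Amb n ≃ₜ Amb n} {L : NNReal} (hL : LipschitzWith L f)
    {s : Set (Amb n)} (h : Measure.hausdorffMeasure (n : ℝ) s = 0) :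
    Measure.hausdorffMeasure (n : ℝ) (f '' s) = 0 := by
  have := hL.hausdorffMeasure_image_le (d := (n : ℝ)) (Nat.cast_nonneg n) s
  rw [h, mul_zero] at this
  exact le_antisymm this zero_le

/-- Diffeomorphisms preserve null sets, density points and essential boundaries, and the Lipschitz
bound preserves `ℋⁿ`-null sets. -/
lemma EssDisconnects.image {f : Amb n ≃ₜ Amb n} (hf : IsDiffeo f) {L : NNReal}
    (hL : LipschitzWith L f) {S T T₁ T₂ : Set (Amb n)} (hT : MeasurableSet T)
    (h : EssDisconnects S T T₁ T₂) : EssDisconnects (f '' S) (f '' T) (f '' T₁) (f '' T₂) where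
  meas₁ := f.measurableEmbedding.measurableSet_image.2 h.meas₁
  meas₂ := f.measurableEmbedding.measurableSet_image.2 h.meas₂
  cover := by
    rw [← image_union, ← image_symmDiff f.injective]
    exact hf.volume_image_eq_zero h.cover
  disj := by
    rw [← image_inter f.injective]
    exact hf.volume_image_eq_zero h.disj
  pos₁ := hf.volume_image_pos h.pos₁
  pos₂ := hf.volume_image_pos h.pos₂
  bdry := by
    refine measure_mono_null ?_ (hausdorff_image_null hL h.bdry)
    intro y hy
    obtain ⟨x, rfl⟩ := f.surjective y
    obtain ⟨⟨⟨h1, h2⟩, h3⟩, h4⟩ := hy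
    exact ⟨x, ⟨⟨⟨densityPts_one_of_image hf hT h1, (essBdry_image_iff hf h.meas₁).1 h2⟩,
      (essBdry_image_iff hf h.meas₂).1 h3⟩, fun hx => h4 ⟨x, hx, rfl⟩⟩, rfl⟩

lemma IsTube.continuousOn {Ω : Set (Amb n)} {γ : UnitAddCircle → Amb n}
    {Φ : UnitAddCircle → Cross n → Amb n} (h : IsTube Ω γ Φ) :
    ContinuousOn (fun p : ℝ × Cross n => Φ (p.1 : UnitAddCircle) p.2)
      (univ ×ˢ Metric.closedBall 0 1) := h.smooth.continuousOn

lemma IsTube.eq_of_eq {Ω : Set (Amb n)} {γ : UnitAddCircle → Amb n}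
    {Φ : UnitAddCircle → Cross n → Amb n} (h : IsTube Ω γ Φ) {s s' : UnitAddCircle}
    {y y' : Cross n} (hy : y ∈ Metric.ball (0 : Cross n) 1)
    (hy' : y' ∈ Metric.ball (0 : Cross n) 1) (heq : Φ s y = Φ s' y') : s = s' ∧ y = y' := by
  have h1 : (s, y) ∈ (univ : Set UnitAddCircle) ×ˢ Metric.closedBall (0 : Cross n) 1 :=
    mk_mem_prod (mem_univ _) (Metric.ball_subset_closedBall hy)
  have h2 : (s', y') ∈ (univ : Set UnitAddCircle) ×ˢ Metric.closedBall (0 : Cross n) 1 :=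
    mk_mem_prod (mem_univ _) (Metric.ball_subset_closedBall hy')
  exact Prod.mk.inj (h.injOn h1 h2 heq)

lemma IsTube.measurableSet_slice {Ω : Set (Amb n)} {γ : UnitAddCircle → Amb n}
    {Φ : UnitAddCircle → Cross n → Amb n} (h : IsTube Ω γ Φ) (s : UnitAddCircle) :
    MeasurableSet (slice Φ s) := by
  obtain ⟨t, rfl⟩ := QuotientAddGroup.mk_surjective s
  refine Metric.isOpen_ball.measurableSet.image_of_continuousOn_injOn ?_ ?_
  · have : ContinuousOn (fun y : Cross n => ((t, y) : ℝ × Cross n)) (Metric.ball 0 1) :=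
      (Continuous.prodMk_right t).continuousOn
    exact h.continuousOn.comp this fun y hy => ⟨mem_univ _, Metric.ball_subset_closedBall hy⟩
  · intro y hy y' hy' heq
    exact (h.eq_of_eq hy hy' heq).2

/-- Parametrized over the half-open interval `[0,1)`, the tube is an injective continuous image of a
Borel set. -/
lemma IsTube.measurableSet_tube {Ω : Set (Amb n)} {γ : UnitAddCircle → Amb n}
    {Φ : UnitAddCircle → Cross n → Amb n} (h : IsTube Ω γ Φ) : MeasurableSet (tube Φ) := by
  have he : tube Φ = (fun p : ℝ × Cross n => Φ (p.1 : UnitAddCircle) p.2) ''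
      (Ico 0 1 ×ˢ Metric.ball 0 1) := by
    ext x
    simp only [tube, slice, mem_iUnion, mem_image, Prod.exists, mem_prod]
    constructor
    · rintro ⟨s, y, hy, rfl⟩
      obtain ⟨t, ht, rfl⟩ : ∃ t ∈ Ico (0 : ℝ) 1, (t : UnitAddCircle) = s := by
        have := AddCircle.coe_image_Ico_eq (1 : ℝ) 0
        have hs : s ∈ (univ : Set (AddCircle (1 : ℝ))) := mem_univ s
        rw [← this, zero_add] at hs
        exact hs
      exact ⟨t, y, ⟨ht, hy⟩, rfl⟩
    · rintro ⟨t, y, ⟨-, hy⟩, rfl⟩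
      exact ⟨t, y, hy, rfl⟩
  rw [he]
  refine (measurableSet_Ico.prod Metric.isOpen_ball.measurableSet).image_of_continuousOn_injOn
    (h.continuousOn.mono (prod_mono (subset_univ _) Metric.ball_subset_closedBall)) ?_
  rintro ⟨t, y⟩ ⟨ht, hy⟩ ⟨t', y'⟩ ⟨ht', hy'⟩ heq
  have := h.eq_of_eq hy hy' heq
  refine Prod.ext ?_ this.2
  exact (AddCircle.coe_eq_coe_iff_of_mem_Ico (p := (1 : ℝ)) (a := 0) (by simpa using ht)
    (by simpa using ht')).1 this.1

lemma IsDiffeo.fderiv_injective {g : Amb n ≃ₜ Amb n} (hg : IsDiffeo g) (x : Amb n) :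
    Function.Injective (fderiv ℝ g x) := by
  intro a b hab
  have h := hg.fderiv_comp_symm x
  have ha := DFunLike.congr_fun h a
  have hb := DFunLike.congr_fun h b
  simp only [ContinuousLinearMap.comp_apply, ContinuousLinearMap.id_apply] at ha hb
  rw [← ha, ← hb, hab]

lemma IsTube.comp_diffeo {Ω : Set (Amb n)} {γ : UnitAddCircle → Amb n}
    {Φ : UnitAddCircle → Cross n → Amb n} (h : IsTube Ω γ Φ) {g : Amb n ≃ₜ Amb n}
    (hg : IsDiffeo g) (hgΩ : ∀ x ∈ Ω, g x ∈ Ω) :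
    IsTube Ω (fun s => g (γ s)) (fun s y => g (Φ s y)) where
  smooth := hg.smooth.comp_contDiffOn h.smooth
  injOn := fun p hp q hq heq => h.injOn hp hq (g.injective heq)
  immersion := by
    intro p hp
    have hu : UniqueDiffWithinAt ℝ ((univ : Set ℝ) ×ˢ Metric.closedBall (0 : Cross n) 1) p := by
      have hconv : Convex ℝ ((univ : Set ℝ) ×ˢ Metric.closedBall (0 : Cross n) 1) :=
        convex_univ.prod (convex_closedBall 0 1)
      refine uniqueDiffOn_convex hconv ?_ p hp
      refine ⟨(0, 0), ?_⟩
      rw [interior_prod_eq, interior_univ]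
      exact ⟨mem_univ _, Metric.ball_subset_interior_closedBall (Metric.mem_ball_self one_pos)⟩
    have h1 := (h.smooth.differentiableOn (by norm_num) p hp).hasFDerivWithinAt
    have h2 := (hg.hasFDerivAt (Φ (p.1 : UnitAddCircle) p.2)).comp_hasFDerivWithinAt p h1
    have h3 : fderivWithin ℝ (fun p : ℝ × Cross n => g (Φ (p.1 : UnitAddCircle) p.2)) _ p = _ :=
      h2.fderivWithin hu
    rw [h3]
    exact (hg.fderiv_injective _).comp (h.immersion p hp)
  core s := by rw [h.core]
  mem s y hy := hgΩ _ (h.mem s y hy)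

/-- The image of a spanning set under a diffeomorphism whose inverse preserves the spanning
class is a spanning set. -/
lemma IsSpanning.image {Ω : Set (Amb n)} {C : Set (UnitAddCircle → Amb n)} {S : Set (Amb n)}
    (h : IsSpanning Ω C S) {f : Amb n ≃ₜ Amb n} (hf : IsDiffeo f) {L : NNReal}
    (hL : LipschitzWith L f) (hfΩ : ∀ x ∈ Ω, f.symm x ∈ Ω)
    (hC : ∀ γ ∈ C, (fun s => f.symm (γ s)) ∈ C) : IsSpanning Ω C (f '' S) := by
  intro γ hγ Φ hΦ
  -- Spanning of `S` is tested on the tube pulled back by `f⁻¹`, whose core `f⁻¹ ∘ γ` is again in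
  -- the class; its slices and partitions are then pushed forward by `f`.
  have hΦ' := hΦ.comp_diffeo hf.symm hfΩ
  have hsl : ∀ s, f '' slice (fun s y => f.symm (Φ s y)) s = slice Φ s := by
    intro s
    unfold slice
    rw [← image_comp]
    congr 1
    ext1 y
    simp
  have htu : f '' tube (fun s y => f.symm (Φ s y)) = tube Φ := by
    unfold tube
    rw [image_iUnion]
    exact iUnion_congr hsl
  filter_upwards [h _ (hC γ hγ) _ hΦ'] with s hs
  rw [ae_restrict_iff' (hΦ.measurableSet_slice s)]
  rw [ae_restrict_iff' (hΦ'.measurableSet_slice s), ae_iff] at hs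
  rw [ae_iff]
  refine measure_mono_null ?_ (hausdorff_image_null hL hs)
  intro y hy
  obtain ⟨x, rfl⟩ := f.surjective y
  refine ⟨x, fun hx => hy fun hxs => ?_, rfl⟩
  rw [← hsl s] at hxs
  obtain ⟨x', hx', hxx'⟩ := hxs
  obtain rfl := f.injective hxx'
  obtain ⟨T₁, T₂, h1, h2⟩ := hx hx'
  have h3 := h2.image hf hL hΦ'.measurableSet_tube
  rw [image_union, hsl, htu] at h3
  exact ⟨f '' T₁, f '' T₂, ⟨(essBdry_image_iff hf h2.meas₁).2 h1.1,
    (essBdry_image_iff hf h2.meas₂).2 h1.2⟩, h3⟩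

lemma IsLoop.comp_diffeo {Ω : Set (Amb n)} {γ : UnitAddCircle → Amb n} (h : IsLoop Ω γ)
    {g : Amb n ≃ₜ Amb n} (hg : IsDiffeo g) (hgΩ : ∀ x ∈ Ω, g x ∈ Ω) :
    IsLoop Ω fun s => g (γ s) where
  smooth := hg.smooth.comp h.smooth
  injective := g.injective.comp h.injective
  immersion t := by
    have h1 := (h.smooth.differentiable (by norm_num) t).hasDerivAt
    have h2 : HasDerivAt (fun t : ℝ => g (γ (t : UnitAddCircle))) _ t :=
      (hg.hasFDerivAt (γ (t : UnitAddCircle))).comp_hasDerivAt t h1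
    rw [h2.deriv]
    intro h0
    refine h.immersion t (hg.fderiv_injective _ (h0.trans (map_zero _).symm))
  mem s := hgΩ _ (h.mem s)

end Density

end ACPlateau

end

noncomputable section

namespace ACPlateau

/-! ### Perturbations of the identity -/

section Perturbation

variable {n : ℕ}

/-- If `|s| Lip(X) ≤ 1/2`, then `id + s X` is a Lipschitz perturbation of the identity with constant
below `1`, hence a homeomorphism. Its differential is invertible by a Neumann series, so the inverse
is smooth. -/
lemma exists_diffeo_id_add_smul {Ω : Set (Amb n)} {X : Amb n → Amb n} (hX : IsTest Ω X) :
    ∃ s₀ > 0, ∀ s : ℝ, |s| ≤ s₀ → ∃ f : Amb n ≃ₜ Amb n, (∀ x, f x = x + s • X x) ∧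
      IsDiffeo f ∧ LipschitzWith 2 f ∧ ∀ x, f x ∈ Ω ↔ x ∈ Ω := by
  obtain ⟨L, hL⟩ := hX.smooth.lipschitzWith_of_hasCompactSupport hX.compact (by norm_num)
  refine ⟨(2 * (L + 1))⁻¹, by positivity, fun s hs => ?_⟩
  have hsL : |s| * L ≤ 1 / 2 := by
    have h1 : |s| * (2 * (L + 1)) ≤ 1 := by
      rwa [← le_div_iff₀ (by positivity), one_div]
    have := abs_nonneg s
    nlinarith [L.2]
  let F : Amb n → Amb n := fun x => x + s • X x
  have hd : ∀ x, HasFDerivAt F (ContinuousLinearMap.id ℝ (Amb n) + s • fderiv ℝ X x) x :=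
    fun x => (hasFDerivAt_id x).add ((hX.differentiable x).hasFDerivAt.const_smul s)
  have hsd : ∀ x, ‖-(s • fderiv ℝ X x)‖ < 1 := by
    intro x
    rw [norm_neg, norm_smul, Real.norm_eq_abs]
    have h1 : ‖fderiv ℝ X x‖ ≤ L := norm_fderiv_le_of_lipschitz ℝ hL
    have := mul_le_mul_of_nonneg_left h1 (abs_nonneg s)
    linarith
  have happ : ApproximatesLinearOn F
      ((ContinuousLinearEquiv.refl ℝ (Amb n) : Amb n ≃L[ℝ] Amb n) : Amb n →L[ℝ] Amb n)
      univ (1 / 2 : NNReal) := by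
    intro x _ y _
    have h1 : F x - F y - (ContinuousLinearEquiv.refl ℝ (Amb n) : Amb n →L[ℝ] Amb n) (x - y)
        = s • (X x - X y) := by
      simp only [F, ContinuousLinearEquiv.coe_refl, ContinuousLinearMap.id_apply, smul_sub]
      abel
    rw [h1, norm_smul, Real.norm_eq_abs]
    have h2 := hL.dist_le_mul x y
    rw [dist_eq_norm, dist_eq_norm] at h2
    calc |s| * ‖X x - X y‖ ≤ |s| * (L * ‖x - y‖) := by gcongr
      _ = |s| * L * ‖x - y‖ := by ring
      _ ≤ 1 / 2 * ‖x - y‖ := by gcongr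
      _ = _ := by norm_num
  have hN : ‖((ContinuousLinearEquiv.refl ℝ (Amb n)).symm : Amb n →L[ℝ] Amb n)‖₊ = 1 := by
    simp
  let f : Amb n ≃ₜ Amb n := happ.toHomeomorph F (Or.inr (by
    rw [hN]
    norm_num))
  have hfF : ∀ x, f x = x + s • X x := fun x => rfl
  have hsm : ContDiff ℝ ∞ F := contDiff_id.add (hX.smooth.const_smul s)
  refine ⟨f, hfF, ⟨hsm, ?_⟩, ?_, ?_⟩
  · refine f.contDiff_symm (f₀' := fun a => ContinuousLinearEquiv.unitsEquiv ℝ _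
      (Units.oneSub _ (hsd a))) (fun a => ?_) hsm
    have : ((ContinuousLinearEquiv.unitsEquiv ℝ _ (Units.oneSub _ (hsd a)) :
        Amb n ≃L[ℝ] Amb n) : Amb n →L[ℝ] Amb n)
        = ContinuousLinearMap.id ℝ (Amb n) + s • fderiv ℝ X a := by
      ext1 v
      simp
    rw [this]
    exact hd a
  · refine LipschitzWith.of_dist_le_mul fun x y => ?_
    rw [hfF, hfF, dist_eq_norm, dist_eq_norm]
    have h2 := hL.dist_le_mul x y
    rw [dist_eq_norm, dist_eq_norm] at h2
    have h1 : x + s • X x - (y + s • X y) = (x - y) + s • (X x - X y) := by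
      rw [smul_sub]
      abel
    rw [h1]
    calc ‖(x - y) + s • (X x - X y)‖ ≤ ‖x - y‖ + |s| * (L * ‖x - y‖) := by
          refine (norm_add_le _ _).trans ?_
          rw [norm_smul, Real.norm_eq_abs]
          gcongr
      _ = (1 + |s| * L) * ‖x - y‖ := by ring
      _ ≤ 2 * ‖x - y‖ := by gcongr; linarith
  · intro x
    constructor
    · intro h
      by_contra hx
      rw [hfF, hX.eq_zero hx, smul_zero, add_zero] at h
      exact hx h
    · intro hx
      by_contra h
      -- Points outside `Ω` are fixed by `f`; if `f x` is one of them, injectivity gives `f x = x`.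
      have h1 : f (f x) = f x := by
        rw [hfF (f x), hX.eq_zero h, smul_zero, add_zero]
      rw [f.injective h1] at h
      exact h hx

/-- Small perturbations of the identity preserve spanning classes. -/
lemma IsSpanningClass.exists_diffeo {Ω : Set (Amb n)} {C : Set (UnitAddCircle → Amb n)}
    (hC : IsSpanningClass Ω C) {X : Amb n → Amb n} (hX : IsTest Ω X) :
    ∃ s₀ > 0, ∀ s : ℝ, |s| ≤ s₀ → ∃ f : Amb n ≃ₜ Amb n, (∀ x, f x = x + s • X x) ∧
      IsDiffeo f ∧ LipschitzWith 2 f ∧ (∀ x, f x ∈ Ω ↔ x ∈ Ω) ∧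
      ∀ γ ∈ C, (fun θ => f.symm (γ θ)) ∈ C := by
  obtain ⟨s₀, hs₀, h⟩ := exists_diffeo_id_add_smul hX
  refine ⟨s₀, hs₀, fun s hs => ?_⟩
  obtain ⟨f, hf, hfd, hfL, hfΩ⟩ := h s hs
  refine ⟨f, hf, hfd, hfL, hfΩ, fun γ hγ => ?_⟩
  have hsymm : ∀ x ∈ Ω, f.symm x ∈ Ω := fun x hx => by
    rw [← hfΩ, Homeomorph.apply_symm_apply]
    exact hx
  have hγl := hC.loop γ hγ
  -- This isotopy joins `γ` at `t = 0` to `f⁻¹ ∘ γ` at `t = 1`. Only the one inverse `f⁻¹` enters,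
  -- so smooth dependence of inverses on `t` is not needed.
  have key := hC.isotopy
    (fun θ t => f.symm (γ θ + ((1 - t) * s) • X (γ θ))) ?_ ?_ ?_
  · simpa using key
  · have h1 : ContDiff ℝ ∞ fun p : ℝ × ℝ => γ (p.1 : UnitAddCircle) :=
      hγl.smooth.comp contDiff_fst
    refine ContDiff.contDiffOn ?_
    have h2 : ContDiff ℝ ∞ fun p : ℝ × ℝ => X (γ (p.1 : UnitAddCircle)) := hX.smooth.comp h1
    have h3 : ContDiff ℝ ∞ fun p : ℝ × ℝ => (1 - p.2) * s := by fun_prop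
    exact hfd.smooth_symm.comp (h1.add (h3.smul h2))
  · intro t ht
    obtain ⟨g, hg, hgd, -, hgΩ⟩ := h ((1 - t) * s) (by
      rw [abs_mul, abs_of_nonneg (by linarith [ht.2])]
      have := abs_nonneg s
      nlinarith [ht.1, ht.2])
    have := (hγl.comp_diffeo hgd fun x hx => (hgΩ x).2 hx).comp_diffeo hfd.symm hsymm
    simpa only [hg] using this
  · have : (fun θ => f.symm (γ θ + ((1 - 0) * s) • X (γ θ))) = γ := by
      ext1 θ
      rw [sub_zero, one_mul, ← hf, Homeomorph.symm_apply_apply]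
    rw [this]
    exact hγ

end Perturbation

end ACPlateau

end

noncomputable section

namespace ACPlateau

/-! ### Approximate limits and superlevel sets -/

section ApproxLim

variable {n : ℕ}

/-- `u` has approximate limit `ℓ` at `x`. -/
def HasApproxLim (Ω : Set (Amb n)) (u : Amb n → ℝ) (x : Amb n) (ℓ : ℝ) : Prop :=
  ∀ η > 0, x ∈ densityPts 0 {y | y ∈ Ω ∧ η ≤ |u y - ℓ|}

lemma HasApproxLim.approxSup_eq {Ω : Set (Amb n)} (hΩ : IsOpen Ω) {u : Amb n → ℝ} {x : Amb n}
    {ℓ : ℝ} (hx : x ∈ Ω) (h : HasApproxLim Ω u x ℓ) : approxSup Ω u x = ℓ := by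
  apply le_antisymm
  · refine EReal.le_of_forall_lt_iff_le.1 fun z hz => ?_
    have hz' : ℓ < z := by exact_mod_cast hz
    refine sInf_le ⟨z, ?_, rfl⟩
    refine densityPts_zero_mono one_pos ?_ (h (z - ℓ) (sub_pos.2 hz'))
    rintro y ⟨⟨h1, h2⟩, -⟩
    exact ⟨h1, (sub_le_sub_right h2.le _).trans (le_abs_self _)⟩
  · refine le_sInf ?_
    rintro _ ⟨t, ht, rfl⟩
    rw [EReal.coe_le_coe_iff]
    by_contra! hlt
    refine not_densityPts_zero_of_nhds ?_
      (densityPts_zero_union ht (h (ℓ - t) (sub_pos.2 hlt)))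
    refine mem_of_superset (hΩ.mem_nhds hx) fun y hy => ?_
    by_cases hy' : t < u y
    · exact Or.inl ⟨hy, hy'⟩
    · refine Or.inr ⟨hy, ?_⟩
      rw [abs_sub_comm]
      exact (by linarith : ℓ - t ≤ ℓ - u y).trans (le_abs_self _)

lemma HasApproxLim.approxInf_eq {Ω : Set (Amb n)} (hΩ : IsOpen Ω) {u : Amb n → ℝ} {x : Amb n}
    {ℓ : ℝ} (hx : x ∈ Ω) (h : HasApproxLim Ω u x ℓ) : approxInf Ω u x = ℓ := by
  apply le_antisymm
  · refine sSup_le ?_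
    rintro _ ⟨t, ht, rfl⟩
    rw [EReal.coe_le_coe_iff]
    by_contra! hlt
    refine not_densityPts_zero_of_nhds ?_
      (densityPts_zero_union ht (h (t - ℓ) (sub_pos.2 hlt)))
    refine mem_of_superset (hΩ.mem_nhds hx) fun y hy => ?_
    by_cases hy' : u y < t
    · exact Or.inl ⟨hy, hy'⟩
    · exact Or.inr ⟨hy, (by linarith : t - ℓ ≤ u y - ℓ).trans (le_abs_self _)⟩
  · refine EReal.ge_of_forall_gt_iff_ge.1 fun z hz => ?_
    have hz' : z < ℓ := by exact_mod_cast hz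
    refine le_sSup ⟨z, ?_, rfl⟩
    refine densityPts_zero_mono one_pos ?_ (h (ℓ - z) (sub_pos.2 hz'))
    rintro y ⟨⟨h1, h2⟩, -⟩
    refine ⟨h1, ?_⟩
    rw [abs_sub_comm]
    exact (by linarith : ℓ - z ≤ ℓ - u y).trans (le_abs_self _)

lemma HasApproxLim.mem_superlevel {Ω : Set (Amb n)} (hΩ : IsOpen Ω) {u : Amb n → ℝ} {x : Amb n}
    {ℓ t : ℝ} (hx : x ∈ Ω) (h : HasApproxLim Ω u x ℓ) (ht : t ≤ ℓ) : x ∈ superlevel Ω u t := by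
  refine ⟨hx, ?_, ?_⟩
  · rw [h.approxSup_eq hΩ hx, h.approxInf_eq hΩ hx]
  · rw [h.approxSup_eq hΩ hx]
    exact_mod_cast ht

/-- The bounds `0 ≤ u ≤ 1` make the common approximate limit finite, and `{|u - ℓ| ≥ η}` is covered
by an upper and a lower level set of density zero. -/
lemma exists_hasApproxLim_of_mem_superlevel {Ω : Set (Amb n)} (hΩ : IsOpen Ω) {u : Amb n → ℝ}
    (hr : ∀ᵐ x ∂(volume.restrict Ω), u x ∈ Icc (0 : ℝ) 1) {x : Amb n} {t : ℝ}
    (h : x ∈ superlevel Ω u t) : ∃ ℓ : ℝ, HasApproxLim Ω u x ℓ ∧ t ≤ ℓ := by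
  obtain ⟨hx, h1, h2⟩ := h
  rw [ae_restrict_iff' hΩ.measurableSet, ae_iff] at hr
  have hle : approxSup Ω u x ≤ (1 : ℝ) := by
    refine sInf_le ⟨1, densityPts_zero_of_null (measure_mono_null ?_ hr), rfl⟩
    intro y hy h
    exact absurd (h hy.1).2 (not_le.2 hy.2)
  have hge : ((0 : ℝ) : EReal) ≤ approxInf Ω u x := by
    refine le_sSup ⟨0, densityPts_zero_of_null (measure_mono_null ?_ hr), rfl⟩
    intro y hy h
    exact absurd (h hy.1).1 (not_le.2 hy.2)
  rw [h1] at hge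
  obtain ⟨ℓ, hℓ⟩ : ∃ ℓ : ℝ, approxSup Ω u x = ℓ := by
    refine ⟨(approxSup Ω u x).toReal, (EReal.coe_toReal ?_ ?_).symm⟩
    · exact (hle.trans_lt (EReal.coe_lt_top 1)).ne
    · exact ((EReal.bot_lt_coe 0).trans_le hge).ne'
  refine ⟨ℓ, fun η hη => ?_, by rw [hℓ] at h2; exact_mod_cast h2⟩
  have hs : approxSup Ω u x < ((ℓ + η : ℝ) : EReal) := by
    rw [hℓ]
    exact_mod_cast (by linarith : ℓ < ℓ + η)
  have hi : ((ℓ - η : ℝ) : EReal) < approxInf Ω u x := by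
    rw [h1, hℓ]
    exact_mod_cast (by linarith : ℓ - η < ℓ)
  obtain ⟨_, ⟨a, ha, rfl⟩, ha'⟩ := sInf_lt_iff.1 hs
  obtain ⟨_, ⟨b, hb, rfl⟩, hb'⟩ := lt_sSup_iff.1 hi
  have ha'' : a < ℓ + η := EReal.coe_lt_coe_iff.1 ha'
  have hb'' : ℓ - η < b := EReal.coe_lt_coe_iff.1 hb'
  refine densityPts_zero_mono one_pos ?_ (densityPts_zero_union ha hb)
  rintro y ⟨⟨hy, hyη⟩, -⟩
  rcases le_abs.1 hyη with h | h
  · exact Or.inl ⟨hy, by linarith⟩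
  · exact Or.inr ⟨hy, by linarith⟩

lemma HasApproxLim.le_of_ae {Ω U : Set (Amb n)} (hΩ : IsOpen Ω) (hU : IsOpen U) {u : Amb n → ℝ}
    {x : Amb n} {ℓ c : ℝ} (h : HasApproxLim Ω u x ℓ) (hx : x ∈ Ω) (hxU : x ∈ U)
    (hc : ∀ᵐ y ∂(volume.restrict U), c ≤ u y) : c ≤ ℓ := by
  by_contra! hlt
  rw [ae_restrict_iff' hU.measurableSet, ae_iff] at hc
  refine not_densityPts_zero_of_nhds ?_ (densityPts_zero_union (h (c - ℓ) (sub_pos.2 hlt))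
    (densityPts_zero_of_null hc))
  refine mem_of_superset ((hΩ.inter hU).mem_nhds ⟨hx, hxU⟩) fun y hy => ?_
  by_cases hy' : c ≤ u y
  · exact Or.inl ⟨hy.1, (by linarith : c - ℓ ≤ u y - ℓ).trans (le_abs_self _)⟩
  · exact Or.inr fun h => hy' (h hy.2)

/-- Dependence of `Ψ` on the point as well as on the value is needed for perturbations `(1 + b(y))
u(y) + a(y)`. -/
lemma HasApproxLim.comp {Ω : Set (Amb n)} {u : Amb n → ℝ} {x : Amb n} {ℓ : ℝ}
    (h : HasApproxLim Ω u x ℓ) {Ψ : Amb n × ℝ → ℝ} (hΨ : Continuous Ψ) :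
    HasApproxLim Ω (fun y => Ψ (y, u y)) x (Ψ (x, ℓ)) := by
  intro η hη
  obtain ⟨ρ, hρ, hball⟩ := Metric.continuous_iff.1 hΨ (x, ℓ) η hη
  refine densityPts_zero_mono hρ ?_ (h ρ hρ)
  rintro y ⟨⟨hy, hyη⟩, hyρ⟩
  refine ⟨hy, ?_⟩
  by_contra! hlt
  have := hball (y, u y) (by
    rw [Prod.dist_eq, max_lt_iff]
    exact ⟨hyρ, hlt⟩)
  rw [Real.dist_eq] at this
  linarith

lemma HasApproxLim.comp_diffeo {Ω : Set (Amb n)} {u : Amb n → ℝ} {x : Amb n} {ℓ : ℝ}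
    (h : HasApproxLim Ω u x ℓ) {f : Amb n ≃ₜ Amb n} (hf : IsDiffeo f)
    (hfΩ : ∀ x, f x ∈ Ω ↔ x ∈ Ω) : HasApproxLim Ω (fun y => u (f.symm y)) (f x) ℓ := by
  intro η hη
  refine densityPts_zero_mono one_pos ?_ (densityPts_zero_image hf (h η hη))
  rintro y ⟨⟨hy, hyη⟩, -⟩
  refine ⟨f.symm y, ⟨?_, hyη⟩, f.apply_symm_apply y⟩
  rwa [← hfΩ, f.apply_symm_apply]

/-- Approximate limits are carried along by continuous changes of value and by diffeomorphisms. With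
the monotonicity of spanning in the set, this reduces the spanning condition for a competitor to an
inequality at points where `u` has an approximate limit. -/
lemma image_superlevel_subset {Ω : Set (Amb n)} (hΩ : IsOpen Ω) {u : Amb n → ℝ}
    (hr : ∀ᵐ x ∂(volume.restrict Ω), u x ∈ Icc (0 : ℝ) 1) {f : Amb n ≃ₜ Amb n} (hf : IsDiffeo f)
    (hfΩ : ∀ x, f x ∈ Ω ↔ x ∈ Ω) {Ψ : Amb n × ℝ → ℝ} (hΨ : Continuous Ψ) {t t' : ℝ}
    (h : ∀ x ∈ Ω, ∀ ℓ, HasApproxLim Ω u x ℓ → t' ≤ ℓ → t ≤ Ψ (x, ℓ)) :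
    f '' superlevel Ω u t' ⊆ superlevel Ω (fun y => Ψ (f.symm y, u (f.symm y))) t := by
  rintro _ ⟨x, hx, rfl⟩
  obtain ⟨ℓ, hℓ, htℓ⟩ := exists_hasApproxLim_of_mem_superlevel hΩ hr hx
  exact ((hℓ.comp hΨ).comp_diffeo hf hfΩ).mem_superlevel hΩ ((hfΩ x).2 hx.1)
    (h x hx.1 ℓ hℓ htℓ)

end ApproxLim

end ACPlateau

end

noncomputable section

namespace ACPlateau

/-! ### Energy densities of perturbations -/

section Jets

variable {n : ℕ}

/-- First order data `(DX, a, b, ∇a, ∇b)` of a perturbation `(1 + b) u + a` of `u` transported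
by `id + X`. -/
def Jet (n : ℕ) : Type := (Amb n →L[ℝ] Amb n) × ℝ × ℝ × Amb n × Amb n

instance : NormedAddCommGroup (Jet n) :=
  inferInstanceAs (NormedAddCommGroup ((Amb n →L[ℝ] Amb n) × ℝ × ℝ × Amb n × Amb n))

instance : NormedSpace ℝ (Jet n) :=
  inferInstanceAs (NormedSpace ℝ ((Amb n →L[ℝ] Amb n) × ℝ × ℝ × Amb n × Amb n))

variable (n) in
/-- The differential of the displacement. -/
def jLin : Jet n →L[ℝ] (Amb n →L[ℝ] Amb n) :=
  LinearMap.mkContinuous ⟨⟨fun j : Jet n => Prod.fst j, fun _ _ => rfl⟩, fun _ _ => rfl⟩ 1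
    fun j => by
      rw [one_mul]
      exact norm_fst_le (E := Amb n →L[ℝ] Amb n) (F := ℝ × ℝ × Amb n × Amb n) j

variable (n) in
/-- The components of a jet other than the differential of the displacement. -/
def jRest : Jet n →L[ℝ] ℝ × ℝ × Amb n × Amb n :=
  LinearMap.mkContinuous ⟨⟨fun j : Jet n => Prod.snd j, fun _ _ => rfl⟩, fun _ _ => rfl⟩ 1
    fun j => by
      rw [one_mul]
      exact norm_snd_le (E := Amb n →L[ℝ] Amb n) (F := ℝ × ℝ × Amb n × Amb n) j

variable (n) in
/-- The value of the additive perturbation. -/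
def jShift : Jet n →L[ℝ] ℝ := (ContinuousLinearMap.fst ℝ ℝ (ℝ × Amb n × Amb n)).comp (jRest n)

variable (n) in
/-- The value of the multiplicative perturbation. -/
def jFactor : Jet n →L[ℝ] ℝ :=
  ((ContinuousLinearMap.fst ℝ ℝ (Amb n × Amb n)).comp
    (ContinuousLinearMap.snd ℝ ℝ (ℝ × Amb n × Amb n))).comp (jRest n)

variable (n) in
/-- The gradient of the additive perturbation. -/
def jShiftGrad : Jet n →L[ℝ] Amb n :=
  ((ContinuousLinearMap.fst ℝ (Amb n) (Amb n)).comp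
    ((ContinuousLinearMap.snd ℝ ℝ (Amb n × Amb n)).comp
      (ContinuousLinearMap.snd ℝ ℝ (ℝ × Amb n × Amb n)))).comp (jRest n)

variable (n) in
/-- The gradient of the multiplicative perturbation. -/
def jFactorGrad : Jet n →L[ℝ] Amb n :=
  ((ContinuousLinearMap.snd ℝ (Amb n) (Amb n)).comp
    ((ContinuousLinearMap.snd ℝ ℝ (Amb n × Amb n)).comp
      (ContinuousLinearMap.snd ℝ ℝ (ℝ × Amb n × Amb n)))).comp (jRest n)

/-- The jet with prescribed components. -/
def Jet.mk (T : Amb n →L[ℝ] Amb n) (a b : ℝ) (a' b' : Amb n) : Jet n := (T, a, b, a', b')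

section Components

variable (T : Amb n →L[ℝ] Amb n) (a b : ℝ) (a' b' : Amb n)

@[simp] lemma jLin_mk : jLin n (Jet.mk T a b a' b') = T := rfl
@[simp] lemma jShift_mk : jShift n (Jet.mk T a b a' b') = a := rfl
@[simp] lemma jFactor_mk : jFactor n (Jet.mk T a b a' b') = b := rfl
@[simp] lemma jShiftGrad_mk : jShiftGrad n (Jet.mk T a b a' b') = a' := rfl
@[simp] lemma jFactorGrad_mk : jFactorGrad n (Jet.mk T a b a' b') = b' := rfl

lemma Jet.mk_zero : Jet.mk (n := n) 0 0 0 0 0 = 0 := rfl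

end Components

lemma continuous_jet_mk {T : Amb n → Amb n →L[ℝ] Amb n} {a b : Amb n → ℝ} {a' b' : Amb n → Amb n}
    (hT : Continuous T) (ha : Continuous a) (hb : Continuous b) (ha' : Continuous a')
    (hb' : Continuous b') : Continuous fun x => Jet.mk (T x) (a x) (b x) (a' x) (b' x) :=
  hT.prodMk (ha.prodMk (hb.prodMk (ha'.prodMk hb')))

/-- The value of the perturbed function. -/
def Jet.val (j : Jet n) (z : ℝ) : ℝ := (1 + (jFactor n j)) * z + (jShift n j)

/-- The gradient of the perturbed function. -/
def Jet.grad (j : Jet n) (z : ℝ) (g : Amb n) : Amb n :=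
  (1 + (jFactor n j)) • g + z • (jFactorGrad n j) + (jShiftGrad n j)

/-- The density `(c |∇w|² + κ P(w)) J` of the perturbed function, pulled back to the original
domain. -/
def jetDensity (c κ : ℝ) (P : ℝ → ℝ) (z : ℝ) (g : Amb n) (j : Jet n) : ℝ :=
  (c * ‖ContinuousLinearMap.adjoint (Ring.inverse (1 + (jLin n j))) (j.grad z g)‖ ^ 2
    + κ * P (clamp (j.val z))) * |(1 + (jLin n j)).det|

/-- The first variation of `jetDensity`. -/
def jetVariation (c κ : ℝ) (P : ℝ → ℝ) (z : ℝ) (g : Amb n) (j : Jet n) : ℝ :=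
  c * (2 * inner ℝ g ((jFactor n j) • g + z • (jFactorGrad n j) + (jShiftGrad n j) - (jLin n j) g))
    + κ * (deriv01 P (clamp z) * ((jFactor n j) * z + (jShift n j)))
    + (c * ‖g‖ ^ 2 + κ * P (clamp z)) * LinearMap.trace ℝ (Amb n) ((jLin n j) : Amb n →ₗ[ℝ] Amb n)

lemma jetDensity_zero (c κ : ℝ) (P : ℝ → ℝ) (z : ℝ) (g : Amb n) :
    jetDensity c κ P z g 0 = c * ‖g‖ ^ 2 + κ * P (clamp z) := by
  have h : ContinuousLinearMap.adjoint (1 : Amb n →L[ℝ] Amb n) = 1 :=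
    ContinuousLinearMap.adjoint_id
  have hd : (1 : Amb n →L[ℝ] Amb n).det = 1 := by
    simp [ContinuousLinearMap.det]
  simp [jetDensity, Jet.val, Jet.grad, h, hd]

/-- The determinant is polynomial in the entries, hence differentiable; its derivative is read off
along lines from `det(1 + sM) = 1 + s tr M + s² q(s)`. -/
lemma hasFDerivAt_det_one_add :
    ∃ D : (Amb n →L[ℝ] Amb n) →L[ℝ] ℝ,
      (∀ T, D T = LinearMap.trace ℝ (Amb n) (T : Amb n →ₗ[ℝ] Amb n)) ∧
      HasFDerivAt (fun T : Amb n →L[ℝ] Amb n => (1 + T).det) D 0 := by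
  let b := (EuclideanSpace.basisFun (Fin (n + 1)) ℝ).toBasis
  have hdet : ∀ T : Amb n →L[ℝ] Amb n, T.det = (LinearMap.toMatrix b b T).det := fun T => by
    rw [ContinuousLinearMap.det, LinearMap.det_toMatrix]
  have hentry : ∀ i k, Differentiable ℝ fun T : Amb n →L[ℝ] Amb n =>
      LinearMap.toMatrix b b (T : Amb n →ₗ[ℝ] Amb n) i k := by
    intro i k
    have : (fun T : Amb n →L[ℝ] Amb n => LinearMap.toMatrix b b (T : Amb n →ₗ[ℝ] Amb n) i k)
        = fun T => (T (b k)) i := by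
      ext1 T
      rw [LinearMap.toMatrix_apply]
      simp [b]
    rw [this]
    have h1 : Differentiable ℝ fun T : Amb n →L[ℝ] Amb n => T (b k) := by fun_prop
    exact (EuclideanSpace.proj (𝕜 := ℝ) i).differentiable.comp h1
  have hdiff : Differentiable ℝ fun T : Amb n →L[ℝ] Amb n => T.det := by
    simp_rw [hdet, Matrix.det_apply]
    fun_prop
  have hd1 : Differentiable ℝ fun T : Amb n →L[ℝ] Amb n => (1 + T).det :=
    hdiff.comp (differentiable_id.const_add 1)
  refine ⟨fderiv ℝ (fun T : Amb n →L[ℝ] Amb n => (1 + T).det) 0, fun T => ?_,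
    (hd1 0).hasFDerivAt⟩
  have h1 : HasDerivAt (fun s : ℝ => (1 + s • T).det)
      (fderiv ℝ (fun T : Amb n →L[ℝ] Amb n => (1 + T).det) 0 T) 0 := by
    have hs : HasDerivAt (fun s : ℝ => s • T) T 0 := by
      simpa using (hasDerivAt_id (0 : ℝ)).smul_const T
    exact HasFDerivAt.comp_hasDerivAt_of_eq (0 : ℝ) (hd1 0).hasFDerivAt hs
      (zero_smul ℝ T).symm
  let M := LinearMap.toMatrix b b (T : Amb n →ₗ[ℝ] Amb n)
  have h2 : HasDerivAt (fun s : ℝ => (1 + s • T).det) M.trace 0 := by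
    let q := (Matrix.det (1 + (Polynomial.X : Polynomial ℝ) • M.map Polynomial.C)).divX.divX
    have hpoly : ∀ s : ℝ, (1 + s • T).det = 1 + M.trace * s + q.eval s * s ^ 2 := by
      intro s
      rw [hdet, ← Matrix.det_one_add_smul]
      congr 1
      have : ((1 + s • T : Amb n →L[ℝ] Amb n) : Amb n →ₗ[ℝ] Amb n)
          = LinearMap.id + s • (T : Amb n →ₗ[ℝ] Amb n) := rfl
      rw [this, map_add, map_smul, LinearMap.toMatrix_id]
    have h3 := (((hasDerivAt_id (0 : ℝ)).const_mul M.trace).const_add 1).add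
      ((q.hasDerivAt 0).mul ((hasDerivAt_id (0 : ℝ)).pow 2))
    refine (h3.congr_deriv (by simp)).congr_of_eventuallyEq
      (Eventually.of_forall fun s =>
        (hpoly s).trans (by simp))
  rw [h1.unique h2, LinearMap.trace_eq_matrix_trace ℝ b]

lemma hasFDerivAt_abs_det_one_add :
    ∃ D : (Amb n →L[ℝ] Amb n) →L[ℝ] ℝ,
      (∀ T, D T = LinearMap.trace ℝ (Amb n) (T : Amb n →ₗ[ℝ] Amb n)) ∧
      HasFDerivAt (fun T : Amb n →L[ℝ] Amb n => |(1 + T).det|) D 0 := by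
  obtain ⟨D, hD, h⟩ := hasFDerivAt_det_one_add (n := n)
  refine ⟨D, hD, h.congr_of_eventuallyEq ?_⟩
  have h0 : (0 : ℝ) < (1 + (0 : Amb n →L[ℝ] Amb n)).det := by
    simp [ContinuousLinearMap.det]
  filter_upwards [h.continuousAt.eventually (lt_mem_nhds h0)] with T hT
  exact abs_of_pos hT

/-- The adjoint as a real linear map. -/
def adjointL (n : ℕ) : (Amb n →L[ℝ] Amb n) →L[ℝ] (Amb n →L[ℝ] Amb n) :=
  (ContinuousLinearMap.adjoint : (Amb n →L[ℝ] Amb n) ≃ₗᵢ⋆[ℝ] _).toLinearEquiv.toAddEquiv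
    |>.toAddMonoidHom.toRealLinearMap (LinearIsometryEquiv.continuous _)

lemma adjointL_apply (T : Amb n →L[ℝ] Amb n) : adjointL n T = ContinuousLinearMap.adjoint T := rfl

lemma hasFDerivAt_inverse_one_add :
    HasFDerivAt (fun T : Amb n →L[ℝ] Amb n => Ring.inverse (1 + T))
      (-ContinuousLinearMap.id ℝ (Amb n →L[ℝ] Amb n)) 0 := by
  have h := hasFDerivAt_ringInverse (𝕜 := ℝ) (1 : (Amb n →L[ℝ] Amb n)ˣ)
  have h1 : HasFDerivAt (fun T : Amb n →L[ℝ] Amb n => 1 + T)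
      (ContinuousLinearMap.id ℝ (Amb n →L[ℝ] Amb n)) 0 := (hasFDerivAt_id _).const_add 1
  have h2 : HasFDerivAt (Ring.inverse : (Amb n →L[ℝ] Amb n) → _)
      (-ContinuousLinearMap.id ℝ (Amb n →L[ℝ] Amb n)) (1 + (0 : Amb n →L[ℝ] Amb n)) := by
    rw [add_zero]
    refine h.congr_fderiv ?_
    ext1 T
    simp
  exact h2.comp (0 : Amb n →L[ℝ] Amb n) h1

/-- At the trivial jet the inverse differential contributes `-T`, the Jacobian its trace, and the
value and gradient of `(1 + b) z + a` their linear parts. -/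
lemma hasFDerivAt_jetDensity (c κ : ℝ) {P : ℝ → ℝ} (hP : IsFlatPotential P) (z : ℝ) (g : Amb n) :
    ∃ D : Jet n →L[ℝ] ℝ, (∀ j, D j = jetVariation c κ P z g j) ∧
      HasFDerivAt (jetDensity c κ P z g) D 0 := by
  obtain ⟨Dd, hDd, hd⟩ := hasFDerivAt_abs_det_one_add (n := n)
  have hT : HasFDerivAt (fun j : Jet n => jLin n j) (jLin n) 0 := (jLin n).hasFDerivAt
  have ha : HasFDerivAt (fun j : Jet n => jShift n j) (jShift n) 0 := (jShift n).hasFDerivAt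
  have hb : HasFDerivAt (fun j : Jet n => jFactor n j) (jFactor n) 0 := (jFactor n).hasFDerivAt
  have ha' : HasFDerivAt (fun j : Jet n => jShiftGrad n j) (jShiftGrad n) 0 :=
    (jShiftGrad n).hasFDerivAt
  have hb' : HasFDerivAt (fun j : Jet n => jFactorGrad n j) (jFactorGrad n) 0 :=
    (jFactorGrad n).hasFDerivAt
  have hd0 : HasFDerivAt (fun T : Amb n →L[ℝ] Amb n => |(1 + T).det|) Dd (jLin n 0) := by
    rw [map_zero]
    exact hd
  have hinv0 : HasFDerivAt (fun T : Amb n →L[ℝ] Amb n => Ring.inverse (1 + T))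
      (-ContinuousLinearMap.id ℝ (Amb n →L[ℝ] Amb n)) (jLin n 0) := by
    rw [map_zero]
    exact hasFDerivAt_inverse_one_add
  have hinv : HasFDerivAt (fun j : Jet n => Ring.inverse (1 + (jLin n j))) _ 0 :=
    HasFDerivAt.comp (0 : Jet n) (f := fun j : Jet n => (jLin n j))
      (g := fun T : Amb n →L[ℝ] Amb n => Ring.inverse (1 + T)) hinv0 hT
  have hadj := (adjointL n).hasFDerivAt.comp (0 : Jet n) hinv
  have hgrad : HasFDerivAt (fun j : Jet n => j.grad z g) _ 0 :=
    (((hb.const_add 1).smul_const g).add (hb'.const_smul z)).add ha'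
  have hval : HasFDerivAt (fun j : Jet n => j.val z) _ 0 :=
    ((hb.const_add 1).mul_const z).add ha
  have hPv : HasFDerivAt (fun j : Jet n => P (clamp (j.val z))) _ 0 :=
    HasDerivAt.comp_hasFDerivAt (f := fun j : Jet n => j.val z) (h₂ := fun s => P (clamp s))
      (0 : Jet n) (hP.hasDerivAt (Jet.val (0 : Jet n) z)) hval
  have hdet : HasFDerivAt (fun j : Jet n => |(1 + (jLin n j)).det|) _ 0 :=
    HasFDerivAt.comp (0 : Jet n) (f := fun j : Jet n => (jLin n j))
      (g := fun T : Amb n →L[ℝ] Amb n => |(1 + T).det|) hd0 hT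
  have hn := (hadj.clm_apply hgrad).norm_sq
  have hfull := ((hn.const_mul c).add (hPv.const_mul κ)).mul hdet
  refine ⟨_, fun j => ?_, hfull⟩
  have hone : ContinuousLinearMap.adjoint (1 : Amb n →L[ℝ] Amb n) = 1 :=
    ContinuousLinearMap.adjoint_id
  have hd1 : (1 : Amb n →L[ℝ] Amb n).det = 1 := by
    simp [ContinuousLinearMap.det]
  simp [jetVariation, Jet.val, Jet.grad, hone, hd1, hDd, adjointL_apply,
    ContinuousLinearMap.adjoint_inner_right]
  rw [inner_sub_right, inner_add_right, inner_add_right, inner_smul_right, inner_smul_right,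
    real_inner_self_eq_norm_sq, real_inner_comm ((jLin n j) g) g]
  ring

/-- Differentiability at one point already gives a linear bound for increments from that point. Such
bounds, uniform in `z` and `g`, are what domination requires. -/
lemma exists_calm_inverse_det : ∃ C r : ℝ, 0 ≤ C ∧ 0 < r ∧ r ≤ 1 / 2 ∧
    ∀ T : Amb n →L[ℝ] Amb n, ‖T‖ ≤ r →
      ‖Ring.inverse (1 + T) - 1‖ ≤ C * ‖T‖ ∧ |(|(1 + T).det|) - 1| ≤ C * ‖T‖ := by
  obtain ⟨Dd, -, hd⟩ := hasFDerivAt_abs_det_one_add (n := n)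
  obtain ⟨C₁, hC₁⟩ := hd.isBigO_sub.bound
  obtain ⟨C₂, hC₂⟩ := (hasFDerivAt_inverse_one_add (n := n)).isBigO_sub.bound
  obtain ⟨ρ, hρ, hball⟩ := Metric.eventually_nhds_iff.1 (hC₁.and hC₂)
  refine ⟨max 0 (max C₁ C₂), min (ρ / 2) (1 / 2), le_max_left _ _, by positivity,
    min_le_right _ _, fun T hT => ?_⟩
  have h := @hball T (by
    rw [dist_zero_right]
    have := hT.trans (min_le_left _ _)
    linarith)
  have hd1 : (1 : Amb n →L[ℝ] Amb n).det = 1 := by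
    simp [ContinuousLinearMap.det]
  simp only [add_zero, Ring.inverse_one, sub_zero, hd1, abs_one, Real.norm_eq_abs] at h
  constructor
  · refine h.2.trans ?_
    gcongr
    exact (le_max_right _ _).trans (le_max_right _ _)
  · refine h.1.trans ?_
    gcongr
    exact (le_max_left _ _).trans (le_max_right _ _)

lemma Jet.norm_lin_le (j : Jet n) : ‖jLin n j‖ ≤ ‖j‖ :=
  norm_fst_le (E := Amb n →L[ℝ] Amb n) (F := ℝ × ℝ × Amb n × Amb n) j

lemma Jet.norm_rest_le (j : Jet n) : ‖jRest n j‖ ≤ ‖j‖ :=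
  norm_snd_le (E := Amb n →L[ℝ] Amb n) (F := ℝ × ℝ × Amb n × Amb n) j

lemma Jet.abs_shift_le (j : Jet n) : |jShift n j| ≤ ‖j‖ :=
  (norm_fst_le (jRest n j)).trans j.norm_rest_le

lemma Jet.abs_factor_le (j : Jet n) : |jFactor n j| ≤ ‖j‖ :=
  (norm_fst_le (jRest n j).2).trans ((norm_snd_le _).trans j.norm_rest_le)

lemma Jet.norm_shift_grad_le (j : Jet n) : ‖jShiftGrad n j‖ ≤ ‖j‖ :=
  (norm_fst_le (jRest n j).2.2).trans
    ((norm_snd_le _).trans ((norm_snd_le _).trans j.norm_rest_le))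

lemma Jet.norm_factor_grad_le (j : Jet n) : ‖jFactorGrad n j‖ ≤ ‖j‖ :=
  (norm_snd_le (jRest n j).2.2).trans
    ((norm_snd_le _).trans ((norm_snd_le _).trans j.norm_rest_le))

set_option maxHeartbeats 1000000 in
/-- Calmness of `jetDensity` at the trivial jet. -/
lemma exists_jetDensity_sub_le (c κ : ℝ) {P : ℝ → ℝ} (hP : IsFlatPotential P) :
    ∃ C r : ℝ, 0 ≤ C ∧ 0 < r ∧ r ≤ 1 / 2 ∧ ∀ z ∈ Icc (0 : ℝ) 1, ∀ g : Amb n, ∀ j : Jet n, ‖j‖ ≤ r →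
      |jetDensity c κ P z g j - jetDensity c κ P z g 0| ≤ C * (1 + ‖g‖) ^ 2 * ‖j‖ := by
  obtain ⟨C, r, hC0, hr0, hr1, hC⟩ := exists_calm_inverse_det (n := n)
  obtain ⟨L, hL0, hL⟩ := hP.exists_lipschitz
  obtain ⟨M, hM0, hM⟩ := hP.exists_le
  -- `C₁` bounds the change of the gradient, `C₂` the change of the density before the Jacobian
  -- factor, and `C₃` the unperturbed density, each relative to the appropriate power of `m = 1 +
  -- ‖g‖`.
  set C₁ := 3 * C + 2 with hC₁
  set C₂ := |c| * (C₁ * (C₁ + 2)) + |κ| * (2 * L) with hC₂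
  set C₃ := |c| + |κ| * M with hC₃
  refine ⟨(C₂ + C₃) * C + C₂, r, by positivity, hr0, hr1, fun z hz g j hj => ?_⟩
  set N := ‖j‖ with hN
  have hN0 : 0 ≤ N := norm_nonneg j
  have hN1 : N ≤ 1 := hj.trans (by linarith)
  set m := 1 + ‖g‖ with hm
  have hm1 : 1 ≤ m := by linarith [norm_nonneg g]
  have hgm : ‖g‖ ≤ m := by linarith
  obtain ⟨hA, hD⟩ := hC (jLin n j) (j.norm_lin_le.trans hj)
  have hA' : ‖Ring.inverse (1 + (jLin n j)) - 1‖ ≤ C * N := hA.trans (by gcongr; exact j.norm_lin_le)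
  have hD' : |(|(1 + (jLin n j)).det|) - 1| ≤ C * N := hD.trans (by gcongr; exact j.norm_lin_le)
  set A := ContinuousLinearMap.adjoint (Ring.inverse (1 + (jLin n j))) with hAdef
  have hA1 : ‖A - 1‖ ≤ C * N := by
    have : A - 1 = ContinuousLinearMap.adjoint (Ring.inverse (1 + (jLin n j)) - 1) := by
      rw [map_sub]
      congr 1
      exact ContinuousLinearMap.adjoint_id.symm
    rw [this, LinearIsometryEquiv.norm_map]
    exact hA'
  set ζ : Amb n := (jFactor n j) • g + z • (jFactorGrad n j) + (jShiftGrad n j) with hζ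
  have hζn : ‖ζ‖ ≤ 2 * N * m := by
    calc ‖ζ‖ ≤ |(jFactor n j)| * ‖g‖ + |z| * ‖(jFactorGrad n j)‖ + ‖(jShiftGrad n j)‖ := by
          refine (norm_add_le _ _).trans ?_
          gcongr
          refine (norm_add_le _ _).trans ?_
          rw [norm_smul, norm_smul, Real.norm_eq_abs, Real.norm_eq_abs]
      _ ≤ N * ‖g‖ + 1 * N + N := by
          have hz1 : |z| ≤ 1 := by rw [abs_of_nonneg hz.1]; exact hz.2
          gcongr
          · exact j.abs_factor_le
          · exact j.norm_factor_grad_le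
          · exact j.norm_shift_grad_le
      _ ≤ 2 * N * m := by
          rw [hm]
          nlinarith [norm_nonneg g]
  have hξ : j.grad z g = g + ζ := by
    simp only [Jet.grad, hζ, add_smul, one_smul]
    abel
  have hξn : ‖g + ζ‖ ≤ 3 * m := by
    refine (norm_add_le _ _).trans ?_
    nlinarith
  set η : Amb n := A (g + ζ) - g with hη
  have hηe : η = (A - 1) (g + ζ) + ζ := by
    simp only [hη, sub_apply, one_apply_eq_self]
    abel
  have hηn : ‖η‖ ≤ C₁ * N * m := by
    rw [hηe]
    calc ‖(A - 1) (g + ζ) + ζ‖ ≤ ‖A - 1‖ * ‖g + ζ‖ + ‖ζ‖ := by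
          refine (norm_add_le _ _).trans ?_
          gcongr
          exact ContinuousLinearMap.le_opNorm _ _
      _ ≤ C * N * (3 * m) + 2 * N * m := by gcongr
      _ = C₁ * N * m := by rw [hC₁]; ring
  have hsq : |‖A (g + ζ)‖ ^ 2 - ‖g‖ ^ 2| ≤ C₁ * (C₁ + 2) * N * m ^ 2 := by
    have e1 : ‖A (g + ζ)‖ ^ 2 - ‖g‖ ^ 2 = (‖A (g + ζ)‖ - ‖g‖) * (‖A (g + ζ)‖ + ‖g‖) := by ring
    have e2 : |‖A (g + ζ)‖ - ‖g‖| ≤ ‖η‖ := abs_norm_sub_norm_le _ _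
    have e3 : ‖A (g + ζ)‖ ≤ ‖η‖ + ‖g‖ := by
      have := abs_le.1 e2
      linarith [this.2]
    rw [e1, abs_mul, abs_of_nonneg (add_nonneg (norm_nonneg (A (g + ζ))) (norm_nonneg g))]
    have hC₁0 : 0 ≤ C₁ := by positivity
    have e4 : ‖η‖ ≤ C₁ * m := hηn.trans (by nlinarith [mul_nonneg hC₁0 (by linarith : 0 ≤ m)])
    calc |‖A (g + ζ)‖ - ‖g‖| * (‖A (g + ζ)‖ + ‖g‖)
        ≤ (C₁ * N * m) * (C₁ * m + m + m) := by
          gcongr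
          · exact e2.trans hηn
          · linarith
      _ = C₁ * (C₁ + 2) * N * m ^ 2 := by ring
  have hPd : |P (clamp (j.val z)) - P (clamp z)| ≤ 2 * L * N := by
    refine (hL _ _).trans ?_
    have e1 : j.val z - z = (jFactor n j) * z + (jShift n j) := by
      simp only [Jet.val]
      ring
    have e2 : |j.val z - z| ≤ 2 * N := by
      rw [e1]
      refine (abs_add_le _ _).trans ?_
      rw [abs_mul, abs_of_nonneg hz.1]
      have := j.abs_factor_le
      have h2 := j.abs_shift_le
      have h3 := hz.2
      have h4 := abs_nonneg (jFactor n j)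
      nlinarith
    calc L * |j.val z - z| ≤ L * (2 * N) := by gcongr
      _ = 2 * L * N := by ring
  set Q := c * ‖A (g + ζ)‖ ^ 2 + κ * P (clamp (j.val z)) with hQ
  set Q₀ := c * ‖g‖ ^ 2 + κ * P (clamp z) with hQ₀
  have hm2 : 1 ≤ m ^ 2 := one_le_pow₀ hm1
  have hQd : |Q - Q₀| ≤ C₂ * N * m ^ 2 := by
    have : Q - Q₀ = c * (‖A (g + ζ)‖ ^ 2 - ‖g‖ ^ 2) + κ * (P (clamp (j.val z)) - P (clamp z)) := by
      rw [hQ, hQ₀]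
      ring
    rw [this]
    refine (abs_add_le _ _).trans ?_
    rw [abs_mul, abs_mul]
    calc |c| * |‖A (g + ζ)‖ ^ 2 - ‖g‖ ^ 2| + |κ| * |P (clamp (j.val z)) - P (clamp z)|
        ≤ |c| * (C₁ * (C₁ + 2) * N * m ^ 2) + |κ| * (2 * L * N * m ^ 2) := by
          gcongr
          exact hPd.trans (le_mul_of_one_le_right (by positivity) hm2)
      _ = C₂ * N * m ^ 2 := by rw [hC₂]; ring
  have hQ0n : |Q₀| ≤ C₃ * m ^ 2 := by
    refine (abs_add_le _ _).trans ?_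
    rw [abs_mul, abs_mul, abs_of_nonneg (sq_nonneg ‖g‖),
      abs_of_nonneg (hP.nonneg _ (clamp_mem z))]
    calc |c| * ‖g‖ ^ 2 + |κ| * P (clamp z) ≤ |c| * m ^ 2 + |κ| * (M * m ^ 2) := by
          gcongr
          exact (hM z).trans (le_mul_of_one_le_right hM0 hm2)
      _ = C₃ * m ^ 2 := by rw [hC₃]; ring
  have hC₂0 : 0 ≤ C₂ := by positivity
  have hQn : |Q| ≤ (C₂ + C₃) * m ^ 2 := by
    have h1 : |Q| ≤ |Q - Q₀| + |Q₀| := by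
      have := abs_add_le (Q - Q₀) Q₀
      rwa [sub_add_cancel] at this
    have h2 : C₂ * N * m ^ 2 ≤ C₂ * m ^ 2 := by
      gcongr
      exact mul_le_of_le_one_right hC₂0 hN1
    linarith
  have hval : jetDensity c κ P z g j = Q * |(1 + (jLin n j)).det| := by
    rw [hQ, ← hξ]
    rfl
  rw [jetDensity_zero, hval]
  generalize |(1 + (jLin n j)).det| = d at hD' ⊢
  have : Q * d - Q₀ = Q * (d - 1) + (Q - Q₀) := by ring
  rw [this]
  refine (abs_add_le _ _).trans ?_
  rw [abs_mul]
  calc |Q| * |d - 1| + |Q - Q₀|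
      ≤ (C₂ + C₃) * m ^ 2 * (C * N) + C₂ * N * m ^ 2 := by gcongr
    _ = ((C₂ + C₃) * C + C₂) * m ^ 2 * N := by ring

end Jets

end ACPlateau

end

noncomputable section

namespace ACPlateau

/-! ### First variations of integrals -/

section Variation

variable {n : ℕ} {Ω : Set (Amb n)} {u : Amb n → ℝ} {G : Amb n → Amb n}

lemma IsW12loc.aestronglyMeasurable_restrict (hΩ : IsOpen Ω) (hu : IsW12loc Ω u G) :
    AEStronglyMeasurable u (volume.restrict Ω) :=
  ((locallyIntegrableOn_iff hΩ.isLocallyClosed).2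
    fun _ h hK => hu.integrableOn hK h).aestronglyMeasurable

lemma IsW12loc.aestronglyMeasurable_grad_restrict (hΩ : IsOpen Ω) (hu : IsW12loc Ω u G) :
    AEStronglyMeasurable G (volume.restrict Ω) :=
  ((locallyIntegrableOn_iff hΩ.isLocallyClosed).2
    fun _ h hK => hu.integrableOn_grad hK h).aestronglyMeasurable

/-- Continuous jet fields with compact support in `Ω`. -/
structure IsJetField (Ω : Set (Amb n)) (j : Amb n → Jet n) : Prop where
  cont : Continuous j
  supp : ∃ K ⊆ Ω, IsCompact K ∧ ∀ x ∉ K, j x = 0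

lemma IsJetField.exists_bound {j : Amb n → Jet n} (h : IsJetField Ω j) :
    ∃ R, 0 ≤ R ∧ ∀ x, ‖j x‖ ≤ R := by
  obtain ⟨K, -, hK, h0⟩ := h.supp
  obtain ⟨R, hR⟩ := hK.exists_bound_of_continuousOn h.cont.continuousOn
  refine ⟨max R 0, le_max_right _ _, fun x => ?_⟩
  by_cases hx : x ∈ K
  · exact (hR x hx).trans (le_max_left _ _)
  · rw [h0 x hx, norm_zero]
    exact le_max_right _ _

/-- `jetDensity` as a continuous function, with the inverse matrix as an independent variable. -/
def jetDensityAux (c κ : ℝ) (P : ℝ → ℝ) (A : Amb n →L[ℝ] Amb n) (z : ℝ) (g : Amb n)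
    (j : Jet n) : ℝ :=
  (c * ‖ContinuousLinearMap.adjoint A (j.grad z g)‖ ^ 2
    + κ * P (clamp (j.val z))) * |(1 + jLin n j).det|

lemma continuous_jetDensityAux (c κ : ℝ) {P : ℝ → ℝ} (hP : IsFlatPotential P) :
    Continuous fun q : (Amb n →L[ℝ] Amb n) × ℝ × Amb n × Jet n =>
      jetDensityAux c κ P q.1 q.2.1 q.2.2.1 q.2.2.2 := by
  unfold jetDensityAux Jet.grad Jet.val
  have hA : Continuous fun q : (Amb n →L[ℝ] Amb n) × ℝ × Amb n × Jet n =>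
      ContinuousLinearMap.adjoint q.1 :=
    (ContinuousLinearMap.adjoint : (Amb n →L[ℝ] Amb n) ≃ₗᵢ⋆[ℝ] _).continuous.comp continuous_fst
  have hz : Continuous fun q : (Amb n →L[ℝ] Amb n) × ℝ × Amb n × Jet n => q.2.1 :=
    continuous_snd.fst
  have hg : Continuous fun q : (Amb n →L[ℝ] Amb n) × ℝ × Amb n × Jet n => q.2.2.1 :=
    continuous_snd.snd.fst
  have hj : Continuous fun q : (Amb n →L[ℝ] Amb n) × ℝ × Amb n × Jet n => q.2.2.2 :=
    continuous_snd.snd.snd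
  have hb := continuous_const.add ((jFactor n).continuous.comp hj) (f := fun _ => (1 : ℝ))
  have h2 := ((hb.smul hg).add (hz.smul ((jFactorGrad n).continuous.comp hj))).add
    ((jShiftGrad n).continuous.comp hj)
  have h3 := (hb.mul hz).add ((jShift n).continuous.comp hj)
  have h4 := continuous_const.add ((jLin n).continuous.comp hj)
    (f := fun _ => (1 : Amb n →L[ℝ] Amb n))
  exact ((continuous_const.mul ((hA.clm_apply h2).norm.pow 2)).add
    (continuous_const.mul (hP.continuous.comp h3))).mul
      ((ContinuousLinearMap.continuous_det.comp h4).abs)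

lemma continuousAt_inverse_one_add {T : Amb n →L[ℝ] Amb n} (h : ‖T‖ < 1) :
    ContinuousAt (fun T : Amb n →L[ℝ] Amb n => Ring.inverse (1 + T)) T := by
  have h1 : ContinuousAt Ring.inverse (1 + T) := by
    have := NormedRing.inverse_continuousAt (Units.oneSub (-T) (by rwa [norm_neg]))
    rwa [Units.val_oneSub, sub_neg_eq_add] at this
  exact h1.comp (f := fun T : Amb n →L[ℝ] Amb n => 1 + T) (by fun_prop)

lemma continuousOn_jetDensity (c κ : ℝ) {P : ℝ → ℝ} (hP : IsFlatPotential P) (z : ℝ) (g : Amb n) :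
    ContinuousOn (jetDensity c κ P z g) (Metric.ball 0 1) := by
  intro j hj
  refine ContinuousAt.continuousWithinAt ?_
  have h1 : ContinuousAt (fun j : Jet n => Ring.inverse (1 + jLin n j)) j :=
    ContinuousAt.comp (f := fun j : Jet n => jLin n j)
      (g := fun T : Amb n →L[ℝ] Amb n => Ring.inverse (1 + T))
      (continuousAt_inverse_one_add (j.norm_lin_le.trans_lt (mem_ball_zero_iff.1 hj)))
      (jLin n).continuous.continuousAt
  have h2 : ContinuousAt (fun j : Jet n => (Ring.inverse (1 + jLin n j), z, g, j)) j :=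
    h1.prodMk (continuousAt_const.prodMk (continuousAt_const.prodMk continuousAt_id))
  exact ContinuousAt.comp (f := fun j : Jet n => (Ring.inverse (1 + jLin n j), z, g, j))
    (continuous_jetDensityAux c κ hP).continuousAt h2

/-- Inversion is continuous only near invertible maps, so the inverse is first formed as a
continuous function of `x`; the rest is the jointly continuous `jetDensityAux`. -/
lemma aestronglyMeasurable_jetDensity {μ : Measure (Amb n)} (hu : AEStronglyMeasurable u μ)
    (hG : AEStronglyMeasurable G μ) (c κ : ℝ) {P : ℝ → ℝ} (hP : IsFlatPotential P)
    {j : Amb n → Jet n} (hj : Continuous j) (hj1 : ∀ x, ‖j x‖ < 1) :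
    AEStronglyMeasurable (fun x => jetDensity c κ P (u x) (G x) (j x)) μ := by
  have h1 : Continuous fun x => Ring.inverse (1 + jLin n (j x)) := by
    refine continuous_iff_continuousAt.2 fun x => ?_
    exact ContinuousAt.comp (f := fun x => jLin n (j x))
      (g := fun T : Amb n →L[ℝ] Amb n => Ring.inverse (1 + T))
      (continuousAt_inverse_one_add ((j x).norm_lin_le.trans_lt (hj1 x)))
      ((jLin n).continuous.comp hj).continuousAt
  have h2 : AEStronglyMeasurable
      (fun x => (Ring.inverse (1 + jLin n (j x)), u x, G x, j x)) μ :=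
    AEStronglyMeasurable.prodMk h1.aestronglyMeasurable
      (hu.prodMk (hG.prodMk hj.aestronglyMeasurable))
  exact Continuous.comp_aestronglyMeasurable
    (g := fun q : (Amb n →L[ℝ] Amb n) × ℝ × Amb n × Jet n =>
      jetDensityAux c κ P q.1 q.2.1 q.2.2.1 q.2.2.2)
    (f := fun x => (Ring.inverse (1 + jLin n (j x)), u x, G x, j x))
    (continuous_jetDensityAux c κ hP) h2

lemma aestronglyMeasurable_jetVariation {μ : Measure (Amb n)} (hu : AEStronglyMeasurable u μ)
    (hG : AEStronglyMeasurable G μ) (c κ : ℝ) {P : ℝ → ℝ} (hP : IsFlatPotential P)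
    {j : Amb n → Jet n} (hj : Continuous j) :
    AEStronglyMeasurable (fun x => jetVariation c κ P (u x) (G x) (j x)) μ := by
  have htr : Continuous fun T : Amb n →L[ℝ] Amb n =>
      LinearMap.trace ℝ (Amb n) (T : Amb n →ₗ[ℝ] Amb n) :=
    (LinearMap.trace ℝ (Amb n) ∘ₗ ContinuousLinearMap.coeLM ℝ).continuous_of_finiteDimensional
  have h : Continuous fun q : ℝ × Amb n × Jet n => jetVariation c κ P q.1 q.2.1 q.2.2 := by
    unfold jetVariation
    have hz : Continuous fun q : ℝ × Amb n × Jet n => q.1 := continuous_fst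
    have hg : Continuous fun q : ℝ × Amb n × Jet n => q.2.1 := continuous_snd.fst
    have hj : Continuous fun q : ℝ × Amb n × Jet n => q.2.2 := continuous_snd.snd
    have hT := (jLin n).continuous.comp hj
    have hb := (jFactor n).continuous.comp hj
    have h5 := hg.inner (𝕜 := ℝ) ((((hb.smul hg).add
      (hz.smul ((jFactorGrad n).continuous.comp hj))).add
      ((jShiftGrad n).continuous.comp hj)).sub (hT.clm_apply hg))
    have h6 := (hb.mul hz).add ((jShift n).continuous.comp hj)
    exact ((continuous_const.mul (continuous_const.mul h5)).add
      (continuous_const.mul ((hP.continuous_deriv.comp hz).mul h6))).add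
      (((continuous_const.mul (hg.norm.pow 2)).add
        (continuous_const.mul (hP.continuous.comp hz))).mul (htr.comp hT))
  have h2 : AEStronglyMeasurable (fun x => (u x, G x, j x)) μ :=
    hu.prodMk (hG.prodMk hj.aestronglyMeasurable)
  exact Continuous.comp_aestronglyMeasurable
    (g := fun q : ℝ × Amb n × Jet n => jetVariation c κ P q.1 q.2.1 q.2.2)
    (f := fun x => (u x, G x, j x)) h h2

lemma IsW12loc.integrable_indicator_grad (hu : IsW12loc Ω u G) {K : Set (Amb n)}
    (hK : IsCompact K) (h : K ⊆ Ω) (C : ℝ) :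
    Integrable (K.indicator fun x => C * (1 + ‖G x‖) ^ 2) := by
  rw [integrable_indicator_iff hK.measurableSet]
  have : IsFiniteMeasure (volume.restrict K) := ⟨by simpa using hK.measure_lt_top⟩
  refine Integrable.const_mul ?_ C
  have h1 : MemLp (fun x => 1 + ‖G x‖) 2 (volume.restrict K) :=
    (memLp_const (1 : ℝ)).add (hu.memLp_grad K h hK).norm
  exact h1.integrable_sq

/-- Dominated differentiation of the integral of `jetDensity` along two jet fields. -/
lemma exists_hasFDerivAt_integral_jetDensity (hΩ : IsOpen Ω) (hu : IsW12loc Ω u G)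
    (hr : ∀ᵐ x ∂(volume.restrict Ω), u x ∈ Icc (0 : ℝ) 1) (c κ : ℝ) {P : ℝ → ℝ}
    (hP : IsFlatPotential P)
    (h0 : IntegrableOn (fun x => jetDensity c κ P (u x) (G x) 0) Ω)
    {j₁ j₂ : Amb n → Jet n} (h₁ : IsJetField Ω j₁) (h₂ : IsJetField Ω j₂) :
    ∃ ρ > 0,
      (∀ p : ℝ × ℝ, ‖p‖ ≤ ρ → IntegrableOn (fun x =>
        jetDensity c κ P (u x) (G x) (p.1 • j₁ x + p.2 • j₂ x)) Ω) ∧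
      ContinuousOn (fun p : ℝ × ℝ => ∫ x in Ω,
        jetDensity c κ P (u x) (G x) (p.1 • j₁ x + p.2 • j₂ x)) (Metric.closedBall 0 ρ) ∧
      IntegrableOn (fun x => jetVariation c κ P (u x) (G x) (j₁ x)) Ω ∧
      IntegrableOn (fun x => jetVariation c κ P (u x) (G x) (j₂ x)) Ω ∧
      HasFDerivAt (fun p : ℝ × ℝ => ∫ x in Ω,
        jetDensity c κ P (u x) (G x) (p.1 • j₁ x + p.2 • j₂ x))
        ((∫ x in Ω, jetVariation c κ P (u x) (G x) (j₁ x)) • ContinuousLinearMap.fst ℝ ℝ ℝ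
          + (∫ x in Ω, jetVariation c κ P (u x) (G x) (j₂ x)) • ContinuousLinearMap.snd ℝ ℝ ℝ)
        0 := by
  obtain ⟨C, r, hC0, hr0, hr1, hC⟩ := exists_jetDensity_sub_le (n := n) c κ hP
  obtain ⟨R₁, hR₁0, hR₁⟩ := h₁.exists_bound
  obtain ⟨R₂, hR₂0, hR₂⟩ := h₂.exists_bound
  obtain ⟨K₁, hK₁Ω, hK₁, hK₁0⟩ := h₁.supp
  obtain ⟨K₂, hK₂Ω, hK₂, hK₂0⟩ := h₂.supp
  set R := R₁ + R₂ + 1 with hR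
  have hRpos : 0 < R := by positivity
  let ρ := r / R
  have hρ : 0 < ρ := by positivity
  have hum := hu.aestronglyMeasurable_restrict hΩ
  have hGm := hu.aestronglyMeasurable_grad_restrict hΩ
  have hnorm : ∀ (p : ℝ × ℝ) x, ‖p.1 • j₁ x + p.2 • j₂ x‖ ≤ R * ‖p‖ := by
    intro p x
    calc ‖p.1 • j₁ x + p.2 • j₂ x‖ ≤ ‖p.1‖ * ‖j₁ x‖ + ‖p.2‖ * ‖j₂ x‖ := by
          refine (norm_add_le _ _).trans ?_
          rw [norm_smul, norm_smul]
      _ ≤ ‖p‖ * R₁ + ‖p‖ * R₂ := by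
          gcongr
          · exact norm_fst_le p
          · exact hR₁ x
          · exact norm_snd_le p
          · exact hR₂ x
      _ ≤ R * ‖p‖ := by
          rw [hR]
          nlinarith [norm_nonneg p]
  have hsmall : ∀ p : ℝ × ℝ, ‖p‖ ≤ ρ → ∀ x, ‖p.1 • j₁ x + p.2 • j₂ x‖ ≤ r := by
    intro p hp x
    refine (hnorm p x).trans ?_
    calc R * ‖p‖ ≤ R * (r / R) := by gcongr
      _ = r := by field_simp
  set K := K₁ ∪ K₂ with hK
  have hKΩ : K ⊆ Ω := union_subset hK₁Ω hK₂Ω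
  -- Off the supports of the jets nothing changes, so a bound on the compact `K`, integrable because
  -- `G` is locally square integrable, controls the increments over all of `Ω`.
  set bound : Amb n → ℝ := K.indicator fun x => C * R * (1 + ‖G x‖) ^ 2 with hbound
  have hbi : Integrable bound (volume.restrict Ω) :=
    (hu.integrable_indicator_grad (hK₁.union hK₂) hKΩ (C * R)).restrict
  have hmeas : ∀ p : ℝ × ℝ, ‖p‖ ≤ ρ → AEStronglyMeasurable (fun x =>
      jetDensity c κ P (u x) (G x) (p.1 • j₁ x + p.2 • j₂ x)) (volume.restrict Ω) := by
    intro p hp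
    refine aestronglyMeasurable_jetDensity hum hGm c κ hP
      ((h₁.cont.const_smul p.1).add (h₂.cont.const_smul p.2)) fun x => ?_
    exact (hsmall p hp x).trans_lt (by linarith)
  have hlip : ∀ᵐ x ∂(volume.restrict Ω), ∀ p : ℝ × ℝ, ‖p‖ ≤ ρ →
      |jetDensity c κ P (u x) (G x) (p.1 • j₁ x + p.2 • j₂ x)
        - jetDensity c κ P (u x) (G x) 0| ≤ bound x * ‖p‖ := by
    filter_upwards [hr] with x hx p hp
    by_cases hxK : x ∈ K
    · rw [hbound, indicator_of_mem hxK]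
      refine (hC _ hx (G x) _ (hsmall p hp x)).trans ?_
      calc C * (1 + ‖G x‖) ^ 2 * ‖p.1 • j₁ x + p.2 • j₂ x‖
          ≤ C * (1 + ‖G x‖) ^ 2 * (R * ‖p‖) := by gcongr; exact hnorm p x
        _ = C * R * (1 + ‖G x‖) ^ 2 * ‖p‖ := by ring
    · rw [hbound, indicator_of_notMem hxK, hK₁0 x fun h => hxK (Or.inl h),
        hK₂0 x fun h => hxK (Or.inr h)]
      simp
  have hbnn : ∀ x, 0 ≤ bound x := fun x => indicator_nonneg (fun _ _ => by positivity) x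
  have hdom : ∀ p : ℝ × ℝ, ‖p‖ ≤ ρ → ∀ᵐ x ∂(volume.restrict Ω),
      ‖jetDensity c κ P (u x) (G x) (p.1 • j₁ x + p.2 • j₂ x)‖
        ≤ bound x * ρ + ‖jetDensity c κ P (u x) (G x) 0‖ := by
    intro p hp
    filter_upwards [hlip] with x hx
    have h1 := hx p hp
    rw [← Real.norm_eq_abs] at h1
    have h2 := norm_sub_norm_le (jetDensity c κ P (u x) (G x) (p.1 • j₁ x + p.2 • j₂ x))
      (jetDensity c κ P (u x) (G x) 0)
    have h3 : bound x * ‖p‖ ≤ bound x * ρ := mul_le_mul_of_nonneg_left hp (hbnn x)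
    linarith
  have hdi : Integrable (fun x => bound x * ρ + ‖jetDensity c κ P (u x) (G x) 0‖)
      (volume.restrict Ω) := (hbi.mul_const ρ).add h0.norm
  have hdiff : ∀ x, HasFDerivAt
      (fun p : ℝ × ℝ => jetDensity c κ P (u x) (G x) (p.1 • j₁ x + p.2 • j₂ x))
      (jetVariation c κ P (u x) (G x) (j₁ x) • ContinuousLinearMap.fst ℝ ℝ ℝ
        + jetVariation c κ P (u x) (G x) (j₂ x) • ContinuousLinearMap.snd ℝ ℝ ℝ) 0 := by
    intro x
    obtain ⟨D, hD, hd⟩ := hasFDerivAt_jetDensity c κ hP (u x) (G x)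
    have h1 : HasFDerivAt (fun p : ℝ × ℝ => p.1 • j₁ x + p.2 • j₂ x)
        ((ContinuousLinearMap.fst ℝ ℝ ℝ).smulRight (j₁ x)
          + (ContinuousLinearMap.snd ℝ ℝ ℝ).smulRight (j₂ x)) 0 :=
      (hasFDerivAt_fst.smul_const (j₁ x)).add (hasFDerivAt_snd.smul_const (j₂ x))
    have h2 := HasFDerivAt.comp (0 : ℝ × ℝ) (f := fun p : ℝ × ℝ => p.1 • j₁ x + p.2 • j₂ x)
      (g := jetDensity c κ P (u x) (G x)) (g' := D) (by simpa using hd) h1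
    refine h2.congr_fderiv ?_
    have hD0 : jetVariation c κ P (u x) (G x) 0 = 0 := by rw [← hD, map_zero]
    ext <;> simp [hD, hD0]
  have hm₁ := aestronglyMeasurable_jetVariation hum hGm c κ hP h₁.cont
  have hm₂ := aestronglyMeasurable_jetVariation hum hGm c κ hP h₂.cont
  -- This criterion needs the increment bound from the base point only, which is what calmness at
  -- the trivial jet provides.
  have key := hasFDerivAt_integral_of_dominated_loc_of_lip' (𝕜 := ℝ)
    (μ := volume.restrict Ω) (x₀ := (0 : ℝ × ℝ)) (bound := bound)
    (F := fun (p : ℝ × ℝ) x => jetDensity c κ P (u x) (G x) (p.1 • j₁ x + p.2 • j₂ x))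
    (F' := fun x => jetVariation c κ P (u x) (G x) (j₁ x) • ContinuousLinearMap.fst ℝ ℝ ℝ
        + jetVariation c κ P (u x) (G x) (j₂ x) • ContinuousLinearMap.snd ℝ ℝ ℝ)
    (Metric.closedBall_mem_nhds (0 : ℝ × ℝ) hρ)
    (fun p hp => hmeas p (by simpa using hp))
    (by
      have h0' : Integrable (fun x => jetDensity c κ P (u x) (G x) 0) (volume.restrict Ω) := h0
      simpa using h0')
    ((hm₁.smul_const _).add (hm₂.smul_const _))
    (by
      filter_upwards [hlip] with x hx p hp
      have := hx p (by simpa using hp)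
      simpa using this) hbi (Eventually.of_forall hdiff)
  have hi₁ : IntegrableOn (fun x => jetVariation c κ P (u x) (G x) (j₁ x)) Ω := by
    have := key.1.apply_continuousLinearMap ((1, 0) : ℝ × ℝ)
    simp only [add_apply, smul_apply, ContinuousLinearMap.coe_fst', ContinuousLinearMap.coe_snd',
      smul_eq_mul, mul_one, mul_zero, add_zero] at this
    exact this
  have hi₂ : IntegrableOn (fun x => jetVariation c κ P (u x) (G x) (j₂ x)) Ω := by
    have := key.1.apply_continuousLinearMap ((0, 1) : ℝ × ℝ)
    simp only [add_apply, smul_apply, ContinuousLinearMap.coe_fst', ContinuousLinearMap.coe_snd',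
      smul_eq_mul, mul_one, mul_zero, zero_add] at this
    exact this
  refine ⟨ρ, hρ, fun p hp => hdi.mono' (hmeas p hp) (hdom p hp), ?_, hi₁, hi₂, ?_⟩
  · refine continuousOn_of_dominated (bound := fun x =>
      bound x * ρ + ‖jetDensity c κ P (u x) (G x) 0‖)
      (fun p hp => hmeas p (by simpa using hp)) (fun p hp => hdom p (by simpa using hp)) hdi
      (Eventually.of_forall fun x => ?_)
    refine (continuousOn_jetDensity c κ hP (u x) (G x)).comp
      (f := fun p : ℝ × ℝ => p.1 • j₁ x + p.2 • j₂ x) ?_ ?_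
    · exact Continuous.continuousOn (by fun_prop)
    · intro p hp
      rw [mem_ball_zero_iff]
      exact (hsmall p (by simpa using hp) x).trans_lt (by linarith)
  · refine key.2.congr_fderiv ?_
    rw [integral_add (hi₁.smul_const _) (hi₂.smul_const _), integral_smul_const,
      integral_smul_const]

end Variation

end ACPlateau

end

noncomputable section

namespace ACPlateau

/-! ### A one-sided Lagrange multiplier rule -/

section Lagrange

lemma exists_abs_sub_le_of_hasFDerivAt {F : ℝ × ℝ → ℝ} {a b : ℝ}
    (h : HasFDerivAt F (a • ContinuousLinearMap.fst ℝ ℝ ℝ + b • ContinuousLinearMap.snd ℝ ℝ ℝ) 0)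
    {κ : ℝ} (hκ : 0 < κ) :
    ∃ ρ > 0, ∀ s t, |s| ≤ ρ → |t| ≤ ρ →
      |F (s, t) - F 0 - (a * s + b * t)| ≤ κ * max |s| |t| := by
  have h1 := (hasFDerivAt_iff_isLittleO_nhds_zero.1 h).def hκ
  obtain ⟨ρ, hρ, hball⟩ := Metric.eventually_nhds_iff.1 h1
  refine ⟨ρ / 2, by positivity, fun s t hs ht => ?_⟩
  have := @hball (s, t) (by
    rw [dist_zero_right, Prod.norm_def, max_lt_iff, Real.norm_eq_abs, Real.norm_eq_abs]
    constructor <;> linarith)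
  simpa [Prod.norm_def] using this

/-- If `E` is minimal at the origin along the constraint `V = V 0`, `s ≥ 0`, and `∂ₜV ≠ 0`, then
`∂ₛE - (∂ₜE / ∂ₜV) ∂ₛV ≥ 0`. -/
lemma lagrange_nonneg {E V : ℝ × ℝ → ℝ} {e₁ e₂ v₁ v₂ r : ℝ} (hr : 0 < r)
    (hE : HasFDerivAt E (e₁ • ContinuousLinearMap.fst ℝ ℝ ℝ + e₂ • ContinuousLinearMap.snd ℝ ℝ ℝ) 0)
    (hV : HasFDerivAt V (v₁ • ContinuousLinearMap.fst ℝ ℝ ℝ + v₂ • ContinuousLinearMap.snd ℝ ℝ ℝ) 0)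
    (hVc : ContinuousOn V (Metric.closedBall 0 r)) (hv : v₂ ≠ 0)
    (hmin : ∀ s t, 0 ≤ s → s ≤ r → |t| ≤ r → V (s, t) = V 0 → E 0 ≤ E (s, t)) :
    0 ≤ e₁ - e₂ / v₂ * v₁ := by
  by_contra! hneg
  set L := e₁ - e₂ / v₂ * v₁ with hL
  -- The correction is sought as `t = s (θ - v₁/v₂)` with `|θ| ≤ η ≤ 1`; then `|t| ≤ s m`, and the
  -- linear part of the volume change is `s v₂ θ`.
  set m := |v₁ / v₂| + 1 with hm
  have hm1 : 1 ≤ m := by linarith [abs_nonneg (v₁ / v₂)]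
  -- the width of the window in which the constraint is solved
  set η := min 1 (-L / (4 * (|e₂| + 1))) with hη
  have hη0 : 0 < η := by
    refine lt_min one_pos (div_pos (by linarith) (by positivity))
  have hη1 : η ≤ 1 := min_le_left _ _
  have hηe : η * |e₂| ≤ -L / 4 := by
    have h1 : η ≤ -L / (4 * (|e₂| + 1)) := min_le_right _ _
    rw [le_div_iff₀ (by positivity)] at h1
    nlinarith [abs_nonneg e₂]
  -- The first bound lets the sign of `V - V 0` at `θ = ±η` follow the linear part; the second, with
  -- `η |e₂| ≤ -L/4`, leaves an energy change of at most `s L / 2 < 0`.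
  set κ := min (|v₂| * η / (2 * m)) (-L / (4 * m)) with hκ
  have hv' : 0 < |v₂| := abs_pos.2 hv
  have hκ0 : 0 < κ := lt_min (by positivity) (div_pos (by linarith) (by positivity))
  have hκm1 : κ * m ≤ |v₂| * η / 2 := by
    have h1 : κ ≤ |v₂| * η / (2 * m) := min_le_left _ _
    rw [le_div_iff₀ (by positivity)] at h1
    linarith
  have hκm2 : κ * m ≤ -L / 4 := by
    have h1 : κ ≤ -L / (4 * m) := min_le_right _ _
    rw [le_div_iff₀ (by positivity)] at h1
    linarith
  obtain ⟨ρ₁, hρ₁, hE'⟩ := exists_abs_sub_le_of_hasFDerivAt hE hκ0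
  obtain ⟨ρ₂, hρ₂, hV'⟩ := exists_abs_sub_le_of_hasFDerivAt hV hκ0
  set s := min r (min ρ₁ ρ₂) / m with hs
  have hs0 : 0 < s := div_pos (lt_min hr (lt_min hρ₁ hρ₂)) (by linarith)
  have hsm : s * m = min r (min ρ₁ ρ₂) := by
    rw [hs]
    field_simp
  have hsmr : s * m ≤ r := hsm.le.trans (min_le_left _ _)
  have hsm1 : s * m ≤ ρ₁ := hsm.le.trans ((min_le_right _ _).trans (min_le_left _ _))
  have hsm2 : s * m ≤ ρ₂ := hsm.le.trans ((min_le_right _ _).trans (min_le_right _ _))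
  have hssm : s ≤ s * m := le_mul_of_one_le_right hs0.le hm1
  have habs : |s| = s := abs_of_pos hs0
  have ht : ∀ θ, |θ| ≤ η → |s * (θ - v₁ / v₂)| ≤ s * m := by
    intro θ hθ
    rw [abs_mul, habs]
    gcongr
    have := abs_sub θ (v₁ / v₂)
    linarith
  have hmax : ∀ θ, |θ| ≤ η → max |s| |s * (θ - v₁ / v₂)| ≤ s * m := fun θ hθ =>
    max_le (by rwa [habs]) (ht θ hθ)
  have hVθ : ∀ θ, |θ| ≤ η →
      |V (s, s * (θ - v₁ / v₂)) - V 0 - s * v₂ * θ| ≤ s * (|v₂| * η / 2) := by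
    intro θ hθ
    have h1 := hV' s (s * (θ - v₁ / v₂)) (by rw [habs]; linarith) ((ht θ hθ).trans hsm2)
    have h2 : v₁ * s + v₂ * (s * (θ - v₁ / v₂)) = s * v₂ * θ := by
      field_simp
      ring
    rw [h2] at h1
    refine h1.trans ?_
    calc κ * max |s| |s * (θ - v₁ / v₂)| ≤ κ * (s * m) := by gcongr; exact hmax θ hθ
      _ = s * (κ * m) := by ring
      _ ≤ s * (|v₂| * η / 2) := by gcongr
  -- solve the constraint by the intermediate value theorem
  have hcont : ContinuousOn (fun θ => V (s, s * (θ - v₁ / v₂))) (Icc (-η) η) := by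
    refine hVc.comp (f := fun θ : ℝ => (s, s * (θ - v₁ / v₂)))
      (Continuous.continuousOn (by fun_prop)) fun θ hθ => ?_
    rw [mem_closedBall_zero_iff, Prod.norm_def, Real.norm_eq_abs, Real.norm_eq_abs]
    exact (hmax θ (abs_le.2 hθ)).trans hsmr
  -- Continuity near the origin and opposite signs at `±η` suffice; an implicit function theorem
  -- would need `V` to be `C¹`.
  obtain ⟨θ, hθ, hθV⟩ : ∃ θ ∈ Icc (-η) η, V (s, s * (θ - v₁ / v₂)) = V 0 := by
    have hp := abs_le.1 (hVθ η (abs_of_pos hη0).le)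
    have hn := abs_le.1 (hVθ (-η) (by rw [abs_neg]; exact (abs_of_pos hη0).le))
    have hle : -η ≤ η := by linarith
    rcases lt_or_gt_of_ne hv with hneg' | hpos
    · have e : |v₂| = -v₂ := abs_of_neg hneg'
      rw [e] at hp hn
      refine intermediate_value_Icc' hle hcont ⟨?_, ?_⟩
      · nlinarith [mul_pos hs0 (mul_pos (neg_pos.2 hneg') hη0)]
      · nlinarith [mul_pos hs0 (mul_pos (neg_pos.2 hneg') hη0)]
    · have e : |v₂| = v₂ := abs_of_pos hpos
      rw [e] at hp hn
      refine intermediate_value_Icc hle hcont ⟨?_, ?_⟩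
      · nlinarith [mul_pos hs0 (mul_pos hpos hη0)]
      · nlinarith [mul_pos hs0 (mul_pos hpos hη0)]
  have hθ' : |θ| ≤ η := abs_le.2 hθ
  have h1 := hmin s (s * (θ - v₁ / v₂)) hs0.le (hssm.trans hsmr) ((ht θ hθ').trans hsmr) hθV
  have h2 := hE' s (s * (θ - v₁ / v₂)) (by rw [habs]; linarith) ((ht θ hθ').trans hsm1)
  have h3 : e₁ * s + e₂ * (s * (θ - v₁ / v₂)) = s * (L + e₂ * θ) := by
    rw [hL]
    field_simp
    ring
  rw [h3] at h2
  have h4 : κ * max |s| |s * (θ - v₁ / v₂)| ≤ s * (-L / 4) := by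
    calc κ * max |s| |s * (θ - v₁ / v₂)| ≤ κ * (s * m) := by gcongr; exact hmax θ hθ'
      _ = s * (κ * m) := by ring
      _ ≤ s * (-L / 4) := by gcongr
  have h5 : e₂ * θ ≤ -L / 4 := by
    calc e₂ * θ ≤ |e₂ * θ| := le_abs_self _
      _ = |θ| * |e₂| := by rw [abs_mul, mul_comm]
      _ ≤ η * |e₂| := by gcongr
      _ ≤ -L / 4 := hηe
  have h6 := (abs_le.1 h2).2
  have h7 : s * (L + e₂ * θ) ≤ s * (L - L / 4) := by
    gcongr
    linarith
  nlinarith [mul_pos hs0 (neg_pos.2 hneg)]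

end Lagrange

end ACPlateau

end

noncomputable section

namespace ACPlateau

/-! ### Competitors -/

section Competitors

variable {n : ℕ} {Ω : Set (Amb n)} {u : Amb n → ℝ} {G : Amb n → Amb n}

/-- The jet field of the perturbation `(1 + b) u + a` transported by `id + X`. -/
def jetField (X : Amb n → Amb n) (a b : Amb n → ℝ) (x : Amb n) : Jet n :=
  Jet.mk (fderiv ℝ X x) (a x) (b x) (gradient a x) (gradient b x)

lemma isJetField_jetField {X : Amb n → Amb n} {a b : Amb n → ℝ} (hX : IsTest Ω X)
    (ha : IsTest Ω a) (hb : IsTest Ω b) : IsJetField Ω (jetField X a b) where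
  cont := continuous_jet_mk hX.continuous_fderiv ha.smooth.continuous hb.smooth.continuous
    (continuous_gradient ha.smooth) (continuous_gradient hb.smooth)
  supp := by
    refine ⟨tsupport X ∪ tsupport a ∪ tsupport b, union_subset (union_subset hX.support ha.support)
      hb.support, (hX.compact.isCompact.union ha.compact.isCompact).union hb.compact.isCompact,
      fun x hx => ?_⟩
    simp only [mem_union, not_or] at hx
    obtain ⟨⟨h1, h2⟩, h3⟩ := hx
    unfold jetField
    rw [fderiv_eq_zero_of_notMem_tsupport h1, image_eq_zero_of_notMem_tsupport h2,
      image_eq_zero_of_notMem_tsupport h3,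
      gradient_eq_zero_of_fderiv (fderiv_eq_zero_of_notMem_tsupport h2),
      gradient_eq_zero_of_fderiv (fderiv_eq_zero_of_notMem_tsupport h3), Jet.mk_zero]

lemma gradient_lincomb {a a₀ : Amb n → ℝ} (ha : Differentiable ℝ a) (ha₀ : Differentiable ℝ a₀)
    (s t : ℝ) (x : Amb n) :
    gradient (fun x => s * a x + t * a₀ x) x = s • gradient a x + t • gradient a₀ x := by
  unfold gradient
  have h := ((ha x).hasFDerivAt.const_mul s).add ((ha₀ x).hasFDerivAt.const_mul t)
  have h' : HasFDerivAt (fun x => s * a x + t * a₀ x) _ x := h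
  rw [h'.fderiv, map_add, map_smulₛₗ, map_smulₛₗ]
  rfl

/-- Linearity in `(s, t)` identifies the two-parameter family of competitors with the family of jets
whose integrals are differentiated. The correcting direction carries no displacement, so the
diffeomorphism depends on `s` alone. -/
lemma jetField_lincomb {X : Amb n → Amb n} {a b a₀ b₀ : Amb n → ℝ} (hX : IsTest Ω X)
    (ha : IsTest Ω a) (hb : IsTest Ω b) (ha₀ : IsTest Ω a₀) (hb₀ : IsTest Ω b₀) (s t : ℝ)
    (x : Amb n) :
    jetField (fun x => s • X x) (fun x => s * a x + t * a₀ x) (fun x => s * b x + t * b₀ x) x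
      = s • jetField X a b x + t • jetField (fun _ => 0) a₀ b₀ x := by
  unfold jetField
  rw [gradient_lincomb ha.differentiable ha₀.differentiable,
    gradient_lincomb hb.differentiable hb₀.differentiable]
  have h : fderiv ℝ (fun x => s • X x) x = s • fderiv ℝ X x + t • 0 := by
    have h1 : HasFDerivAt (fun x => s • X x) (s • fderiv ℝ X x) x :=
      (hX.differentiable x).hasFDerivAt.const_smul s
    rw [h1.fderiv]
    ext1 y
    simp
  have h0 : fderiv ℝ (fun _ : Amb n => (0 : Amb n)) x = 0 := by simp
  rw [h, h0]
  rfl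

lemma IsDiffeo.fderiv_symm_eq_inverse {f : Amb n ≃ₜ Amb n} (hf : IsDiffeo f) (x : Amb n) :
    fderiv ℝ f.symm (f x) = Ring.inverse (fderiv ℝ f x) := by
  have h1 : fderiv ℝ f.symm (f x) * fderiv ℝ f x = 1 := hf.fderiv_comp_symm x
  have h2 : fderiv ℝ f x * fderiv ℝ f.symm (f x) = 1 := by
    have := hf.symm.fderiv_comp_symm (f x)
    rw [f.symm_symm, f.symm_apply_apply] at this
    exact this
  have := Ring.inverse_unit (⟨fderiv ℝ f x, fderiv ℝ f.symm (f x), h2, h1⟩ :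
    (Amb n →L[ℝ] Amb n)ˣ)
  exact this.symm

lemma IsDiffeo.lintegral_comp {f : Amb n ≃ₜ Amb n} (hf : IsDiffeo f) (hΩ : IsOpen Ω)
    (hfΩ : ∀ x, f x ∈ Ω ↔ x ∈ Ω) (F : Amb n → ℝ≥0∞) :
    ∫⁻ y in Ω, F y = ∫⁻ x in Ω, ENNReal.ofReal |(fderiv ℝ f x).det| * F (f x) := by
  have h : f '' Ω = Ω := by
    ext y
    constructor
    · rintro ⟨x, hx, rfl⟩
      exact (hfΩ x).2 hx
    · intro hy
      refine ⟨f.symm y, ?_, f.apply_symm_apply y⟩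
      rwa [← hfΩ, f.apply_symm_apply]
  conv_lhs => rw [← h]
  exact lintegral_image_eq_lintegral_abs_det_fderiv_mul volume hΩ.measurableSet
    (fun x _ => (hf.hasFDerivAt x).hasFDerivWithinAt) f.injective.injOn F

/-- A constrained perturbation of a minimizer does not have smaller energy. -/
lemma IsMinimizer.energy_le {W : ℝ → ℝ} (hn : 1 ≤ n) (hW : IsDoubleWell W) (hΩ : IsOpen Ω)
    {C : Set (UnitAddCircle → Amb n)} {v ε δ : ℝ} (hε : 0 < ε)
    (hu : IsMinimizer W Ω C v ε δ u G) {Y : Amb n → Amb n} {a b : Amb n → ℝ} (hY : IsTest Ω Y)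
    (ha : IsTest Ω a) (hb : IsTest Ω b) {f : Amb n ≃ₜ Amb n} (hf : ∀ x, f x = x + Y x)
    (hfd : IsDiffeo f) (hfL : LipschitzWith 2 f) (hfΩ : ∀ x, f x ∈ Ω ↔ x ∈ Ω)
    (hfC : ∀ γ ∈ C, (fun θ => f.symm (γ θ)) ∈ C)
    (hEi : IntegrableOn (fun x => jetDensity ε ε⁻¹ W (u x) (G x) (jetField Y a b x)) Ω)
    (hVi : IntegrableOn (fun x => jetDensity 0 1 (volPot n W) (u x) (G x) (jetField Y a b x)) Ω)
    (hv : ∫ x in Ω, jetDensity 0 1 (volPot n W) (u x) (G x) (jetField Y a b x) = v)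
    (hsp : ∀ τ ∈ Ioo (1 / 2 : ℝ) δ, τ ≤ 1 ∧ ∃ τ' ∈ Ioo (1 / 2 : ℝ) δ, ∀ x ∈ Ω, ∀ ℓ,
      HasApproxLim Ω u x ℓ → τ' ≤ ℓ → τ ≤ (1 + b x) * ℓ + a x) :
    acEnergy W ε Ω u G
      ≤ ENNReal.ofReal (∫ x in Ω, jetDensity ε ε⁻¹ W (u x) (G x) (jetField Y a b x)) := by
  have hWf := hW.isFlatPotential
  have hVf := hW.isFlatPotential_volPot hn
  set w : Amb n → ℝ := fun x => (1 + b x) * u x + a x with hw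
  set gw : Amb n → Amb n := fun x => (1 + b x) • G x + u x • gradient b x + gradient a x with hgw
  have hgb : ∀ x, gradient (fun x => 1 + b x) x = gradient b x := fun x => by
    unfold gradient
    rw [fderiv_const_add]
  have hwS : IsW12loc Ω w gw := by
    have h := (hu.competitor.sobolev.smul_smooth (b := fun x => 1 + b x)
      (contDiff_const.add hb.smooth)).add (isW12loc_smooth (Ω := Ω) ha.smooth)
    simp only [hgb] at h
    exact h
  -- Competitors must take values in `[0,1]`. Since `jetDensity` evaluates the potential at the
  -- clamped value, truncation leaves the volume identity exact.
  obtain ⟨c, hc, hcS⟩ := hwS.clamp hΩ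
  have hsymm : ∀ x ∈ Ω, f.symm x ∈ Ω := fun x hx => by
    rw [← hfΩ, Homeomorph.apply_symm_apply]
    exact hx
  have hS := hcS.comp_diffeo hΩ hfd (image_subset_iff.2 hsymm)
  have hdf : ∀ x, fderiv ℝ f x = 1 + jLin n (jetField Y a b x) := by
    intro x
    have h1 : (f : Amb n → Amb n) = fun x => x + Y x := funext hf
    rw [h1]
    exact ((hasFDerivAt_id x).add (hY.differentiable x).hasFDerivAt).fderiv
  have hval : ∀ x, (jetField Y a b x).val (u x) = w x := fun x => rfl
  have hgrad : ∀ x, (jetField Y a b x).grad (u x) (G x) = gw x := fun x => rfl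
  have hcomp : IsCompetitor W Ω C v δ (fun y => clamp (w (f.symm y)))
      (fun y => (fderiv ℝ f.symm y).adjoint (c (f.symm y) • gw (f.symm y))) := by
    refine ⟨hS, Eventually.of_forall fun x => clamp_mem _, ?_, fun τ hτ => ?_⟩
    · rw [hfd.lintegral_comp hΩ hfΩ, ← hv, ofReal_integral_eq_lintegral_ofReal hVi
        (Eventually.of_forall fun x => ?_)]
      · refine lintegral_congr fun x => ?_
        rw [← ENNReal.ofReal_mul (abs_nonneg _), f.symm_apply_apply, hdf]
        congr 1
        rw [jetDensity, hval]
        ring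
      · change 0 ≤ jetDensity _ _ _ _ _ _
        rw [jetDensity, zero_mul, zero_add, one_mul]
        exact mul_nonneg (hVf.nonneg _ (clamp_mem _)) (abs_nonneg _)
    -- The level `τ'` of `u` is carried into the level `τ` of the competitor; truncation at `1` is
    -- harmless because `τ ≤ 1`.
    · obtain ⟨hτ1, τ', hτ', h⟩ := hsp τ hτ
      refine ((hu.competitor.spanning τ' hτ').image hfd hfL hsymm hfC).mono ?_
      refine image_superlevel_subset hΩ hu.competitor.range hfd hfΩ
        (Ψ := fun p => clamp ((1 + b p.1) * p.2 + a p.1)) ?_ fun x hx ℓ hℓ hτℓ => ?_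
      · have h1 := hb.smooth.continuous
        have h2 := ha.smooth.continuous
        refine continuous_clamp.comp ?_
        fun_prop
      · have h1 := h x hx ℓ hℓ hτℓ
        unfold clamp
        exact le_max_of_le_right (le_min h1 hτ1)
  have hle : acEnergy W ε Ω u G ≤ acEnergy W ε Ω (fun y => clamp (w (f.symm y)))
      (fun y => (fderiv ℝ f.symm y).adjoint (c (f.symm y) • gw (f.symm y))) := by
    have h1 : Upsilon W Ω C v ε δ ≤ acEnergy W ε Ω (fun y => clamp (w (f.symm y)))
      (fun y => (fderiv ℝ f.symm y).adjoint (c (f.symm y) • gw (f.symm y))) / 2 :=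
      (iInf_le _ _).trans ((iInf_le _ _).trans (iInf_le _ hcomp))
    rw [← hu.attains] at h1
    rwa [ENNReal.div_le_iff_le_mul (by simp) (by simp),
      ENNReal.div_mul_cancel (by simp) (by simp)] at h1
  refine hle.trans ?_
  rw [acEnergy, hfd.lintegral_comp hΩ hfΩ, ofReal_integral_eq_lintegral_ofReal hEi
    (Eventually.of_forall fun x => ?_)]
  · refine lintegral_mono fun x => ?_
    simp only
    rw [← ENNReal.ofReal_mul (abs_nonneg _)]
    refine ENNReal.ofReal_le_ofReal ?_
    rw [jetDensity, hval, hgrad, acDensity, f.symm_apply_apply, hfd.fderiv_symm_eq_inverse, ← hdf,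
      mul_comm, div_eq_inv_mul, map_smul, norm_smul, mul_pow]
    gcongr
    -- Only an inequality is available here: truncation multiplies the gradient by a factor of
    -- modulus at most `1`.
    refine mul_le_of_le_one_left (by positivity) ?_
    rw [Real.norm_eq_abs, sq_abs]
    exact (sq_le_one_iff_abs_le_one _).2 (hc x)
  · change 0 ≤ jetDensity _ _ _ _ _ _
    rw [jetDensity]
    have := hWf.nonneg _ (clamp_mem ((jetField Y a b x).val (u x)))
    positivity

end Competitors

end ACPlateau

end

noncomputable section

namespace ACPlateau

/-! ### First variation inequalities -/

section FirstVariation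

variable {n : ℕ} {Ω : Set (Amb n)} {u : Amb n → ℝ} {G : Amb n → Amb n} {W : ℝ → ℝ}

/-- The first variation of the energy. -/
def energyVar (W : ℝ → ℝ) (Ω : Set (Amb n)) (ε : ℝ) (u : Amb n → ℝ) (G : Amb n → Amb n)
    (X : Amb n → Amb n) (a b : Amb n → ℝ) : ℝ :=
  ∫ x in Ω, jetVariation ε ε⁻¹ W (u x) (G x) (jetField X a b x)

/-- The first variation of the volume. -/
def volVar (W : ℝ → ℝ) (Ω : Set (Amb n)) (u : Amb n → ℝ) (G : Amb n → Amb n)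
    (X : Amb n → Amb n) (a b : Amb n → ℝ) : ℝ :=
  ∫ x in Ω, jetVariation 0 1 (volPot n W) (u x) (G x) (jetField X a b x)

lemma jetDensity_nonneg {c κ : ℝ} (hc : 0 ≤ c) (hκ : 0 ≤ κ) {P : ℝ → ℝ} (hP : IsFlatPotential P)
    (z : ℝ) (g : Amb n) (j : Jet n) : 0 ≤ jetDensity c κ P z g j := by
  rw [jetDensity]
  have := hP.nonneg _ (clamp_mem (j.val z))
  positivity

/-- Finiteness of the energy turns the extended integral into a real one of `jetDensity` at the
trivial jet, the base point of the differentiation. -/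
lemma IsMinimizer.energy_density (hW : IsDoubleWell W) (hΩ : IsOpen Ω)
    {C : Set (UnitAddCircle → Amb n)} {v ε δ : ℝ} (hε : 0 < ε)
    (hu : IsMinimizer W Ω C v ε δ u G) :
    IntegrableOn (fun x => jetDensity ε ε⁻¹ W (u x) (G x) 0) Ω ∧
      acEnergy W ε Ω u G = ENNReal.ofReal (∫ x in Ω, jetDensity ε ε⁻¹ W (u x) (G x) 0) := by
  have hWf := hW.isFlatPotential
  have hum := hu.competitor.sobolev.aestronglyMeasurable_restrict hΩ
  have hGm := hu.competitor.sobolev.aestronglyMeasurable_grad_restrict hΩ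
  have hm : AEStronglyMeasurable (fun x => jetDensity ε ε⁻¹ W (u x) (G x) 0) (volume.restrict Ω) :=
    aestronglyMeasurable_jetDensity hum hGm ε ε⁻¹ hWf continuous_const fun x => by simp
  have hnn : ∀ x, 0 ≤ jetDensity ε ε⁻¹ W (u x) (G x) 0 := fun x =>
    jetDensity_nonneg hε.le (inv_nonneg.2 hε.le) hWf _ _ _
  have he : acEnergy W ε Ω u G
      = ∫⁻ x in Ω, ENNReal.ofReal (jetDensity ε ε⁻¹ W (u x) (G x) 0) := by
    refine lintegral_congr_ae ?_
    filter_upwards [hu.competitor.range] with x hx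
    rw [jetDensity_zero, acDensity, clamp_of_mem hx, div_eq_inv_mul]
  have hi : IntegrableOn (fun x => jetDensity ε ε⁻¹ W (u x) (G x) 0) Ω := by
    refine ⟨hm, ?_⟩
    rw [hasFiniteIntegral_iff_ofReal (Eventually.of_forall hnn), ← he]
    exact lt_top_iff_ne_top.2 hu.finite
  exact ⟨hi, by rw [he, ofReal_integral_eq_lintegral_ofReal hi (Eventually.of_forall hnn)]⟩

lemma IsMinimizer.volume_density (hn : 1 ≤ n) (hW : IsDoubleWell W) (hΩ : IsOpen Ω)
    {C : Set (UnitAddCircle → Amb n)} {v ε δ : ℝ} (hv : 0 < v)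
    (hu : IsMinimizer W Ω C v ε δ u G) :
    IntegrableOn (fun x => jetDensity 0 1 (volPot n W) (u x) (G x) 0) Ω ∧
      ∫ x in Ω, jetDensity 0 1 (volPot n W) (u x) (G x) 0 = v := by
  have hVf := hW.isFlatPotential_volPot hn
  have hum := hu.competitor.sobolev.aestronglyMeasurable_restrict hΩ
  have hGm := hu.competitor.sobolev.aestronglyMeasurable_grad_restrict hΩ
  have hm : AEStronglyMeasurable (fun x => jetDensity 0 1 (volPot n W) (u x) (G x) 0)
      (volume.restrict Ω) :=
    aestronglyMeasurable_jetDensity hum hGm 0 1 hVf continuous_const fun x => by simp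
  have hnn : ∀ x, 0 ≤ jetDensity 0 1 (volPot n W) (u x) (G x) 0 := fun x =>
    jetDensity_nonneg le_rfl zero_le_one hVf _ _ _
  have he : ∫⁻ x in Ω, ENNReal.ofReal (jetDensity 0 1 (volPot n W) (u x) (G x) 0)
      = ENNReal.ofReal v := by
    rw [← hu.competitor.volume_eq]
    refine lintegral_congr_ae ?_
    filter_upwards [hu.competitor.range] with x hx
    rw [jetDensity_zero, clamp_of_mem hx, zero_mul, zero_add, one_mul]
  refine ⟨⟨hm, ?_⟩, ?_⟩
  · rw [hasFiniteIntegral_iff_ofReal (Eventually.of_forall hnn), he]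
    exact ENNReal.ofReal_lt_top
  · rw [integral_eq_lintegral_of_nonneg_ae (Eventually.of_forall hnn) hm, he,
      ENNReal.toReal_ofReal hv.le]

/-- The first variation inequality at a minimizer, in admissible directions. -/
lemma IsMinimizer.variation_nonneg (hn : 1 ≤ n) (hW : IsDoubleWell W) (hΩ : IsOpen Ω)
    {C : Set (UnitAddCircle → Amb n)} (hC : IsSpanningClass Ω C) {v ε δ : ℝ} (hv : 0 < v)
    (hε : 0 < ε) (hδ : δ ≤ 1) (hu : IsMinimizer W Ω C v ε δ u G) {a₀ b₀ : Amb n → ℝ}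
    (ha₀ : IsTest Ω a₀) (hb₀ : IsTest Ω b₀) (hne : volVar W Ω u G (fun _ => 0) a₀ b₀ ≠ 0)
    {X : Amb n → Amb n} {a b : Amb n → ℝ} (hX : IsTest Ω X) (ha : IsTest Ω a) (hb : IsTest Ω b)
    (hadm : ∃ r > 0, ∀ s t, 0 ≤ s → s ≤ r → |t| ≤ r → ∀ τ ∈ Ioo (1 / 2 : ℝ) δ,
      ∃ τ' ∈ Ioo (1 / 2 : ℝ) δ, ∀ x ∈ Ω, ∀ ℓ, HasApproxLim Ω u x ℓ → τ' ≤ ℓ →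
        τ ≤ (1 + (s * b x + t * b₀ x)) * ℓ + (s * a x + t * a₀ x)) :
    0 ≤ energyVar W Ω ε u G X a b
      - energyVar W Ω ε u G (fun _ => 0) a₀ b₀ / volVar W Ω u G (fun _ => 0) a₀ b₀
        * volVar W Ω u G X a b := by
  have hWf := hW.isFlatPotential
  have hVf := hW.isFlatPotential_volPot hn
  obtain ⟨hE0, hE⟩ := hu.energy_density hW hΩ hε
  obtain ⟨hV0, hV⟩ := hu.volume_density hn hW hΩ hv
  have hj₁ := isJetField_jetField hX ha hb
  have hj₂ := isJetField_jetField (isTest_zero (Ω := Ω) (F := Amb n)) ha₀ hb₀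
  obtain ⟨ρ₁, hρ₁, hi₁, -, -, -, hd₁⟩ := exists_hasFDerivAt_integral_jetDensity hΩ
    hu.competitor.sobolev hu.competitor.range ε ε⁻¹ hWf hE0 hj₁ hj₂
  obtain ⟨ρ₂, hρ₂, hi₂, hc₂, -, -, hd₂⟩ := exists_hasFDerivAt_integral_jetDensity hΩ
    hu.competitor.sobolev hu.competitor.range 0 1 hVf hV0 hj₁ hj₂
  obtain ⟨r, hr, hadm⟩ := hadm
  obtain ⟨s₀, hs₀, hdiff⟩ := hC.exists_diffeo hX
  have hρ : 0 < min (min ρ₁ ρ₂) (min r s₀) := lt_min (lt_min hρ₁ hρ₂) (lt_min hr hs₀)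
  refine lagrange_nonneg hρ hd₁ hd₂ (hc₂.mono (Metric.closedBall_subset_closedBall
    ((min_le_left _ _).trans (min_le_right _ _)))) hne fun s t hs0 hs ht hVst => ?_
  have hsr : s ≤ r := hs.trans ((min_le_right _ _).trans (min_le_left _ _))
  have htr : |t| ≤ r := ht.trans ((min_le_right _ _).trans (min_le_left _ _))
  have hnorm : ‖((s, t) : ℝ × ℝ)‖ ≤ min ρ₁ ρ₂ := by
    rw [Prod.norm_def, Real.norm_eq_abs, Real.norm_eq_abs, abs_of_nonneg hs0]
    exact max_le (hs.trans (min_le_left _ _)) (ht.trans (min_le_left _ _))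
  obtain ⟨f, hf, hfd, hfL, hfΩ, hfC⟩ := hdiff s (by
    rw [abs_of_nonneg hs0]
    exact hs.trans ((min_le_right _ _).trans (min_le_right _ _)))
  have hcomb := jetField_lincomb hX ha hb ha₀ hb₀ s t
  have hEi := hi₁ (s, t) (hnorm.trans (min_le_left _ _))
  have hVi := hi₂ (s, t) (hnorm.trans (min_le_right _ _))
  have h0 : ∀ x, (0 : ℝ × ℝ).1 • jetField X a b x + (0 : ℝ × ℝ).2 • jetField (fun _ => 0) a₀ b₀ x
      = 0 := fun x => by simp
  simp only [h0] at hVst ⊢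
  simp only [← hcomb] at hEi hVi hVst ⊢
  have key := hu.energy_le hn hW hΩ hε (hX.const_smul s) ((ha.const_mul s).add (ha₀.const_mul t))
    ((hb.const_mul s).add (hb₀.const_mul t)) hf hfd hfL hfΩ hfC hEi hVi (hVst.trans hV)
    fun τ hτ => ⟨hτ.2.le.trans hδ, hadm s t hs0 hsr htr τ hτ⟩
  rw [hE] at key
  exact (ENNReal.ofReal_le_ofReal_iff (integral_nonneg fun x =>
    jetDensity_nonneg hε.le (inv_nonneg.2 hε.le) hWf _ _ _)).1 key

end FirstVariation

end ACPlateau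

end

noncomputable section

namespace ACPlateau

/-! ### Admissible directions and the multiplier -/

section Multiplier

variable {n : ℕ} {Ω : Set (Amb n)} {u : Amb n → ℝ} {G : Amb n → Amb n} {W : ℝ → ℝ}

lemma IsTest.exists_abs_le {φ : Amb n → ℝ} (h : IsTest Ω φ) : ∃ R, 0 ≤ R ∧ ∀ x, |φ x| ≤ R := by
  obtain ⟨R, hR⟩ := h.compact.exists_bound_of_continuous h.smooth.continuous
  exact ⟨R, (norm_nonneg _).trans (hR 0), hR⟩

/-- A direction which is nonnegative at level `δ`, except possibly where `u` exceeds `δ`, preserves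
the spanning condition. -/
lemma exists_admissible {δ c : ℝ} (hc : δ < c) {φ₀ a b : Amb n → ℝ} (hφ₀ : IsTest Ω φ₀)
    (ha : IsTest Ω a) (hb : IsTest Ω b)
    (hab : ∀ x ∈ Ω, ∀ ℓ, HasApproxLim Ω u x ℓ → 0 ≤ a x + δ * b x ∨ c ≤ ℓ) :
    ∃ r > 0, ∀ s t, 0 ≤ s → s ≤ r → |t| ≤ r → ∀ τ ∈ Ioo (1 / 2 : ℝ) δ,
      ∃ τ' ∈ Ioo (1 / 2 : ℝ) δ, ∀ x ∈ Ω, ∀ ℓ, HasApproxLim Ω u x ℓ → τ' ≤ ℓ →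
        τ ≤ (1 + (s * b x + t * (-φ₀ x))) * ℓ + (s * a x + t * (δ * φ₀ x)) := by
  obtain ⟨R₀, hR₀0, hR₀⟩ := hφ₀.exists_abs_le
  obtain ⟨R₁, hR₁0, hR₁⟩ := hb.exists_abs_le
  obtain ⟨R₂, hR₂0, hR₂⟩ := ((ha.add (hb.const_mul δ))).exists_abs_le
  set R := R₀ + R₁ + R₂ + 1 with hR
  have hR1 : 1 ≤ R := by linarith
  refine ⟨min (1 / (2 * R)) ((c - δ) / (2 * R)), lt_min (by positivity)
    (div_pos (by linarith) (by positivity)), fun s t hs0 hs ht τ hτ => ?_⟩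
  -- The factor `1 + B` is at most `3/2`, so a deficit `δ - ℓ ≤ (2/3)(δ - τ)` grows to at most `δ -
  -- τ`. The radius is independent of `τ`, as all levels must be handled at once.
  refine ⟨δ - 2 / 3 * (δ - τ), ⟨by linarith [hτ.1, hτ.2], by linarith [hτ.2]⟩,
    fun x hx ℓ hℓ hτℓ => ?_⟩
  have hs1 : s * R ≤ 1 / 2 := by
    have h := hs.trans (min_le_left _ _)
    rw [le_div_iff₀ (by positivity)] at h
    linarith
  have hs2 : s * R ≤ (c - δ) / 2 := by
    have h := hs.trans (min_le_right _ _)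
    rw [le_div_iff₀ (by positivity)] at h
    linarith
  have ht1 : |t| * R ≤ 1 / 2 := by
    have h := ht.trans (min_le_left _ _)
    rw [le_div_iff₀ (by positivity)] at h
    linarith
  set B := s * b x + t * (-φ₀ x) with hB
  have hBabs : |B| ≤ 1 / 2 := by
    have h1 : |B| ≤ s * R₁ + |t| * R₀ := by
      refine (abs_add_le _ _).trans ?_
      rw [abs_mul, abs_mul, abs_neg, abs_of_nonneg hs0]
      gcongr
      · exact hR₁ x
      · exact hR₀ x
    have hm : max s |t| * R ≤ 1 / 2 := by
      rcases le_total s |t| with h | h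
      · rwa [max_eq_right h]
      · rwa [max_eq_left h]
    have h2 : s * R₁ + |t| * R₀ ≤ max s |t| * R := by
      calc s * R₁ + |t| * R₀ ≤ max s |t| * R₁ + max s |t| * R₀ := by
            gcongr
            · exact le_max_left _ _
            · exact le_max_right _ _
        _ ≤ max s |t| * R := by
            rw [hR]
            nlinarith [hs0.trans (le_max_left s |t|)]
    linarith
  obtain ⟨hB1, hB2⟩ := abs_le.1 hBabs
  -- Centred at `δ`, the correcting direction acts only through the factor `1 + B`; this is why `t`
  -- may have either sign.
  have hw : (1 + B) * ℓ + (s * a x + t * (δ * φ₀ x))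
      = δ + (1 + B) * (ℓ - δ) + s * (a x + δ * b x) := by
    rw [hB]
    ring
  rw [hw]
  have hgen : 0 ≤ a x + δ * b x → τ ≤ δ + (1 + B) * (ℓ - δ) + s * (a x + δ * b x) := by
    intro h
    have h1 := mul_nonneg hs0 h
    rcases le_total δ ℓ with h2 | h2
    · have := mul_nonneg (by linarith : 0 ≤ 1 + B) (sub_nonneg.2 h2)
      linarith [hτ.2]
    · nlinarith [hτ.2]
  rcases hab x hx ℓ hℓ with h | h
  · exact hgen h
  -- Where `ℓ ≥ c`, the surplus `(1 + B)(ℓ - δ) ≥ (c - δ)/2` pays for any decrease, which is at most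
  -- `s R`.
  · have h1 : -(s * R) ≤ s * (a x + δ * b x) := by
      have h3 := (abs_le.1 (hR₂ x)).1
      have h4 : -R ≤ a x + δ * b x := by linarith
      nlinarith
    have h2 : (c - δ) / 2 ≤ (1 + B) * (ℓ - δ) := by nlinarith
    linarith [hτ.2]

lemma trace_fderiv_eq_divergence (X : Amb n → Amb n) (x : Amb n) :
    LinearMap.trace ℝ (Amb n) (fderiv ℝ X x : Amb n →ₗ[ℝ] Amb n) = divergence X x := by
  rw [LinearMap.trace_eq_sum_inner _ (EuclideanSpace.basisFun (Fin (n + 1)) ℝ), divergence]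
  refine Finset.sum_congr rfl fun i _ => ?_
  rw [EuclideanSpace.basisFun_apply, EuclideanSpace.inner_single_left]
  simp

lemma jetVariation_neg (c κ : ℝ) (P : ℝ → ℝ) (z : ℝ) (g : Amb n) (j : Jet n) :
    jetVariation c κ P z g (-j) = -jetVariation c κ P z g j := by
  unfold jetVariation
  have h : inner ℝ g (jFactor n (-j) • g + z • jFactorGrad n (-j) + jShiftGrad n (-j)
      - jLin n (-j) g) = -inner ℝ g (jFactor n j • g + z • jFactorGrad n j + jShiftGrad n j
      - jLin n j g) := by
    rw [← inner_neg_right]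
    congr 1
    simp only [map_neg, neg_smul, smul_neg, neg_apply]
    abel
  have ht : LinearMap.trace ℝ (Amb n) (jLin n (-j) : Amb n →ₗ[ℝ] Amb n)
      = -LinearMap.trace ℝ (Amb n) (jLin n j : Amb n →ₗ[ℝ] Amb n) := by
    rw [map_neg (jLin n), ContinuousLinearMap.toLinearMap_neg, map_neg]
  rw [h, ht, map_neg, map_neg]
  ring

lemma jetField_neg (X : Amb n → Amb n) (a b : Amb n → ℝ) (x : Amb n) :
    jetField (fun x => -X x) (fun x => -a x) (fun x => -b x) x = -jetField X a b x := by
  unfold jetField gradient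
  rw [fderiv_fun_neg, fderiv_fun_neg, fderiv_fun_neg, map_neg, map_neg]
  rfl

lemma energyVar_neg (W : ℝ → ℝ) (Ω : Set (Amb n)) (ε : ℝ) (u : Amb n → ℝ) (G : Amb n → Amb n)
    (X : Amb n → Amb n) (a b : Amb n → ℝ) :
    energyVar W Ω ε u G (fun x => -X x) (fun x => -a x) (fun x => -b x)
      = -energyVar W Ω ε u G X a b := by
  unfold energyVar
  simp only [jetField_neg, jetVariation_neg, integral_neg]

lemma volVar_neg (W : ℝ → ℝ) (Ω : Set (Amb n)) (u : Amb n → ℝ) (G : Amb n → Amb n)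
    (X : Amb n → Amb n) (a b : Amb n → ℝ) :
    volVar W Ω u G (fun x => -X x) (fun x => -a x) (fun x => -b x)
      = -volVar W Ω u G X a b := by
  unfold volVar
  simp only [jetField_neg, jetVariation_neg, integral_neg]

lemma inner_gradient (a : Amb n → ℝ) (x g : Amb n) :
    inner ℝ g (gradient a x) = fderiv ℝ a x g := by
  rw [real_inner_comm, gradient, InnerProductSpace.toDual_symm_apply]

lemma energyVar_eq (hr : ∀ᵐ x ∂(volume.restrict Ω), u x ∈ Icc (0 : ℝ) 1) (ε : ℝ)
    (X : Amb n → Amb n) (a b : Amb n → ℝ) :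
    energyVar W Ω ε u G X a b = ∫ x in Ω,
      (2 * ε * (b x * ‖G x‖ ^ 2 + u x * fderiv ℝ b x (G x) + fderiv ℝ a x (G x))
        + deriv01 W (u x) / ε * (b x * u x + a x)
        + (acDensity W ε u G x * divergence X x
          - 2 * ε * inner ℝ (G x) (fderiv ℝ X x (G x)))) := by
  unfold energyVar
  refine integral_congr_ae ?_
  filter_upwards [hr] with x hx
  simp only [jetVariation, jetField, jLin_mk, jFactor_mk, jShift_mk, jFactorGrad_mk,
    jShiftGrad_mk, trace_fderiv_eq_divergence, inner_sub_right, inner_add_right,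
    inner_smul_right, inner_gradient, clamp_of_mem hx, acDensity, real_inner_self_eq_norm_sq]
  ring

lemma volVar_eq (hr : ∀ᵐ x ∂(volume.restrict Ω), u x ∈ Icc (0 : ℝ) 1)
    (X : Amb n → Amb n) (a b : Amb n → ℝ) :
    volVar W Ω u G X a b = ∫ x in Ω, (deriv01 (volPot n W) (u x) * (b x * u x + a x)
      + volPot n W (u x) * divergence X x) := by
  unfold volVar
  refine integral_congr_ae ?_
  filter_upwards [hr] with x hx
  simp only [jetVariation, jetField, jLin_mk, jFactor_mk, jShift_mk, jFactorGrad_mk,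
    jShiftGrad_mk, trace_fderiv_eq_divergence, clamp_of_mem hx]
  ring

/-- Existence of a Lagrange multiplier in the nondegenerate case. -/
lemma IsMinimizer.exists_multiplier (hn : 1 ≤ n) (hW : IsDoubleWell W) (hΩ : IsOpen Ω)
    {C : Set (UnitAddCircle → Amb n)} (hC : IsSpanningClass Ω C) {v ε δ : ℝ} (hv : 0 < v)
    (hε : 0 < ε) (hδ : δ ≤ 1) (hu : IsMinimizer W Ω C v ε δ u G) {φ₀ : Amb n → ℝ}
    (hφ₀ : IsTest Ω φ₀)
    (hne : volVar W Ω u G (fun _ => 0) (fun x => δ * φ₀ x) (fun x => -φ₀ x) ≠ 0) :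
    ∃ lam : ℝ, ∀ (X : Amb n → Amb n) (a b : Amb n → ℝ), IsTest Ω X → IsTest Ω a → IsTest Ω b →
      (∃ c > δ, ∀ x ∈ Ω, ∀ ℓ, HasApproxLim Ω u x ℓ → 0 ≤ a x + δ * b x ∨ c ≤ ℓ) →
      0 ≤ energyVar W Ω ε u G X a b - lam * volVar W Ω u G X a b := by
  refine ⟨energyVar W Ω ε u G (fun _ => 0) (fun x => δ * φ₀ x) (fun x => -φ₀ x)
    / volVar W Ω u G (fun _ => 0) (fun x => δ * φ₀ x) (fun x => -φ₀ x), fun X a b hX ha hb ⟨c, hc, hab⟩ => ?_⟩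
  exact hu.variation_nonneg hn hW hΩ hC hv hε hδ (hφ₀.const_mul δ) hφ₀.neg hne hX ha hb
    (exists_admissible hc hφ₀ ha hb hab)

end Multiplier

end ACPlateau

end

noncomputable section

namespace ACPlateau

/-! ### Euler–Lagrange equations in the nondegenerate case -/

section EulerLagrange

variable {n : ℕ} {Ω : Set (Amb n)} {u : Amb n → ℝ} {G : Amb n → Amb n} {W : ℝ → ℝ}

/-- Integrability is a by-product of the dominated differentiation, applied with the same jet field
in both slots. -/
lemma IsMinimizer.integrableOn_variation (hn : 1 ≤ n) (hW : IsDoubleWell W) (hΩ : IsOpen Ω)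
    {C : Set (UnitAddCircle → Amb n)} {v ε δ : ℝ} (hv : 0 < v) (hε : 0 < ε)
    (hu : IsMinimizer W Ω C v ε δ u G) {X : Amb n → Amb n} {a b : Amb n → ℝ}
    (hX : IsTest Ω X) (ha : IsTest Ω a) (hb : IsTest Ω b) :
    IntegrableOn (fun x => jetVariation ε ε⁻¹ W (u x) (G x) (jetField X a b x)) Ω ∧
      IntegrableOn (fun x => jetVariation 0 1 (volPot n W) (u x) (G x) (jetField X a b x)) Ω := by
  have hj := isJetField_jetField hX ha hb
  obtain ⟨-, -, -, -, h1, -⟩ := exists_hasFDerivAt_integral_jetDensity hΩ hu.competitor.sobolev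
    hu.competitor.range ε ε⁻¹ hW.isFlatPotential (hu.energy_density hW hΩ hε).1 hj hj
  obtain ⟨-, -, -, -, h2, -⟩ := exists_hasFDerivAt_integral_jetDensity hΩ hu.competitor.sobolev
    hu.competitor.range 0 1 (hW.isFlatPotential_volPot hn)
    (hu.volume_density hn hW hΩ hv).1 hj hj
  exact ⟨h1, h2⟩

/-- The first variation of the Lagrangian, without displacement. -/
lemma IsMinimizer.lagrangian_eq (hn : 1 ≤ n) (hW : IsDoubleWell W) (hΩ : IsOpen Ω)
    {C : Set (UnitAddCircle → Amb n)} {v ε δ : ℝ} (hv : 0 < v) (hε : 0 < ε)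
    (hu : IsMinimizer W Ω C v ε δ u G) (lam : ℝ) {a b : Amb n → ℝ}
    (ha : IsTest Ω a) (hb : IsTest Ω b) :
    IntegrableOn (fun x => 2 * ε * (b x * ‖G x‖ ^ 2 + u x * fderiv ℝ b x (G x)
        + fderiv ℝ a x (G x))
      + (deriv01 W (u x) / ε - lam * deriv01 (volPot n W) (u x)) * (b x * u x + a x)) Ω ∧
    energyVar W Ω ε u G (fun _ => 0) a b - lam * volVar W Ω u G (fun _ => 0) a b
      = ∫ x in Ω, (2 * ε * (b x * ‖G x‖ ^ 2 + u x * fderiv ℝ b x (G x) + fderiv ℝ a x (G x))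
      + (deriv01 W (u x) / ε - lam * deriv01 (volPot n W) (u x)) * (b x * u x + a x)) := by
  obtain ⟨h1, h2⟩ := hu.integrableOn_variation hn hW hΩ hv hε
    (isTest_zero (Ω := Ω) (F := Amb n)) ha hb
  have hae : (fun x => jetVariation ε ε⁻¹ W (u x) (G x) (jetField (fun _ => 0) a b x)
      - lam * jetVariation 0 1 (volPot n W) (u x) (G x) (jetField (fun _ => 0) a b x))
      =ᵐ[volume.restrict Ω] fun x => 2 * ε * (b x * ‖G x‖ ^ 2 + u x * fderiv ℝ b x (G x)
        + fderiv ℝ a x (G x))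
      + (deriv01 W (u x) / ε - lam * deriv01 (volPot n W) (u x)) * (b x * u x + a x) := by
    filter_upwards [hu.competitor.range] with x hx
    have h0 : fderiv ℝ (fun _ : Amb n => (0 : Amb n)) x = 0 := by simp
    have ht : LinearMap.trace ℝ (Amb n)
        ((0 : Amb n →L[ℝ] Amb n) : Amb n →ₗ[ℝ] Amb n) = 0 := by
      rw [ContinuousLinearMap.toLinearMap_zero, map_zero]
    simp only [jetVariation, jetField, jLin_mk, jFactor_mk, jShift_mk, jFactorGrad_mk,
      jShiftGrad_mk, inner_sub_right, inner_add_right,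
      inner_smul_right, inner_gradient, clamp_of_mem hx, real_inner_self_eq_norm_sq, h0, ht,
      zero_apply, inner_zero_right]
    ring
  have hi := h1.sub (h2.const_mul lam)
  refine ⟨hi.congr hae, ?_⟩
  rw [← integral_congr_ae hae, integral_sub h1 (h2.const_mul lam), integral_const_mul]
  rfl

lemma IsW12loc.integrableOn_fderiv_grad (hΩ : IsOpen Ω) (hu : IsW12loc Ω u G) {φ : Amb n → ℝ}
    (hφ : IsTest Ω φ) : IntegrableOn (fun x => fderiv ℝ φ x (G x)) Ω := by
  obtain ⟨R, hR⟩ := (hφ.compact.fderiv ℝ).exists_bound_of_continuous hφ.continuous_fderiv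
  have hc : Continuous fun q : Amb n × Amb n => fderiv ℝ φ q.1 q.2 :=
    (hφ.continuous_fderiv.comp continuous_fst).clm_apply continuous_snd
  have hm : AEStronglyMeasurable (fun x => fderiv ℝ φ x (G x)) (volume.restrict Ω) :=
    Continuous.comp_aestronglyMeasurable (g := fun q : Amb n × Amb n => fderiv ℝ φ q.1 q.2)
      (f := fun x => (x, G x)) hc
      (aestronglyMeasurable_id.prodMk (hu.aestronglyMeasurable_grad_restrict hΩ))
  refine (hu.integrable_indicator_grad hφ.compact.isCompact hφ.support R).restrict.mono' hm
    (Eventually.of_forall fun x => ?_)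
  by_cases hx : x ∈ tsupport φ
  · rw [indicator_of_mem hx]
    have hR0 : 0 ≤ R := (norm_nonneg _).trans (hR x)
    refine (ContinuousLinearMap.le_opNorm _ _).trans ?_
    have h1 : ‖G x‖ ≤ (1 + ‖G x‖) ^ 2 := by nlinarith [norm_nonneg (G x)]
    exact mul_le_mul (hR x) h1 (norm_nonneg _) hR0
  · rw [indicator_of_notMem hx, fderiv_eq_zero_of_notMem_tsupport hx]
    simp

lemma IsW12loc.integrableOn_sq_grad_mul (hu : IsW12loc Ω u G) {φ : Amb n → ℝ}
    (hφ : IsTest Ω φ) : IntegrableOn (fun x => ‖G x‖ ^ 2 * φ x) Ω := by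
  have h : IntegrableOn (fun x => ‖G x‖ ^ 2) (tsupport φ) :=
    (hu.memLp_grad _ hφ.support hφ.compact.isCompact).norm.integrable_sq
  exact (integrable_mul_of_support hφ.compact.isCompact h hφ.smooth.continuous
    fun x hx => image_eq_zero_of_notMem_tsupport hx).integrableOn

lemma IsW12loc.integrableOn_mul_test (hu : IsW12loc Ω u G) {φ : Amb n → ℝ}
    (hφ : IsTest Ω φ) : IntegrableOn (fun x => u x * φ x) Ω :=
  (integrable_mul_of_support hφ.compact.isCompact
    (hu.integrableOn hφ.compact.isCompact hφ.support) hφ.smooth.continuous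
    fun _ hx => image_eq_zero_of_notMem_tsupport hx).integrableOn

lemma IsW12loc.one_sub (hu : IsW12loc Ω u G) : IsW12loc Ω (fun x => 1 - u x) (fun x => -G x) := by
  have h := (isW12loc_smooth (Ω := Ω) (a := fun _ : Amb n => (1 : ℝ)) contDiff_const).add hu.neg
  rw [gradient_fun_const'] at h
  simpa [sub_eq_add_neg] using h

/-- The conclusions drawn from the first variation: the Euler–Lagrange equations and the two
differential inequalities for `u` and `1 - u`. -/
structure HasEulerLagrange (W : ℝ → ℝ) (Ω : Set (Amb n)) (ε δ : ℝ) (u : Amb n → ℝ)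
    (G : Amb n → Amb n) (lam K : ℝ) : Prop where
  inner : InnerEL W Ω ε lam u G
  outer : OuterEL W Ω ε δ lam u G
  super : ∀ φ, IsTest Ω φ → (∀ x, 0 ≤ φ x) →
    -∫ x in Ω, fderiv ℝ φ x (G x) ≤ K * ∫ x in Ω, u x * φ x
  sub : ∀ U ⊆ Ω, IsOpen U → ∀ c > δ, (∀ᵐ x ∂(volume.restrict U), c ≤ u x) →
    ∀ φ, IsTest U φ → (∀ x, 0 ≤ φ x) →
    ∫ x in Ω, fderiv ℝ φ x (G x) ≤ K * ∫ x in Ω, (1 - u x) * φ x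

/-- Directions with `a + δ b = 0` are admissible with both signs and give equations; `φ ≥ 0`, and
`-φ` supported where `u ≥ c > δ`, give inequalities. The linear vanishing of `W'` and `V'` at `0`
and at `1` turns the latter into linear differential inequalities. -/
lemma IsMinimizer.hasEulerLagrange_of_multiplier (hn : 1 ≤ n) (hW : IsDoubleWell W)
    (hΩ : IsOpen Ω) {C : Set (UnitAddCircle → Amb n)} {v ε δ : ℝ} (hv : 0 < v) (hε : 0 < ε)
    (hu : IsMinimizer W Ω C v ε δ u G) {lam : ℝ}
    (hlam : ∀ (X : Amb n → Amb n) (a b : Amb n → ℝ), IsTest Ω X → IsTest Ω a → IsTest Ω b →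
      (∃ c > δ, ∀ x ∈ Ω, ∀ ℓ, HasApproxLim Ω u x ℓ → 0 ≤ a x + δ * b x ∨ c ≤ ℓ) →
      0 ≤ energyVar W Ω ε u G X a b - lam * volVar W Ω u G X a b) :
    ∃ K, 0 ≤ K ∧ HasEulerLagrange W Ω ε δ u G lam K := by
  have hS := hu.competitor.sobolev
  have hr := hu.competitor.range
  have hz : IsTest Ω (fun _ : Amb n => (0 : ℝ)) := isTest_zero
  have hzX : IsTest Ω (fun _ : Amb n => (0 : Amb n)) := isTest_zero
  obtain ⟨M₁, hM₁0, hM₁⟩ := hW.isFlatPotential.bound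
  obtain ⟨M₂, hM₂0, hM₂⟩ := (hW.isFlatPotential_volPot hn).bound
  -- bilateral directions
  have heq : ∀ (X : Amb n → Amb n) (a b : Amb n → ℝ), IsTest Ω X → IsTest Ω a → IsTest Ω b →
      (∀ x, a x + δ * b x = 0) → energyVar W Ω ε u G X a b = lam * volVar W Ω u G X a b := by
    intro X a b hX ha hb hab
    -- The threshold `δ + 1` is a dummy: the first alternative holds everywhere.
    have h1 := hlam X a b hX ha hb ⟨δ + 1, by simp, fun x _ _ _ => Or.inl (hab x).ge⟩
    have h2 := hlam _ _ _ hX.neg ha.neg hb.neg ⟨δ + 1, by simp, fun x _ _ _ => Or.inl (by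
      linarith [hab x])⟩
    rw [energyVar_neg, volVar_neg] at h2
    linarith
  -- Chosen so that `|W'(z)/ε - lam V'(z)|` is at most `2 ε K` times the distance of `z` from either
  -- well.
  set K := (M₁ / ε + |lam| * M₂) / (2 * ε) with hK
  have hKbound : ∀ z ∈ Icc (0 : ℝ) 1,
      |deriv01 W z / ε - lam * deriv01 (volPot n W) z| ≤ 2 * ε * K * z ∧
      |deriv01 W z / ε - lam * deriv01 (volPot n W) z| ≤ 2 * ε * K * (1 - z) := by
    intro z hz
    have e : 2 * ε * K = M₁ / ε + |lam| * M₂ := by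
      rw [hK]
      field_simp
    have h0 : |deriv01 W z / ε - lam * deriv01 (volPot n W) z|
        ≤ |deriv01 W z| / ε + |lam| * |deriv01 (volPot n W) z| := by
      refine (abs_sub _ _).trans ?_
      rw [abs_div, abs_mul, abs_of_pos hε]
    have gen : ∀ y, |deriv01 W z| ≤ M₁ * y → |deriv01 (volPot n W) z| ≤ M₂ * y →
        |deriv01 W z| / ε + |lam| * |deriv01 (volPot n W) z| ≤ (M₁ / ε + |lam| * M₂) * y := by
      intro y h1 h2
      calc |deriv01 W z| / ε + |lam| * |deriv01 (volPot n W) z|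
          ≤ M₁ * y / ε + |lam| * (M₂ * y) := by gcongr
        _ = (M₁ / ε + |lam| * M₂) * y := by ring
    rw [e]
    exact ⟨h0.trans (gen z (hM₁ z hz).1 (hM₂ z hz).1),
      h0.trans (gen (1 - z) (hM₁ z hz).2 (hM₂ z hz).2)⟩
  have h1u := hS.one_sub
  -- unilateral directions
  have hone : ∀ φ, IsTest Ω φ →
      IntegrableOn (fun x => (deriv01 W (u x) / ε - lam * deriv01 (volPot n W) (u x)) * φ x) Ω ∧
      energyVar W Ω ε u G (fun _ => 0) φ (fun _ => 0) - lam * volVar W Ω u G (fun _ => 0) φ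
        (fun _ => 0) = 2 * ε * (∫ x in Ω, fderiv ℝ φ x (G x))
        + ∫ x in Ω, (deriv01 W (u x) / ε - lam * deriv01 (volPot n W) (u x)) * φ x := by
    intro φ hφ
    obtain ⟨hi, he⟩ := hu.lagrangian_eq hn hW hΩ hv hε lam hφ hz
    have hg := hS.integrableOn_fderiv_grad hΩ hφ
    have h0 : ∀ x, fderiv ℝ (fun _ : Amb n => (0 : ℝ)) x = 0 := fun x => by simp
    simp only [h0, zero_mul, zero_apply, mul_zero, zero_add, add_zero] at hi he
    have hi2 : IntegrableOn
        (fun x => (deriv01 W (u x) / ε - lam * deriv01 (volPot n W) (u x)) * φ x) Ω := by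
      refine (hi.sub (hg.const_mul (2 * ε))).congr (Eventually.of_forall fun x => ?_)
      simp
    refine ⟨hi2, ?_⟩
    rw [he, integral_add (hg.const_mul _) hi2, integral_const_mul]
  refine ⟨K, by positivity, ?_, ?_, ?_, ?_⟩
  · intro X hX
    have h := heq X _ _ hX hz hz (fun x => by simp)
    rw [energyVar_eq hr, volVar_eq hr] at h
    simpa using h
  -- The pair `a = δ φ`, `b = -φ` is the variation `u + φ (δ - u)`, which fixes the value `δ`.
  · intro φ hφ
    have h := heq _ _ _ hzX (hφ.const_mul δ) hφ.neg (fun x => by ring)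
    obtain ⟨hi, he⟩ := hu.lagrangian_eq hn hW hΩ hv hε lam (hφ.const_mul δ) hφ.neg
    rw [h, sub_self] at he
    have hG2 := (hS.integrableOn_sq_grad_mul hφ).const_mul (2 * ε)
    rw [← integral_const_mul, ← add_zero (∫ x in Ω, 2 * ε * (‖G x‖ ^ 2 * φ x)), he,
      ← integral_add hG2 hi]
    refine integral_congr_ae (Eventually.of_forall fun x => ?_)
    have hd1 : fderiv ℝ (fun x => δ * φ x) x (G x) = δ * fderiv ℝ φ x (G x) := by
      rw [((hφ.differentiable x).hasFDerivAt.const_mul δ).fderiv]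
      simp
    have hd2 : fderiv ℝ (fun x => -φ x) x (G x) = -fderiv ℝ φ x (G x) := by
      rw [fderiv_fun_neg]
      simp
    simp only [hd1, hd2]
    ring
  · intro φ hφ hφ0
    obtain ⟨hi, he⟩ := hone φ hφ
    have h := hlam _ φ _ hzX hφ hz ⟨δ + 1, by simp, fun x _ _ _ => Or.inl (by simpa using hφ0 x)⟩
    rw [he] at h
    have hle : ∫ x in Ω, (deriv01 W (u x) / ε - lam * deriv01 (volPot n W) (u x)) * φ x
        ≤ ∫ x in Ω, 2 * ε * K * (u x * φ x) := by
      refine integral_mono_ae hi ((hS.integrableOn_mul_test hφ).const_mul _) ?_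
      filter_upwards [hr] with x hx
      rw [← mul_assoc]
      exact mul_le_mul_of_nonneg_right ((le_abs_self _).trans (hKbound _ hx).1) (hφ0 x)
    rw [integral_const_mul] at hle
    have h2 : 0 ≤ 2 * ε * ((∫ x in Ω, fderiv ℝ φ x (G x)) + K * ∫ x in Ω, u x * φ x) := by
      linarith
    have := nonneg_of_mul_nonneg_right h2 (by positivity)
    linarith
  · intro U hUΩ hU c hc hae φ hφU hφ0
    have hφ := hφU.mono hUΩ
    obtain ⟨hi, he⟩ := hone _ hφ.neg
    have h := hlam _ _ _ hzX hφ.neg hz ⟨c, hc, fun x hx ℓ hℓ => by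
      -- In `U` the a.e. bound `u ≥ c` passes to approximate limits; outside `U` the direction
      -- vanishes.
      by_cases hxU : x ∈ U
      · exact Or.inr (hℓ.le_of_ae hΩ hU hx hxU hae)
      · left
        rw [hφU.eq_zero hxU]
        simp⟩
    rw [he] at h
    have hd : ∀ x, fderiv ℝ (fun x => -φ x) x (G x) = -fderiv ℝ φ x (G x) := fun x => by
      rw [fderiv_fun_neg]
      simp
    simp only [hd, integral_neg] at h
    have hle : ∫ x in Ω, (deriv01 W (u x) / ε - lam * deriv01 (volPot n W) (u x)) * -φ x
        ≤ ∫ x in Ω, 2 * ε * K * ((1 - u x) * φ x) := by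
      refine integral_mono_ae hi ((h1u.integrableOn_mul_test hφ).const_mul _) ?_
      filter_upwards [hr] with x hx
      rw [← mul_assoc, mul_neg, ← neg_mul]
      exact mul_le_mul_of_nonneg_right ((neg_le_abs _).trans (hKbound _ hx).2) (hφ0 x)
    rw [integral_const_mul] at hle
    have h2 : 0 ≤ 2 * ε * (-(∫ x in Ω, fderiv ℝ φ x (G x)) + K * ∫ x in Ω, (1 - u x) * φ x) := by
      linarith
    have := nonneg_of_mul_nonneg_right h2 (by positivity)
    linarith

end EulerLagrange

end ACPlateau

end

noncomputable section

namespace ACPlateau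

/-! ### The degenerate case -/

section Degenerate

variable {n : ℕ} {Ω : Set (Amb n)} {u : Amb n → ℝ} {G : Amb n → Amb n} {W : ℝ → ℝ}

lemma ae_eq_zero_of_test (hΩ : IsOpen Ω) {f : Amb n → ℝ}
    (hf : ∀ K ⊆ Ω, IsCompact K → IntegrableOn f K)
    (h : ∀ φ, IsTest Ω φ → ∫ x in Ω, f x * φ x = 0) : ∀ᵐ x ∂(volume.restrict Ω), f x = 0 := by
  rw [ae_restrict_iff' hΩ.measurableSet]
  refine hΩ.ae_eq_zero_of_integral_contDiff_smul_eq_zero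
    ((locallyIntegrableOn_iff hΩ.isLocallyClosed).2 hf) fun g hg hgc hgs => ?_
  have hφ : IsTest Ω g := ⟨hg, hgc, hgs⟩
  rw [← h g hφ, setIntegral_mul_test fun x hx => hφ.eq_zero hx]
  simp only [smul_eq_mul, mul_comm]

/-- A Sobolev function vanishing almost everywhere has vanishing gradient. -/
lemma IsW12loc.grad_eq_zero (hΩ : IsOpen Ω) (hu : IsW12loc Ω u G)
    (h0 : ∀ᵐ x ∂(volume.restrict Ω), u x = 0) : ∀ᵐ x ∂(volume.restrict Ω), G x = 0 := by
  have h : ∀ i, ∀ᵐ x ∂(volume.restrict Ω), inner ℝ (G x) (EuclideanSpace.single i (1 : ℝ)) = 0 := by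
    intro i
    refine ae_eq_zero_of_test hΩ (fun K hK hKc => hu.integrableOn_inner hKc hK _) fun φ hφ => ?_
    have h1 := hu.weak φ hφ (EuclideanSpace.single i 1)
    have h2 : ∫ x in Ω, u x * fderiv ℝ φ x (EuclideanSpace.single i 1) = 0 := by
      refine integral_eq_zero_of_ae ?_
      filter_upwards [h0] with x hx
      simp [hx]
    linarith
  filter_upwards [ae_all_iff.2 h] with x hx
  ext i
  simpa [EuclideanSpace.inner_single_right] using hx i

/-- The composition `F(u)` is zero a.e., so its weak gradient `F'(u) ∇u` is zero, and the factor
`F'(u)` can be cancelled. -/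
lemma IsW12loc.grad_eq_zero_of_comp (hΩ : IsOpen Ω) (hu : IsW12loc Ω u G) {F F' : ℝ → ℝ}
    (hF : ∀ t, HasDerivAt F (F' t) t) (hc : Continuous F') {M : ℝ} (hM : ∀ t, |F' t| ≤ M)
    (h0 : ∀ᵐ x ∂(volume.restrict Ω), F (u x) = 0 ∧ F' (u x) ≠ 0) :
    ∀ᵐ x ∂(volume.restrict Ω), G x = 0 := by
  have h := (hu.comp_contDiff hΩ hF hc hM).grad_eq_zero hΩ (h0.mono fun x hx => hx.1)
  filter_upwards [h, h0] with x hx hx0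
  exact (smul_eq_zero.1 hx).resolve_left hx0.2

/-- It suffices to have `F` with bounded derivative and simple zeros at `0`, `δ` and `1`. For `δ =
1` take `sin(πt)`; for `δ < 1` take `cos(πδ) - cos(π(2t - δ))`, whose derivative at these points is
`±2π sin(πδ) ≠ 0`. -/
lemma IsW12loc.grad_eq_zero_of_values (hΩ : IsOpen Ω) (hu : IsW12loc Ω u G) {δ : ℝ}
    (hδ0 : 0 < δ) (hδ1 : δ ≤ 1)
    (h : ∀ᵐ x ∂(volume.restrict Ω), u x = 0 ∨ u x = δ ∨ u x = 1) :
    ∀ᵐ x ∂(volume.restrict Ω), G x = 0 := by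
  have hπ := Real.pi_pos
  rcases hδ1.eq_or_lt with rfl | hδ
  · refine hu.grad_eq_zero_of_comp hΩ (F := fun t => Real.sin (t * Real.pi))
      (F' := fun t => Real.cos (t * Real.pi) * Real.pi) (M := Real.pi) (fun t => ?_)
      (by fun_prop) (fun t => ?_) ?_
    · have h1 : HasDerivAt (fun t : ℝ => t * Real.pi) Real.pi t := by
        simpa using (hasDerivAt_id t).mul_const Real.pi
      exact h1.sin
    · rw [abs_mul, abs_of_pos hπ]
      exact mul_le_of_le_one_left hπ.le (Real.abs_cos_le_one _)
    · filter_upwards [h] with x hx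
      rcases hx with hx | hx | hx <;> rw [hx] <;> simp
  · have hs : 0 < Real.sin (δ * Real.pi) :=
      Real.sin_pos_of_pos_of_lt_pi (by positivity) (by nlinarith)
    refine hu.grad_eq_zero_of_comp hΩ
      (F := fun t => Real.cos (δ * Real.pi) - Real.cos ((2 * t - δ) * Real.pi))
      (F' := fun t => Real.sin ((2 * t - δ) * Real.pi) * (2 * Real.pi)) (M := 2 * Real.pi)
      (fun t => ?_) (by fun_prop) (fun t => ?_) ?_
    · have h1 : HasDerivAt (fun t : ℝ => (2 * t - δ) * Real.pi) (2 * Real.pi) t := by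
        simpa using (((hasDerivAt_id t).const_mul 2).sub_const δ).mul_const Real.pi
      have h2 := h1.cos.const_sub (Real.cos (δ * Real.pi))
      refine h2.congr_deriv ?_
      ring
    · rw [abs_mul, abs_of_pos (by positivity : 0 < 2 * Real.pi)]
      exact mul_le_of_le_one_left (by positivity) (Real.abs_sin_le_one _)
    · filter_upwards [h] with x hx
      rcases hx with hx | hx | hx <;> rw [hx]
      · have e : (2 * 0 - δ) * Real.pi = -(δ * Real.pi) := by ring
        rw [e, Real.cos_neg, Real.sin_neg, sub_self]
        exact ⟨rfl, mul_ne_zero (neg_ne_zero.2 hs.ne') (by positivity)⟩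
      · have e : (2 * δ - δ) * Real.pi = δ * Real.pi := by ring
        rw [e, sub_self]
        exact ⟨rfl, mul_ne_zero hs.ne' (by positivity)⟩
      · have e : (2 * 1 - δ) * Real.pi = 2 * Real.pi - δ * Real.pi := by ring
        rw [e, Real.cos_two_pi_sub, Real.sin_two_pi_sub, sub_self]
        exact ⟨rfl, mul_ne_zero (neg_ne_zero.2 hs.ne') (by positivity)⟩

lemma IsTest.coord {X : Amb n → Amb n} (hX : IsTest Ω X) (i : Fin (n + 1)) :
    IsTest Ω fun x => X x i where
  smooth := (EuclideanSpace.proj (𝕜 := ℝ) i).contDiff.comp hX.smooth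
  compact := hX.compact.comp_left (g := fun y : Amb n => y i) rfl
  support := (tsupport_comp_subset (g := fun y : Amb n => y i) rfl X).trans hX.support

lemma fderiv_coord {X : Amb n → Amb n} (hX : Differentiable ℝ X) (i : Fin (n + 1)) (x e : Amb n) :
    fderiv ℝ (fun x => X x i) x e = fderiv ℝ X x e i := by
  have h : HasFDerivAt (fun x => X x i) _ x :=
    (EuclideanSpace.proj (𝕜 := ℝ) i).hasFDerivAt.comp x (hX x).hasFDerivAt
  rw [h.fderiv]
  rfl

lemma IsW12loc.integral_mul_divergence_eq_zero (hu : IsW12loc Ω u G)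
    (h0 : ∀ᵐ x ∂(volume.restrict Ω), G x = 0) {X : Amb n → Amb n} (hX : IsTest Ω X) :
    ∫ x in Ω, u x * divergence X x = 0 := by
  have hi : ∀ i, ∫ x in Ω, u x * fderiv ℝ X x (EuclideanSpace.single i 1) i = 0 := by
    intro i
    have h1 := hu.weak _ (hX.coord i) (EuclideanSpace.single i 1)
    simp only [fderiv_coord hX.differentiable] at h1
    rw [h1, neg_eq_zero]
    refine integral_eq_zero_of_ae ?_
    filter_upwards [h0] with x hx
    simp [hx]
  simp only [divergence, Finset.mul_sum]
  rw [integral_finsetSum]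
  · exact Finset.sum_eq_zero fun i _ => hi i
  · intro i _
    have := hu.integrableOn_mul_test ((hX.coord i).fderiv_apply (EuclideanSpace.single i 1))
    simp only [fderiv_coord hX.differentiable] at this
    exact this

/-- Since `V'(u)(δ - u) = 0` a.e., `u` takes only the values `0`, `δ`, `1`, and its gradient
vanishes. Minimality plays no further role: `(δ - u) W'(u) = 0` holds at each of the three values.
-/
lemma IsMinimizer.hasEulerLagrange_of_degenerate (hn : 1 ≤ n) (hW : IsDoubleWell W)
    (hΩ : IsOpen Ω) {C : Set (UnitAddCircle → Amb n)} {v ε δ : ℝ} (hδ0 : 0 < δ) (hδ1 : δ ≤ 1)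
    (hu : IsMinimizer W Ω C v ε δ u G)
    (hdeg : ∀ φ, IsTest Ω φ →
      volVar W Ω u G (fun _ => 0) (fun x => δ * φ x) (fun x => -φ x) = 0) :
    HasEulerLagrange W Ω ε δ u G 0 0 := by
  have hS := hu.competitor.sobolev
  have hr := hu.competitor.range
  have hWf := hW.isFlatPotential
  have hVf := hW.isFlatPotential_volPot hn
  have hvals : ∀ᵐ x ∂(volume.restrict Ω), u x = 0 ∨ u x = δ ∨ u x = 1 := by
    have h1 : ∀ᵐ x ∂(volume.restrict Ω), deriv01 (volPot n W) (clamp (u x)) * (δ - u x) = 0 := by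
      obtain ⟨M, hM0, hM⟩ := hVf.exists_deriv_le
      refine ae_eq_zero_of_test hΩ (fun K hK hKc => ?_) fun φ hφ => ?_
      · have hfin : IsFiniteMeasure (volume.restrict K) := ⟨by simpa using hKc.measure_lt_top⟩
        have hi : IntegrableOn (fun x => δ - u x) K :=
          (integrable_const δ).sub (hS.integrableOn hKc hK)
        exact hi.bdd_mul (c := M)
          (hVf.continuous_deriv.comp_aestronglyMeasurable (hS.aestronglyMeasurable hKc hK))
          (Eventually.of_forall fun x => hM _)
      · have h := hdeg φ hφ
        rw [volVar_eq hr] at h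
        rw [← h]
        refine integral_congr_ae ?_
        filter_upwards [hr] with x hx
        have hd : divergence (fun _ : Amb n => (0 : Amb n)) x = 0 := by simp [divergence]
        rw [clamp_of_mem hx, hd]
        ring
    filter_upwards [h1, hr] with x hx hxr
    rw [clamp_of_mem hxr] at hx
    rcases mul_eq_zero.1 hx with h | h
    · rcases hW.eq_zero_or_one_of_deriv01_volPot hn hxr h with h | h
      · exact Or.inl h
      · exact Or.inr (Or.inr h)
    · exact Or.inr (Or.inl (by linarith))
  have hG := hS.grad_eq_zero_of_values hΩ hδ0 hδ1 hvals
  have hGi : ∀ φ : Amb n → ℝ, ∫ x in Ω, fderiv ℝ φ x (G x) = 0 := by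
    intro φ
    refine integral_eq_zero_of_ae ?_
    filter_upwards [hG] with x hx
    simp [hx]
  refine ⟨?_, ?_, ?_, ?_⟩
  · intro X hX
    obtain ⟨M, -, hM⟩ := hWf.exists_deriv_le
    -- `W(u)` is a Sobolev function with zero gradient, so its integral against any divergence
    -- vanishes.
    have hWu := hS.comp_contDiff hΩ hWf.hasDerivAt hWf.continuous_deriv hM
    have h := hWu.integral_mul_divergence_eq_zero (by
      filter_upwards [hG] with x hx
      simp [hx]) hX
    rw [zero_mul, ← mul_zero ε⁻¹, ← h, ← integral_const_mul]
    refine integral_congr_ae ?_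
    filter_upwards [hG, hr] with x hx hxr
    simp only [hx, acDensity, clamp_of_mem hxr]
    simp
    ring
  · intro φ hφ
    have h1 : ∫ x in Ω, ‖G x‖ ^ 2 * φ x = 0 := by
      refine integral_eq_zero_of_ae ?_
      filter_upwards [hG] with x hx
      simp [hx]
    rw [h1, mul_zero, eq_comm]
    refine integral_eq_zero_of_ae ?_
    filter_upwards [hG, hvals] with x hx hv
    rcases hv with hv | hv | hv <;> simp [hx, hv, hWf.deriv_zero, hWf.deriv_one]
  · intro φ _ _
    rw [hGi]
    simp
  · intro U _ _ c _ _ φ _ _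
    rw [hGi]
    simp

/-- Minimizers satisfy the Euler–Lagrange equations. -/
theorem IsMinimizer.exists_hasEulerLagrange (hn : 1 ≤ n) (hW : IsDoubleWell W) (hΩ : IsOpen Ω)
    {C : Set (UnitAddCircle → Amb n)} (hC : IsSpanningClass Ω C) {v ε δ : ℝ} (hv : 0 < v)
    (hε : 0 < ε) (hδ0 : 0 < δ) (hδ1 : δ ≤ 1) (hu : IsMinimizer W Ω C v ε δ u G) :
    ∃ lam K, 0 ≤ K ∧ HasEulerLagrange W Ω ε δ u G lam K := by
  by_cases hdeg : ∀ φ, IsTest Ω φ →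
      volVar W Ω u G (fun _ => 0) (fun x => δ * φ x) (fun x => -φ x) = 0
  · exact ⟨0, 0, le_rfl, hu.hasEulerLagrange_of_degenerate hn hW hΩ hδ0 hδ1 hdeg⟩
  · push Not at hdeg
    obtain ⟨φ₀, hφ₀, hne⟩ := hdeg
    obtain ⟨lam, hlam⟩ := hu.exists_multiplier hn hW hΩ hC hv hε hδ1 hφ₀ hne
    exact ⟨lam, hu.hasEulerLagrange_of_multiplier hn hW hΩ hv hε hlam⟩

end Degenerate

end ACPlateau

end

noncomputable section

namespace ACPlateau

/-! ### Supersolutions -/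

section Supersolutions

variable {n : ℕ} {Ω : Set (Amb n)} {u : Amb n → ℝ} {G : Amb n → Amb n} {W : ℝ → ℝ}

/-- Testing with the partial derivatives of `φ` converts the gradient form of the first variation
into the form with the Laplacian used by `IsSupersol`. -/
lemma IsW12loc.integral_mul_lap (hu : IsW12loc Ω u G) {φ : Amb n → ℝ} (hφ : IsTest Ω φ) :
    ∫ x in Ω, u x * lap φ x = -∫ x in Ω, fderiv ℝ φ x (G x) := by
  have hsum : ∀ x, fderiv ℝ φ x (G x)
      = ∑ i, inner ℝ (G x) (ebasis n i) * fderiv ℝ φ x (ebasis n i) := by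
    intro x
    have h := (EuclideanSpace.basisFun (Fin (n + 1)) ℝ).sum_repr (G x)
    conv_lhs => rw [← h]
    rw [map_sum]
    refine Finset.sum_congr rfl fun i _ => ?_
    rw [map_smul, smul_eq_mul, inner_ebasis]
    simp [ebasis]
  simp only [lap, Finset.mul_sum, hsum]
  rw [integral_finsetSum, integral_finsetSum, ← Finset.sum_neg_distrib]
  · exact Finset.sum_congr rfl fun i _ => hu.weak _ (hφ.fderiv_apply (ebasis n i)) (ebasis n i)
  · intro i _
    have ht := hφ.fderiv_apply (ebasis n i)
    exact (integrable_mul_of_support ht.compact.isCompact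
      (hu.integrableOn_inner ht.compact.isCompact ht.support _) ht.smooth.continuous
      fun x hx => image_eq_zero_of_notMem_tsupport
        (f := fun x => fderiv ℝ φ x (ebasis n i)) hx).restrict
  · intro i _
    exact hu.integrableOn_mul_test ((hφ.fderiv_apply (ebasis n i)).fderiv_apply (ebasis n i))

lemma integral_indicator_mul (hΩ : IsOpen Ω) (f g : Amb n → ℝ) :
    ∫ x, Ω.indicator f x * g x = ∫ x in Ω, f x * g x := by
  rw [← integral_indicator hΩ.measurableSet]
  simp only [← indicator_mul_left]

/-- Extension by zero gives a globally measurable function with values in `[0,1]`, while test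
functions supported in `U ⊆ Ω` do not see the extension. -/
lemma isSupersol_indicator (hΩ : IsOpen Ω) {U : Set (Amb n)} (hU : U ⊆ Ω) (hu : IsW12loc Ω u G)
    (hr : ∀ᵐ x ∂(volume.restrict Ω), u x ∈ Icc (0 : ℝ) 1) {K : ℝ}
    (h : ∀ φ, IsTest U φ → (∀ x, 0 ≤ φ x) →
      -∫ x in Ω, fderiv ℝ φ x (G x) ≤ K * ∫ x in Ω, u x * φ x) :
    IsSupersol U (Ω.indicator u) K where
  meas := (aestronglyMeasurable_indicator_iff hΩ.measurableSet).2
    (hu.aestronglyMeasurable_restrict hΩ)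
  range := by
    rw [ae_restrict_iff' hΩ.measurableSet] at hr
    filter_upwards [hr] with x hx
    by_cases hxΩ : x ∈ Ω
    · rw [indicator_of_mem hxΩ]
      exact hx hxΩ
    · rw [indicator_of_notMem hxΩ]
      simp
  ineq φ hφ hφ0 := by
    rw [integral_indicator_mul hΩ, integral_indicator_mul hΩ, hu.integral_mul_lap (hφ.mono hU)]
    exact h φ hφ hφ0

end Supersolutions

end ACPlateau

end

/-! ### The main theorem. -/

theorem theorem1p3 (n : ℕ) (hn : 1 ≤ n) (W : ℝ → ℝ) (hW : ACPlateau.IsDoubleWell W)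
    (wire : Set (ACPlateau.Amb n)) (hwire : IsCompact wire)
    (Ω : Set (ACPlateau.Amb n)) (hΩ : Ω = wireᶜ)
    (C : Set (UnitAddCircle → ACPlateau.Amb n)) (hC : ACPlateau.IsSpanningClass Ω C)
    (v ε δ : ℝ) (hv : 0 < v) (hε : 0 < ε) (hδ : 1 / 2 < δ) (hδ1 : δ ≤ 1)
    (u : ACPlateau.Amb n → ℝ) (G : ACPlateau.Amb n → ACPlateau.Amb n)
    (hu : ACPlateau.IsMinimizer W Ω C v ε δ u G) :
    (∃ lam : ℝ, ACPlateau.InnerEL W Ω ε lam u G ∧ ACPlateau.OuterEL W Ω ε δ lam u G) ∧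
    -- the Lebesgue representative of `u`
    ∃ u' : ACPlateau.Amb n → ℝ,
      u' =ᵐ[volume.restrict Ω] u ∧
      (∀ x ∈ Ω, Tendsto (fun r : ℝ => ⨍ y in Metric.ball x r, u y) (𝓝[>] 0) (𝓝 (u' x))) ∧
      LowerSemicontinuousOn u' Ω ∧
      (∀ x ∈ Ω, (∀ y ∈ connectedComponentIn Ω x, u' y = 0) ∨
        ∀ y ∈ connectedComponentIn Ω x, 0 < u' y) ∧
      (δ < 1 → ∀ x ∈ Ω,
        (∀ y ∈ connectedComponentIn Ω x, u' y < 1) ∨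
        (Bornology.IsBounded (connectedComponentIn Ω x) ∧
          ∀ y ∈ connectedComponentIn Ω x, u' y = 1)) := by
  have hΩo : IsOpen Ω := by
    rw [hΩ]
    exact hwire.isClosed.isOpen_compl
  have hS := hu.competitor.sobolev
  have hr := hu.competitor.range
  obtain ⟨lam, K, hK, hEL⟩ := hu.exists_hasEulerLagrange hn hW hΩo hC hv hε (by linarith) hδ1
  have hsup : ACPlateau.IsSupersol Ω (Ω.indicator u) K :=
    ACPlateau.isSupersol_indicator hΩo subset_rfl hS hr hEL.super
  obtain ⟨u', ht, hae, hl, hr', hzero⟩ := hsup.exists_representative hΩo hK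
  have hae' : u' =ᵐ[volume.restrict Ω] u := by
    filter_upwards [hae, ae_restrict_mem hΩo.measurableSet] with x hx hxΩ
    rw [hx, indicator_of_mem hxΩ]
  refine ⟨⟨lam, hEL.inner, hEL.outer⟩, u', hae', fun x hx => ?_, hl, hzero, fun hδ' x hx => ?_⟩
  · obtain ⟨ρ, hρ, hsub⟩ := Metric.isOpen_iff.1 hΩo x hx
    refine (ht x hx).congr' ?_
    filter_upwards [Ioo_mem_nhdsGT hρ] with r hr
    rw [setAverage_eq, setAverage_eq]
    congr 1
    refine setIntegral_congr_fun Metric.isOpen_ball.measurableSet fun y hy => ?_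
    exact indicator_of_mem (hsub (Metric.ball_subset_ball hr.2.le hy)) u
  -- Any `c` strictly between `δ` and `1` serves: above `δ`, so that `u` may be lowered on `{u' >
  -- c}`, and below `1`, so that this open set contains `{u' = 1}`.
  · set c := (δ + 1) / 2 with hc
    have hUo := ACPlateau.lsc_isOpen hΩo hl c
    have hUsub : {x | x ∈ Ω ∧ c < u' x} ⊆ Ω := fun x hx => hx.1
    have hUae : ∀ᵐ x ∂(volume.restrict {x | x ∈ Ω ∧ c < u' x}), c ≤ u x := by
      filter_upwards [ae_restrict_of_ae_restrict_of_subset hUsub hae',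
        ae_restrict_mem hUo.measurableSet] with y hy hyU
      rw [← hy]
      exact hyU.2.le
    have hsup1 : ACPlateau.IsSupersol {x | x ∈ Ω ∧ c < u' x} (Ω.indicator fun x => 1 - u x) K := by
      refine ACPlateau.isSupersol_indicator hΩo hUsub hS.one_sub ?_ fun φ hφ hφ0 => ?_
      · filter_upwards [hr] with x hx
        exact ⟨by linarith [hx.2], by linarith [hx.1]⟩
      · have := hEL.sub _ hUsub hUo c (by linarith) hUae φ hφ hφ0
        simpa [integral_neg] using this
    have hloc : LocallyIntegrable (Ω.indicator u) := by
      refine LocallyIntegrable.mono (locallyIntegrable_const (1 : ℝ)) hsup.meas ?_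
      filter_upwards [hsup.range] with y hy
      rw [Real.norm_eq_abs, abs_of_nonneg hy.1]
      simpa using hy.2
    rcases ACPlateau.eq_one_of_supersol hΩo hloc (fun y hy => (hr' y hy).2) ht hae hl
      (by linarith : c < 1) (w := Ω.indicator fun x => 1 - u x)
      (fun y hy => by rw [indicator_of_mem hy, indicator_of_mem hy]) hK hsup1 x with h | h
    · exact Or.inl h
    · refine Or.inr ⟨?_, h⟩
      by_contra hb
      have hcompo : IsOpen (connectedComponentIn Ω x) := hΩo.connectedComponentIn
      have hcsub : connectedComponentIn Ω x ⊆ Ω := connectedComponentIn_subset Ω x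
      have htop : volume (connectedComponentIn Ω x) = ⊤ := by
        rw [hΩ] at hb ⊢
        exact ACPlateau.volume_component_eq_top hwire hb
      -- On the component `V(u) = V(1) = 1` a.e., so its volume is at most `v`.
      have hle : volume (connectedComponentIn Ω x)
          ≤ ∫⁻ y in Ω, ENNReal.ofReal (ACPlateau.volPot n W (u y)) := by
        rw [← setLIntegral_one]
        refine le_trans (lintegral_mono_ae ?_) (lintegral_mono_set hcsub)
        filter_upwards [ae_restrict_of_ae_restrict_of_subset hcsub hae',
          ae_restrict_mem hcompo.measurableSet] with y hy hyc
        rw [← hy, h y hyc, hW.volPot_one, ENNReal.ofReal_one]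
      rw [htop, hu.competitor.volume_eq] at hle
      exact ENNReal.ofReal_ne_top (top_le_iff.1 hle)
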